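/- Consider a single bosonic mode with canonical variables $x,p$, $[x,p]=i$, annihilation operator $a=(x+ip)/\sqrt2$, and vacuum vector $|0\rangle$. For $\alpha>0$ let $|\pm\alpha\rangle=e^{\pm\alpha(a^\dagger-a)}|0\rangle$ be the coherent states and $\rho_0=|{+\alpha}\rangle\langle{+\alpha}|$, $\rho_1=|{-\alpha}\rangle\langle{-\alpha}|$. For states $\sigma_0,\sigma_1$ of $n$ modes and a set $\mathbb M$ of binary measurements $(M,1-M)$, $0\le M\le 1$, let $P_e(M)=\tfrac12\operatorname{tr}\sigma_0(1-M)+\tfrac12\operatorname{tr}\sigma_1M$, and define $\|\sigma_0-\sigma_1\|_{\mathbb M}$ by $\inf_{(M,1-M)\in\mathbb M}P_e(M)=\tfrac12\bigl(1-\tfrac12\|\sigma_0-\sigma_1\|_{\mathbb M}\bigr)$. Two sets are considered. (i) GOCC: the binary POVMs implemented by finitely many rounds, each of which consists of adjoining modes in the vacuum, applying a Gaussian unitary, and homodyning some of the modes, where the choices in each round depend (measurably) on all previous outcomes, all modes are measured after the last round, and the decision is a function of all outcomes; together with the limits of such POVMs in the strong operator topology. (ii) W+: the binary POVMs $(M,1-M)$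 for which $M$ and $1-M$ both have a non-negative Wigner function. For $d=\|\cdot\|_1$, $\|\cdot\|_{\mathrm{GOCC}}$, $\|\cdot\|_{\mathrm{W+}}$, the Chernoff coefficients $\xi$, $\xi_{\mathrm{GOCC}}$, $\xi_{\mathrm{W+}}$ are the limits $\lim_{n\to\infty}-\tfrac1n\ln\bigl(1-\tfrac12\,d(\rho_0^{\otimes n}-\rho_1^{\otimes n})\bigr)$. Write $F(\rho,\sigma)=\|\sqrt\rho\sqrt\sigma\|_1$ and $\operatorname{erf}(x)=\frac2{\sqrt\pi}\int_0^xe^{-t^2}\,dt$. Then $$\tfrac12\|\rho_0-\rho_1\|_1=\sqrt{1-e^{-4\alpha^2}},\qquad \tfrac12\|\rho_0-\rho_1\|_{\mathrm{GOCC}}=\tfrac12\|\rho_0-\rho_1\|_{\mathrm{W+}}=\operatorname{erf}(\alpha\sqrt2),$$ and the last two are attained by the measurement (which is both GOCC and W+) that homodynes the $x$-quadrature and decides for $\rho_0$ iff the outcome is positive: its error probability is $\tfrac12(1-\operatorname{erf}(\alpha\sqrt2))$. Moreover the limits defining the three Chernoff coefficients exist, and $$\xi(\rho_0,\rho_1)=-\ln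 F(\rho_0,\rho_1)^2=4|\alpha|^2,\qquad \xi_{\mathrm{GOCC}}(\rho_0,\rho_1)=\xi_{\mathrm{W+}}(\rho_0,\rho_1)=2|\alpha|^2,$$ where the last two exponents are attained by homodyning each of the $n$ modes separately in the $x$-direction, followed by classical post-processing of the outcomes. -/

import Mathlib

open MeasureTheory Filter Topology
open scoped ENNReal InnerProductSpace

noncomputable section

namespace Bosonic

/-! ### Operators on a Hilbert space: trace, trace norm, fidelity, hypothesis testing -/

section Operators

variable {E : Type*} [NormedAddCommGroup E] [InnerProductSpace ℂ E] [CompleteSpace E]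

/-- An index set of a Hilbert basis of `E`. -/
def basisSet (E : Type*) [NormedAddCommGroup E] [InnerProductSpace ℂ E] [CompleteSpace E] :
    Set E :=
  (exists_hilbertBasis ℂ E).choose

/-- A Hilbert basis of `E`. -/
def basis (E : Type*) [NormedAddCommGroup E] [InnerProductSpace ℂ E] [CompleteSpace E] :
    HilbertBasis (basisSet E) ℂ E :=
  (exists_hilbertBasis ℂ E).choose_spec.choose

/-- The trace `∑ᵢ ⟨eᵢ, T eᵢ⟩` of a trace class operator `T`
(for trace class operators it does not depend on the Hilbert basis). -/
def tr (T : E →L[ℂ] E) : ℂ :=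
  ∑' i, ⟪basis E i, T (basis E i)⟫_ℂ

/-- The trace norm `‖T‖₁ = tr |T|`, with `|T| = √(T† T)`, of a trace class operator `T`. -/
def traceNorm (T : E →L[ℂ] E) : ℝ :=
  (tr (CFC.abs T)).re

/-- The fidelity `F(ρ, σ) = ‖√ρ √σ‖₁`. -/
def fidelity (ρ σ : E →L[ℂ] E) : ℝ :=
  traceNorm (CFC.sqrt ρ * CFC.sqrt σ)

/-- The operator `|φ⟩⟨ψ|`. -/
def ketBra (φ ψ : E) : E →L[ℂ] E :=
  InnerProductSpace.rankOne ℂ φ ψ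

/-- The pure state `|ψ⟩⟨ψ|`. -/
def pureState (ψ : E) : E →L[ℂ] E :=
  ketBra ψ ψ

/-- The error probability `½ tr ρ₀(1 - M) + ½ tr ρ₁ M` of the binary measurement `(M, 1 - M)`
for two equiprobable hypotheses `ρ₀`, `ρ₁`. -/
def errorProb (ρ₀ ρ₁ M : E →L[ℂ] E) : ℝ :=
  1 / 2 * (tr (ρ₀ * (1 - M))).re + 1 / 2 * (tr (ρ₁ * M)).re

/-- The distinguishability norm `‖ρ₀ - ρ₁‖_𝕄` of two states under a restricted set `𝕄` of binary
measurements `(M, 1 - M)` (represented by their first element), defined through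
`inf_{M ∈ 𝕄} Pₑ = ½ (1 - ½ ‖ρ₀ - ρ₁‖_𝕄)`. -/
def restrictedNorm (𝕄 : Set (E →L[ℂ] E)) (ρ₀ ρ₁ : E →L[ℂ] E) : ℝ :=
  2 * (1 - 2 * sInf (errorProb ρ₀ ρ₁ '' 𝕄))

end Operators

/-! ### The Schrödinger representation of `m` bosonic modes -/

/-- The Hilbert space `L²(ℝᵐ)` of `m` modes. -/
abbrev Modes (m : ℕ) : Type :=
  Lp ℂ 2 (volume : Measure (Fin m → ℝ))

/-- Multiplication by a measurable function bounded by one, as an operator on `L²(ℝᵐ)`. -/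
def mulOp {m : ℕ} (g : (Fin m → ℝ) → ℂ) (hg : Measurable g) (hb : ∀ y, ‖g y‖ ≤ 1) :
    Modes m →L[ℂ] Modes m :=
  have hmem : ∀ f : Modes m, MemLp (fun y => g y * f y) 2 volume := fun f =>
    (Lp.memLp f).of_le (hg.aestronglyMeasurable.mul (Lp.memLp f).1)
      (Eventually.of_forall fun y => by
        rw [norm_mul]
        exact mul_le_of_le_one_left (norm_nonneg _) (hb y))
  LinearMap.mkContinuous
    { toFun := fun f => (hmem f).toLp _
      map_add' := fun f₁ f₂ => by
        apply Lp.ext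
        filter_upwards [(hmem (f₁ + f₂)).coeFn_toLp, (hmem f₁).coeFn_toLp, (hmem f₂).coeFn_toLp,
          Lp.coeFn_add f₁ f₂, Lp.coeFn_add ((hmem f₁).toLp _) ((hmem f₂).toLp _)]
          with y h₁ h₂ h₃ h₄ h₅
        rw [h₁, h₅, Pi.add_apply, h₂, h₃, h₄, Pi.add_apply, mul_add]
      map_smul' := fun c f => by
        apply Lp.ext
        filter_upwards [(hmem (c • f)).coeFn_toLp, (hmem f).coeFn_toLp,
          Lp.coeFn_smul c f, Lp.coeFn_smul c ((hmem f).toLp _)] with y h₁ h₂ h₃ h₄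
        rw [h₁, RingHom.id_apply, h₄, Pi.smul_apply, h₂, h₃, Pi.smul_apply, smul_eq_mul,
          smul_eq_mul, mul_left_comm] }
    1
    (fun f => by
      rw [one_mul]
      refine Lp.norm_le_norm_of_ae_le ?_
      filter_upwards [(hmem f).coeFn_toLp] with y hy
      change ‖((hmem f).toLp _ : Modes m) y‖ ≤ _
      rw [hy, norm_mul]
      exact mul_le_of_le_one_left (norm_nonneg _) (hb y))

/-- Translation `f ↦ f(· - x)` on `L²(ℝᵐ)`. -/
def translation {m : ℕ} (x : Fin m → ℝ) : Modes m →L[ℂ] Modes m :=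
  (Lp.compMeasurePreservingₗᵢ ℂ (fun y : Fin m → ℝ => y - x)
    (measurePreserving_sub_right volume x)).toContinuousLinearMap

/-- The parity operator `(-1)^{N₁ + ⋯ + Nₘ}`, that is `f ↦ f(-·)` on `L²(ℝᵐ)`. -/
def parity (m : ℕ) : Modes m →L[ℂ] Modes m :=
  (Lp.compMeasurePreservingₗᵢ ℂ (fun y : Fin m → ℝ => -y)
    (Measure.measurePreserving_neg volume)).toContinuousLinearMap

/-- The phase `exp(i p·y - i x·p / 2)` occurring in the displacement operator. -/
def weylPhase {m : ℕ} (x p y : Fin m → ℝ) : ℂ :=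
  Complex.exp (((∑ j, p j * y j - 1 / 2 * ∑ j, x j * p j : ℝ) : ℂ) * Complex.I)

lemma measurable_weylPhase {m : ℕ} (x p : Fin m → ℝ) : Measurable (weylPhase x p) := by
  unfold weylPhase
  fun_prop

lemma norm_weylPhase_le {m : ℕ} (x p y : Fin m → ℝ) : ‖weylPhase x p y‖ ≤ 1 :=
  (Complex.norm_exp_ofReal_mul_I _).le

/-- The displacement operator `D(α) = exp(∑ⱼ αⱼ aⱼ† - ᾱⱼ aⱼ)`, where `aⱼ = (xⱼ + i pⱼ)/√2` and
`pⱼ = -i ∂ⱼ`. With `αⱼ = (xⱼ + i pⱼ)/√2` this is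
`(D(α) f)(y) = exp(i p·y - i x·p / 2) f(y - x)`. -/
def displacement {m : ℕ} (α : Fin m → ℂ) : Modes m →L[ℂ] Modes m :=
  mulOp (weylPhase (fun j => √2 * (α j).re) (fun j => √2 * (α j).im))
      (measurable_weylPhase _ _) (norm_weylPhase_le _ _) ∘L
    translation (fun j => √2 * (α j).re)

/-- The wave function `π^{-m/4} exp(-|y|²/2)` of the `m`-mode vacuum. -/
def vacuumFun (m : ℕ) (y : Fin m → ℝ) : ℂ :=
  ∏ j, ((Real.pi ^ (-(1 / 4) : ℝ) * Real.exp (-(y j) ^ 2 / 2) : ℝ) : ℂ)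

lemma memLp_vacuumFun (m : ℕ) : MemLp (vacuumFun m) 2 volume := by
  have hmeas : AEStronglyMeasurable (vacuumFun m) volume := by
    unfold vacuumFun
    exact (Continuous.aestronglyMeasurable (by fun_prop))
  rw [memLp_two_iff_integrable_sq_norm hmeas]
  have h1 : Integrable (fun t : ℝ =>
      (Real.pi ^ (-(1 / 4) : ℝ) * Real.exp (-t ^ 2 / 2)) ^ 2) volume := by
    have := (integrable_exp_neg_mul_sq (b := 1) one_pos).const_mul ((Real.pi ^ (-(1 / 4) : ℝ)) ^ 2)
    refine this.congr (Eventually.of_forall fun t => ?_)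
    simp only
    rw [mul_pow, ← Real.exp_nat_mul]
    congr 2
    push_cast
    ring
  have h2 := Integrable.fintype_prod (ι := Fin m) (E := ℝ) (𝕜 := ℝ)
    (μ := fun _ => (volume : Measure ℝ)) (f := fun _ (t : ℝ) =>
      (Real.pi ^ (-(1 / 4) : ℝ) * Real.exp (-t ^ 2 / 2)) ^ 2) (fun _ => h1)
  refine h2.congr (Eventually.of_forall fun y => ?_)
  simp only [vacuumFun, norm_prod, Complex.norm_real, Real.norm_eq_abs]
  rw [← Finset.prod_pow]
  exact Finset.prod_congr rfl fun j _ => (sq_abs _).symm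

/-- The `m`-mode vacuum vector `|0⟩`. -/
def vacuum (m : ℕ) : Modes m :=
  (memLp_vacuumFun m).toLp _

/-- The `m`-mode coherent vector `|α⟩ = D(α)|0⟩`. -/
def coherent {m : ℕ} (α : Fin m → ℂ) : Modes m :=
  displacement α (vacuum m)

/-! ### Splitting and joining modes -/

section Joining

variable {m k n : ℕ}

/-- The first `m` out of `n = m + k` coordinates. -/
def headModes (h : m + k = n) (y : Fin n → ℝ) : Fin m → ℝ :=
  fun i => y (Fin.cast h (Fin.castAdd k i))

/-- The last `k` out of `n = m + k` coordinates. -/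
def tailModes (h : m + k = n) (y : Fin n → ℝ) : Fin k → ℝ :=
  fun i => y (Fin.cast h (Fin.natAdd m i))

/-- Concatenation of `m` and `k` coordinates to `n = m + k` coordinates. -/
def joinModes (h : m + k = n) (u : Fin m → ℝ) (v : Fin k → ℝ) : Fin n → ℝ :=
  fun i => Fin.append u v (Fin.cast h.symm i)

lemma measurePreserving_split (h : m + k = n) :
    MeasurePreserving (fun y : Fin n → ℝ => (headModes h y, tailModes h y)) := by
  subst h
  have h1 := (volume_measurePreserving_piCongrLeft (fun _ : Fin (m + k) => ℝ)
    (finSumFinEquiv (m := m) (n := k))).symm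
  have h2 := volume_measurePreserving_sumPiEquivProdPi (fun _ : Fin m ⊕ Fin k => ℝ)
  exact h2.comp h1

lemma memLp_tensor (h : m + k = n) (f : Modes m) (g : Modes k) :
    MemLp (fun y => f (headModes h y) * g (tailModes h y)) 2 volume := by
  have hmp := measurePreserving_split h
  have key : MemLp (fun z : (Fin m → ℝ) × (Fin k → ℝ) => f z.1 * g z.2) 2 volume := by
    have hm : AEStronglyMeasurable (fun z : (Fin m → ℝ) × (Fin k → ℝ) => f z.1 * g z.2)
        volume :=
      (((Lp.stronglyMeasurable f).comp_measurable measurable_fst).mul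
        ((Lp.stronglyMeasurable g).comp_measurable measurable_snd)).aestronglyMeasurable
    rw [memLp_two_iff_integrable_sq_norm hm]
    have hf := (memLp_two_iff_integrable_sq_norm (Lp.memLp f).1).1 (Lp.memLp f)
    have hg := (memLp_two_iff_integrable_sq_norm (Lp.memLp g).1).1 (Lp.memLp g)
    refine (hf.mul_prod hg).congr (Eventually.of_forall fun z => ?_)
    simp only [norm_mul, mul_pow]
  exact key.comp_measurePreserving hmp

/-- The tensor product `f ⊗ g` of an `m`-mode and a `k`-mode vector. -/
def tensor (h : m + k = n) (f : Modes m) (g : Modes k) : Modes n :=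
  (memLp_tensor h f g).toLp _

open Classical in
/-- Homodyne detection (of the position quadratures) of the last `k` modes with outcome `x` leaves
the remaining `m` modes in the unnormalised state `(⟨x| on the last modes) φ`, that is
`φ(·, x) ∈ L²(ℝᵐ)`; it is defined for almost all `x`, and its squared norm is the probability
density of the outcome. -/
def slice (h : m + k = n) (φ : Modes n) (x : Fin k → ℝ) : Modes m :=
  if hφ : MemLp (fun u => φ (joinModes h u x)) 2 volume then hφ.toLp _ else 0

end Joining

/-- The `n`-fold tensor power `ψ ⊗ ⋯ ⊗ ψ` of a single-mode vector. For the pure state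
`ρ = |ψ⟩⟨ψ|` the state `ρ^{⊗n}` is the pure state of this vector. -/
def tensorPower (ψ : Modes 1) : (n : ℕ) → Modes n
  | 0 => vacuum 0
  | n + 1 => tensor rfl (tensorPower ψ n) ψ

/-! ### Gaussian unitaries and GOCC measurements -/

/-- A unitary on `n` modes is Gaussian if conjugation by it acts on the canonical variables by an
affine linear map, i.e. if `U D(α) U† = exp(i λ(α)) D(S α)` for a real-linear map `S` of phase space
(symplectic, as follows from the Weyl relations) and a real-linear functional `λ`. -/
def IsGaussianUnitary {n : ℕ} (U : Modes n ≃ₗᵢ[ℂ] Modes n) : Prop :=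
  ∃ (S : (Fin n → ℂ) →ₗ[ℝ] (Fin n → ℂ)) (lam : (Fin n → ℂ) →ₗ[ℝ] ℝ),
    ∀ (α : Fin n → ℂ) (ψ : Modes n),
      U (displacement α ψ) = Complex.exp ((lam α : ℂ) * Complex.I) • displacement (S α) (U ψ)

/-- `GOCCProtocol R m M`: the POVM `M = (M ω)` on `m` modes is implemented by a protocol of `R`
rounds of Gaussian operations and classical computation.

A round creates `k` modes in the vacuum, applies a Gaussian unitary `U` to the `n = m + k` modes,
and performs homodyne detection on the last `l` of them; depending on the outcome `x ∈ ℝˡ`, the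
protocol is continued on the remaining `m'` modes by a protocol with `R` further rounds and POVM
`N x`. (So `k`, `U`, `l` of each round depend on all previous outcomes; the dependence on the
outcomes is measurable in the sense that all resulting outcome probabilities are.) After the last
round no mode is left, and the final outcome `ω₀`, a function of all measurement outcomes, is
announced. -/
inductive GOCCProtocol {Ω : Type} [DecidableEq Ω] :
    ℕ → (m : ℕ) → (Ω → Modes m →L[ℂ] Modes m) → Prop
  | announce (ω₀ : Ω) : GOCCProtocol 0 0 (fun ω => if ω = ω₀ then 1 else 0)
  | round {R m k n m' l : ℕ} (h : m + k = n) (h' : m' + l = n)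
      (U : Modes n ≃ₗᵢ[ℂ] Modes n) (hU : IsGaussianUnitary U)
      (N : (Fin l → ℝ) → Ω → Modes m' →L[ℂ] Modes m')
      (hN : ∀ x, GOCCProtocol R m' (N x))
      (hmeas : ∀ (ω : Ω) (φ : Modes m'), Measurable fun x => ⟪φ, N x ω φ⟫_ℂ)
      (M : Ω → Modes m →L[ℂ] Modes m)
      (hM : ∀ (ω : Ω) (ψ : Modes m), ⟪ψ, M ω ψ⟫_ℂ =
        ∫ x, ⟪slice h' (U (tensor h ψ (vacuum k))) x,
          N x ω (slice h' (U (tensor h ψ (vacuum k))) x)⟫_ℂ) :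
      GOCCProtocol (R + 1) m M

/-- A GOCC POVM is a POVM implemented by a GOCC protocol (with finitely many rounds), or a limit of
such POVMs in the strong operator topology. -/
def IsGOCCPOVM {Ω : Type} [DecidableEq Ω] {m : ℕ} (M : Ω → Modes m →L[ℂ] Modes m) : Prop :=
  (fun ω ψ => M ω ψ) ∈ closure
    {T : Ω → Modes m → Modes m | ∃ (R : ℕ) (M' : Ω → Modes m →L[ℂ] Modes m),
      GOCCProtocol R m M' ∧ T = fun ω ψ => M' ω ψ}

/-- The binary GOCC measurements `(M, 1 - M)` on `m` modes. -/
def GOCC (m : ℕ) : Set (Modes m →L[ℂ] Modes m) :=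
  {M | IsGOCCPOVM ![M, 1 - M]}

/-! ### Wigner functions and W+ measurements -/

/-- The phase space coordinates `αⱼ = (xⱼ + i pⱼ)/√2`. -/
def phasePoint {m : ℕ} (z : (Fin m → ℝ) × (Fin m → ℝ)) : Fin m → ℂ :=
  fun j => ((z.1 j : ℂ) + (z.2 j : ℂ) * Complex.I) / (√2 : ℝ)

/-- The Wigner function `W_T(x, p) = π^{-m} tr T D(α) (-1)^{N₁ + ⋯ + Nₘ} D(α)†` of a trace class
operator `T`, with `αⱼ = (xⱼ + i pⱼ)/√2`. -/
def wigner {m : ℕ} (T : Modes m →L[ℂ] Modes m) (z : (Fin m → ℝ) × (Fin m → ℝ)) : ℂ :=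
  ((Real.pi ^ m)⁻¹ : ℝ) * tr (T * displacement (phasePoint z) * parity m *
    star (displacement (phasePoint z)))

/-- `W` is the Wigner function of the bounded self-adjoint operator `M`, by duality with the Wigner
functions of trace class operators: `tr M T = (2π)^m ∫ W(x,p) W_T(x,p) dx dp` for all
`T = |β⟩⟨γ|` with coherent vectors `|β⟩`, `|γ⟩`. The linear span of these `T` is dense in the trace
class, and this condition determines `M` from `W` and conversely `W` (up to null sets) from `M`. -/
def IsWignerFunction {m : ℕ} (M : Modes m →L[ℂ] Modes m)
    (W : (Fin m → ℝ) × (Fin m → ℝ) → ℝ) : Prop :=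
  Measurable W ∧ ∀ β γ : Fin m → ℂ,
    Integrable (fun z => (W z : ℂ) * wigner (ketBra (coherent β) (coherent γ)) z) ∧
    tr (M * ketBra (coherent β) (coherent γ)) =
      (2 * Real.pi : ℂ) ^ m * ∫ z, (W z : ℂ) * wigner (ketBra (coherent β) (coherent γ)) z

/-- The binary POVMs `(M, 1 - M)` on `m` modes such that both elements have a non-negative Wigner
function. -/
def WPlus (m : ℕ) : Set (Modes m →L[ℂ] Modes m) :=
  {M | 0 ≤ M ∧ M ≤ 1 ∧ ∃ W W' : (Fin m → ℝ) × (Fin m → ℝ) → ℝ,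
    IsWignerFunction M W ∧ IsWignerFunction (1 - M) W' ∧ (∀ z, 0 ≤ W z) ∧ (∀ z, 0 ≤ W' z)}

/-! ### Homodyne decisions, Chernoff coefficients, the error function -/

open Classical in
/-- The binary measurement `(M, 1 - M)` which homodynes the `x`-quadrature of every one of the `m`
modes and decides for the first hypothesis iff the outcome lies in `A ⊆ ℝᵐ`: here `M` is the
spectral projection of the position operators, i.e. multiplication by the indicator function
of `A`. -/
def homodyneTest {m : ℕ} (A : Set (Fin m → ℝ)) (hA : MeasurableSet A) : Modes m →L[ℂ] Modes m :=
  mulOp (fun y => if y ∈ A then 1 else 0) (Measurable.ite hA measurable_const measurable_const)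
    (fun y => by split_ifs <;> simp)

/-- `ξ = lim_{n → ∞} -(1/n) ln (1 - ½ dₙ(ρ₀^{⊗n}, ρ₁^{⊗n}))` for the single-mode pure states
`ρ₀ = |ψ₀⟩⟨ψ₀|` and `ρ₁ = |ψ₁⟩⟨ψ₁|`, where `dₙ` is the norm distance that belongs to the admitted
measurements on `n` modes. -/
def IsChernoffCoefficient
    (d : (n : ℕ) → (Modes n →L[ℂ] Modes n) → (Modes n →L[ℂ] Modes n) → ℝ)
    (ψ₀ ψ₁ : Modes 1) (ξ : ℝ) : Prop :=
  Tendsto (fun n : ℕ => -(1 / (n : ℝ)) * Real.log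
    (1 - 1 / 2 * d n (pureState (tensorPower ψ₀ n)) (pureState (tensorPower ψ₁ n))))
    atTop (𝓝 ξ)

/-- The error function `erf x = (2/√π) ∫₀ˣ exp(-t²) dt`. -/
def erf (x : ℝ) : ℝ :=
  2 / √Real.pi * ∫ t in (0 : ℝ)..x, Real.exp (-t ^ 2)

end Bosonic

end

open MeasureTheory Filter Topology
open scoped ENNReal InnerProductSpace

noncomputable section

namespace Bosonic

section

/-! ### Rank-one operators: traces, fidelity and trace distance of pure states -/

section Operators

variable {E : Type*} [NormedAddCommGroup E] [InnerProductSpace ℂ E] [CompleteSpace E]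

/-! Coherent states have positive Gaussian Wigner functions, and the restricted measurements can do
no better than classical tests on these phase space densities. For `|±α⟩^{⊗n}` the densities differ
only in the position factors, and their likelihood ratio is an increasing function of the sum of the
positions. The best classical test therefore looks at the sign of that sum, which homodyning
realises as both a GOCC and a W+ measurement. So both infima equal half the integral of the
pointwise minimum `min w₀ w₁`, which a one-dimensional Gaussian computation turns into `½ (1 - erf
(α √2 √n))`.

For W+, the Wigner functions `W`, `W'` of `M`, `1 - M` add up to the constant `(2π)^{-n}` almost
everywhere, by uniqueness of Wigner functions. Twice the error is `(2π)^n ∫ (W' w₀ + W w₁)`, which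
is at least `∫ min w₀ w₁` because `W, W' ≥ 0` (`integral_le_of_mem_WPlus`).

For GOCC, the proof is an induction over rounds (`GOCCProtocol.integral_le`): if `v ≤ w₀` and `v ≤
w₁`, then `∫ v` is at most twice the error. Adjoining vacuum multiplies densities by a positive
Gaussian, a Gaussian unitary is an affine change of variables, and homodyning fixes positions and
integrates out momenta. All three are linear and order preserving and keep the total integral (for
homodyning, once integrated over outcomes), so `v` can be carried along. Here the Wigner function of
a vector is characterised by its Fourier transform `ξ ↦ ⟨ψ, D(ξ) ψ⟩`, which makes the three rules
accessible (`IsWignerDensity.tensor`, `IsGaussianUnitary.exists_affine`,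
`IsWignerDensity.ae_slice`). Strong limits are covered because the error is continuous in the
topology of pointwise convergence.

Without restriction, the trace distance of two pure states is a function of their overlap, here
`exp(-2α²n)`. The exponents follow from elementary two-sided bounds on `1 - erf c` and on `1 - √(1 -
s)`. -/

lemma ketBra_apply (φ ψ x : E) : ketBra φ ψ x = ⟪ψ, x⟫_ℂ • φ := rfl

lemma hasSum_tr_ketBra (φ ψ : E) :
    HasSum (fun i => ⟪basis E i, ketBra φ ψ (basis E i)⟫_ℂ) ⟪ψ, φ⟫_ℂ := by
  have h := (basis E).hasSum_inner_mul_inner ψ φ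
  refine h.congr_fun fun i => ?_
  rw [ketBra_apply, inner_smul_right]

lemma tr_ketBra (φ ψ : E) : tr (ketBra φ ψ) = ⟪ψ, φ⟫_ℂ :=
  (hasSum_tr_ketBra φ ψ).tsum_eq

lemma tr_ketBra_sub (φ ψ φ' ψ' : E) :
    tr (ketBra φ ψ - ketBra φ' ψ') = ⟪ψ, φ⟫_ℂ - ⟪ψ', φ'⟫_ℂ := by
  refine HasSum.tsum_eq (((hasSum_tr_ketBra φ ψ).sub (hasSum_tr_ketBra φ' ψ')).congr_fun
    fun i => ?_)
  rw [sub_apply, inner_sub_right]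

lemma mul_ketBra (B : E →L[ℂ] E) (φ ψ : E) : B * ketBra φ ψ = ketBra (B φ) ψ := by
  ext x
  simp [ketBra_apply]

lemma ketBra_mul (B : E →L[ℂ] E) (φ ψ : E) :
    ketBra φ ψ * B = ketBra φ (ContinuousLinearMap.adjoint B ψ) := by
  ext x
  simp [ketBra_apply, ContinuousLinearMap.adjoint_inner_left]

lemma tr_mul_ketBra (B : E →L[ℂ] E) (φ ψ : E) : tr (B * ketBra φ ψ) = ⟪ψ, B φ⟫_ℂ := by
  rw [mul_ketBra, tr_ketBra]

lemma tr_ketBra_mul (B : E →L[ℂ] E) (φ ψ : E) : tr (ketBra φ ψ * B) = ⟪ψ, B φ⟫_ℂ := by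
  rw [ketBra_mul, tr_ketBra, ContinuousLinearMap.adjoint_inner_left]

lemma errorProb_pureState (ψ₀ ψ₁ : E) (M : E →L[ℂ] E) :
    errorProb (pureState ψ₀) (pureState ψ₁) M =
      1 / 2 * (⟪ψ₀, (1 - M) ψ₀⟫_ℂ).re + 1 / 2 * (⟪ψ₁, M ψ₁⟫_ℂ).re := by
  rw [errorProb, pureState, pureState, tr_ketBra_mul, tr_ketBra_mul]

/-- Since `ψ` is a unit vector, `T†T = ‖φ‖² |ψ⟩⟨ψ|` is the square of the positive operator `‖φ‖
|ψ⟩⟨ψ|`, which must then be `|T|`. -/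
lemma traceNorm_ketBra {ψ : E} (hψ : ‖ψ‖ = 1) (φ : E) :
    traceNorm (ketBra φ ψ) = ‖φ‖ := by
  have hpos : (0 : E →L[ℂ] E) ≤ (‖φ‖ : ℝ) • ketBra ψ ψ := by
    refine smul_nonneg (norm_nonneg _) ?_
    rw [ContinuousLinearMap.nonneg_iff_isPositive]
    exact InnerProductSpace.isPositive_rankOne_self ψ
  have habs : CFC.abs (ketBra φ ψ) = (‖φ‖ : ℝ) • ketBra ψ ψ := by
    refine CFC.sqrt_unique ?_ hpos
    have hs : star (ketBra φ ψ) = ketBra ψ φ := InnerProductSpace.adjoint_rankOne φ ψ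
    rw [hs]
    ext x
    simp only [mul_apply_eq_comp, smul_apply, ketBra_apply,
      ← Complex.coe_smul, inner_smul_right, inner_self_eq_norm_sq_to_K, hψ, smul_smul]
    congr 1
    simp only [RCLike.ofReal_one, Complex.coe_algebraMap]
    ring
  have h2 : (‖φ‖ : ℝ) • ketBra ψ ψ = ketBra ((‖φ‖ : ℝ) • ψ) ψ := by
    ext x
    rw [smul_apply, ketBra_apply, ketBra_apply, smul_comm]
  rw [traceNorm, habs, h2, tr_ketBra, ← Complex.coe_smul, inner_smul_right,
    inner_self_eq_norm_sq_to_K, hψ]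
  simp

/-- A positive idempotent is its own positive square root. -/
lemma sqrt_pureState {ψ : E} (hψ : ‖ψ‖ = 1) : CFC.sqrt (pureState ψ) = pureState ψ := by
  refine CFC.sqrt_unique ?_ ?_
  · exact InnerProductSpace.isIdempotentElem_rankOne_self hψ
  · rw [ContinuousLinearMap.nonneg_iff_isPositive]
    exact InnerProductSpace.isPositive_rankOne_self ψ

/-- The fidelity of two pure states is the modulus of their overlap. -/
lemma fidelity_pureState {ψ₀ ψ₁ : E} (h₀ : ‖ψ₀‖ = 1) (h₁ : ‖ψ₁‖ = 1) :
    fidelity (pureState ψ₀) (pureState ψ₁) = ‖⟪ψ₀, ψ₁⟫_ℂ‖ := by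
  rw [fidelity, sqrt_pureState h₀, sqrt_pureState h₁]
  have h : pureState ψ₀ * pureState ψ₁ = ketBra (⟪ψ₀, ψ₁⟫_ℂ • ψ₀) ψ₁ := by
    rw [pureState, pureState, mul_ketBra, ketBra_apply]
  rw [h, traceNorm_ketBra h₁, norm_smul, h₀, mul_one]

/-- The trace distance of two distinct pure states. -/
lemma traceNorm_pureState_sub {ψ₀ ψ₁ : E} (h₀ : ‖ψ₀‖ = 1) (h₁ : ‖ψ₁‖ = 1)
    (hc : ‖⟪ψ₀, ψ₁⟫_ℂ‖ < 1) :
    traceNorm (pureState ψ₀ - pureState ψ₁) = 2 * √(1 - ‖⟪ψ₀, ψ₁⟫_ℂ‖ ^ 2) := by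
  set c := ⟪ψ₀, ψ₁⟫_ℂ with hcdef
  set T := pureState ψ₀ - pureState ψ₁ with hT
  set s := √(1 - ‖c‖ ^ 2) with hs
  have hpos : 0 < 1 - ‖c‖ ^ 2 := by nlinarith [norm_nonneg c]
  have hs0 : 0 < s := Real.sqrt_pos.2 hpos
  have hs2 : s ^ 2 = 1 - ‖c‖ ^ 2 := Real.sq_sqrt hpos.le
  have hcc : ⟪ψ₁, ψ₀⟫_ℂ = (starRingEnd ℂ) c := (inner_conj_symm ψ₁ ψ₀).symm
  have hn₀ : ⟪ψ₀, ψ₀⟫_ℂ = 1 := by rw [inner_self_eq_norm_sq_to_K, h₀]; simp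
  have hn₁ : ⟪ψ₁, ψ₁⟫_ℂ = 1 := by rw [inner_self_eq_norm_sq_to_K, h₁]; simp
  have hTx : ∀ x, T x = ⟪ψ₀, x⟫_ℂ • ψ₀ - ⟪ψ₁, x⟫_ℂ • ψ₁ := fun x => rfl
  have hcn : c * (starRingEnd ℂ) c = ((1 - s ^ 2 : ℝ) : ℂ) := by
    rw [Complex.mul_conj, Complex.normSq_eq_norm_sq, hs2]; congr 1; ring
  -- On the span of `ψ₀` and `ψ₁`, which contains the range of `T`, the operator `T²` is the scalar
  -- `s² = 1 - |c|²`. Hence `T³ = s² T`.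
  have hT0 : T (T ψ₀) = ((s ^ 2 : ℝ) : ℂ) • ψ₀ := by
    rw [hTx ψ₀, map_sub, map_smul, map_smul, hTx ψ₀, hTx ψ₁, hn₀, hn₁, hcc, ← hcdef]
    have : ((s ^ 2 : ℝ) : ℂ) = 1 - c * (starRingEnd ℂ) c := by rw [hcn]; push_cast; ring
    rw [this]; module
  have hT1 : T (T ψ₁) = ((s ^ 2 : ℝ) : ℂ) • ψ₁ := by
    rw [hTx ψ₁, map_sub, map_smul, map_smul, hTx ψ₀, hTx ψ₁, hn₀, hn₁, hcc, ← hcdef]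
    have : ((s ^ 2 : ℝ) : ℂ) = 1 - c * (starRingEnd ℂ) c := by rw [hcn]; push_cast; ring
    rw [this]; module
  have hT3 : ∀ x, T (T (T x)) = ((s ^ 2 : ℝ) : ℂ) • T x := fun x => by
    rw [hTx x, map_sub, map_sub, map_smul, map_smul, map_smul, map_smul, hT0, hT1]
    module
  have hstar : star T = T := by
    rw [hT, star_sub]
    congr 1 <;> exact InnerProductSpace.adjoint_rankOne _ _
  -- From `T³ = s² T` one gets `(T²/s)² = T² = T†T`, and `T²/s` is positive, so it is `|T|`. Strict
  -- inequality `|c| < 1` makes the division legitimate.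
  have habs : CFC.abs T = s⁻¹ • (T * T) := by
    refine CFC.sqrt_unique ?_ (smul_nonneg (by positivity) ?_)
    · rw [hstar]
      ext x
      simp only [mul_apply_eq_comp, smul_apply, ← Complex.coe_smul,
        map_smul]
      rw [hT3, smul_smul, smul_smul]
      have : ((s⁻¹ : ℝ) : ℂ) * ((s⁻¹ : ℝ) : ℂ) * ((s ^ 2 : ℝ) : ℂ) = 1 := by
        rw [← Complex.ofReal_mul, ← Complex.ofReal_mul]
        norm_cast
        field_simp
      rw [this, one_smul]
    · conv_rhs => rw [← hstar]
      rw [hstar]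
      nth_rewrite 1 [← hstar]
      exact star_mul_self_nonneg T
  -- Writing `|T|` as a difference of rank-one operators makes its trace a difference of inner
  -- products.
  have hrep : s⁻¹ • (T * T) = ketBra (s⁻¹ • T ψ₀) ψ₀ - ketBra (s⁻¹ • T ψ₁) ψ₁ := by
    ext x
    simp only [mul_apply_eq_comp, smul_apply,
      sub_apply, ketBra_apply]
    rw [hTx x, map_sub, map_smul, map_smul, smul_sub, smul_comm, smul_comm (s⁻¹)]
  rw [traceNorm, habs, hrep, tr_ketBra_sub, ← Complex.coe_smul, ← Complex.coe_smul,
    inner_smul_right, inner_smul_right, hTx, hTx, inner_sub_right, inner_sub_right,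
    inner_smul_right, inner_smul_right, inner_smul_right, inner_smul_right, hn₀, hn₁, hcc, ← hcdef]
  have e1 : ((s⁻¹ : ℝ) : ℂ) * (1 * 1 - (starRingEnd ℂ) c * c) -
      ((s⁻¹ : ℝ) : ℂ) * (c * (starRingEnd ℂ) c - 1 * 1) = ((2 * s : ℝ) : ℂ) := by
    rw [mul_comm ((starRingEnd ℂ) c) c, hcn]
    push_cast
    have : (s : ℂ) ≠ 0 := by exact_mod_cast hs0.ne'
    field_simp
    ring
  rw [e1, Complex.ofReal_re]

end Operators

end

section

/-! ### Pointwise representatives of vectors and the basic Gaussian integral -/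

section Representatives

variable {m k n : ℕ}

lemma mulOp_coeFn (g : (Fin m → ℝ) → ℂ) (hg : Measurable g) (hb : ∀ y, ‖g y‖ ≤ 1) (f : Modes m) :
    mulOp g hg hb f =ᵐ[volume] fun y => g y * f y :=
  MemLp.coeFn_toLp ((Lp.memLp f).of_le (hg.aestronglyMeasurable.mul (Lp.memLp f).1)
    (Eventually.of_forall fun y => by
      rw [Pi.mul_apply, norm_mul]
      exact mul_le_of_le_one_left (norm_nonneg _) (hb y)))

lemma translation_coeFn (x : Fin m → ℝ) (f : Modes m) :
    translation x f =ᵐ[volume] fun y => f (y - x) :=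
  Lp.coeFn_compMeasurePreserving f _

lemma parity_coeFn (f : Modes m) : parity m f =ᵐ[volume] fun y => f (-y) :=
  Lp.coeFn_compMeasurePreserving f _

lemma displacement_coeFn (ξ : Fin m → ℂ) (f : Modes m) :
    displacement ξ f =ᵐ[volume] fun y =>
      weylPhase (fun j => √2 * (ξ j).re) (fun j => √2 * (ξ j).im) y *
        f (y - fun j => √2 * (ξ j).re) := by
  refine (mulOp_coeFn _ (measurable_weylPhase _ _) (norm_weylPhase_le _ _)
    (translation (fun j => √2 * (ξ j).re) f)).trans ?_
  filter_upwards [translation_coeFn (fun j => √2 * (ξ j).re) f] with y hy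
  rw [hy]

/-- Lets an explicit wave function replace the chosen representative; translations preserve null
sets. -/
lemma displacement_coeFn_of_ae (ξ : Fin m → ℂ) {f : Modes m} {F : (Fin m → ℝ) → ℂ}
    (hF : f =ᵐ[volume] F) :
    displacement ξ f =ᵐ[volume] fun y =>
      weylPhase (fun j => √2 * (ξ j).re) (fun j => √2 * (ξ j).im) y *
        F (y - fun j => √2 * (ξ j).re) := by
  refine (displacement_coeFn ξ f).trans ?_
  have h := (measurePreserving_sub_right volume
    (fun j => √2 * (ξ j).re : Fin m → ℝ)).quasiMeasurePreserving.ae_eq_comp hF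
  filter_upwards [h] with y hy
  simp only [Function.comp_apply] at hy
  rw [hy]

lemma inner_eq_integral (f g : Modes m) :
    ⟪f, g⟫_ℂ = ∫ y, (starRingEnd ℂ) (f y) * g y := by
  rw [L2.inner_def]
  refine integral_congr_ae (Eventually.of_forall fun y => ?_)
  simp [RCLike.inner_apply, mul_comm]

lemma inner_eq_integral_of_ae {f g : Modes m} {F G : (Fin m → ℝ) → ℂ}
    (hf : f =ᵐ[volume] F) (hg : g =ᵐ[volume] G) :
    ⟪f, g⟫_ℂ = ∫ y, (starRingEnd ℂ) (F y) * G y := by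
  rw [inner_eq_integral]
  refine integral_congr_ae ?_
  filter_upwards [hf, hg] with y h₁ h₂
  rw [h₁, h₂]

lemma integrable_conj_mul (f g : Modes m) :
    Integrable (fun y => (starRingEnd ℂ) (f y) * g y) := by
  refine (L2.integrable_inner (𝕜 := ℂ) f g).congr (Eventually.of_forall fun y => ?_)
  simp [RCLike.inner_apply, mul_comm]

lemma displacement_zero (f : Modes m) : displacement 0 f = f := by
  apply Lp.ext
  filter_upwards [displacement_coeFn 0 f] with y hy
  rw [hy]
  have h1 : (fun j : Fin m => √2 * ((0 : Fin m → ℂ) j).re) = 0 := by ext; simp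
  have h2 : (fun j : Fin m => √2 * ((0 : Fin m → ℂ) j).im) = 0 := by ext; simp
  rw [h1, h2, sub_zero]
  simp [weylPhase]

lemma vacuum_coeFn (m : ℕ) : vacuum m =ᵐ[volume] vacuumFun m := MemLp.coeFn_toLp _

/-- The wave function of the single-mode coherent vector with position `x` and momentum `p`. -/
def coherentWave (x p y : ℝ) : ℂ :=
  ((Real.pi ^ (-(1 / 4) : ℝ) : ℝ) : ℂ) *
    Complex.exp (-(y - x) ^ 2 / 2 + (p * y - x * p / 2) * Complex.I)

/-- The wave function of a coherent vector. -/
def coherentFun (β : Fin m → ℂ) (y : Fin m → ℝ) : ℂ :=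
  ∏ j, coherentWave (√2 * (β j).re) (√2 * (β j).im) (y j)

lemma weylPhase_eq_prod (x p y : Fin m → ℝ) :
    weylPhase x p y = ∏ j, Complex.exp ((p j * y j - x j * p j / 2 : ℝ) * Complex.I) := by
  rw [weylPhase, ← Complex.exp_sum, ← Finset.sum_mul, ← Complex.ofReal_sum, Finset.sum_sub_distrib,
    Finset.mul_sum]
  congr 4
  refine Finset.sum_congr rfl fun j _ => ?_
  ring

lemma coherent_coeFn (β : Fin m → ℂ) : coherent β =ᵐ[volume] coherentFun β := by
  refine (displacement_coeFn_of_ae β (vacuum_coeFn m)).trans (Eventually.of_forall fun y => ?_)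
  simp only [coherentFun, weylPhase_eq_prod, vacuumFun, ← Finset.prod_mul_distrib]
  refine Finset.prod_congr rfl fun j _ => ?_
  simp only [coherentWave, Pi.sub_apply]
  rw [Complex.ofReal_mul, mul_left_comm, Complex.ofReal_exp, ← Complex.exp_add]
  congr 2
  push_cast
  ring

lemma vacuum_eq_coherent (m : ℕ) : vacuum m = coherent (0 : Fin m → ℂ) := by
  rw [coherent, displacement_zero]

lemma pi_rpow_mul_self : (((Real.pi ^ (-(1 / 4) : ℝ) : ℝ) : ℂ) *
    ((Real.pi ^ (-(1 / 4) : ℝ) : ℝ) : ℂ)) = (((√Real.pi)⁻¹ : ℝ) : ℂ) := by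
  rw [← Complex.ofReal_mul, ← Real.rpow_add Real.pi_pos, Real.sqrt_eq_rpow,
    ← Real.rpow_neg Real.pi_pos.le]
  norm_num

/-- Every overlap and Wigner integral of coherent vectors below reduces to this one-dimensional
integral, one mode at a time. -/
lemma integral_gaussian_linear (c d : ℂ) :
    ∫ y : ℝ, Complex.exp (-(y : ℂ) ^ 2 + c * y + d) =
      ((√Real.pi : ℝ) : ℂ) * Complex.exp (d + c ^ 2 / 4) := by
  have h := integral_cexp_quadratic (b := -1) (by simp) c d
  simp only [neg_one_mul] at h
  rw [h, Real.sqrt_eq_rpow, Complex.ofReal_cpow Real.pi_pos.le]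
  congr 2
  · norm_num
  · norm_num
  · ring

lemma integrable_gaussian_linear (c d : ℂ) :
    Integrable fun y : ℝ => Complex.exp (-(y : ℂ) ^ 2 + c * y + d) := by
  have h := integrable_cexp_quadratic' (b := -1) (by simp) c d
  simpa only [neg_one_mul] using h

end Representatives

/-! ### Splitting coordinates and tensor products -/

section Split

variable {m k n : ℕ}

@[simp] lemma headModes_joinModes (h : m + k = n) (u : Fin m → ℝ) (v : Fin k → ℝ) :
    headModes h (joinModes h u v) = u := by
  subst h; ext i; simp [headModes, joinModes]

@[simp] lemma tailModes_joinModes (h : m + k = n) (u : Fin m → ℝ) (v : Fin k → ℝ) :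
    tailModes h (joinModes h u v) = v := by
  subst h; ext i; simp [tailModes, joinModes]

@[simp] lemma joinModes_head_tail (h : m + k = n) (y : Fin n → ℝ) :
    joinModes h (headModes h y) (tailModes h y) = y := by
  subst h
  ext i
  refine Fin.addCases (fun i => ?_) (fun i => ?_) i <;> simp [headModes, tailModes, joinModes]

/-- Splitting the coordinates of `n = m + k` modes, as a measurable equivalence. -/
def splitEquiv (h : m + k = n) : (Fin n → ℝ) ≃ᵐ (Fin m → ℝ) × (Fin k → ℝ) where
  toFun y := (headModes h y, tailModes h y)
  invFun z := joinModes h z.1 z.2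
  left_inv y := joinModes_head_tail h y
  right_inv z := by simp
  measurable_toFun := (measurePreserving_split h).measurable
  measurable_invFun := by
    subst h
    refine measurable_pi_iff.2 fun i => ?_
    refine Fin.addCases (fun i => ?_) (fun i => ?_) i
    · simpa [joinModes, Function.comp_def] using (measurable_pi_apply i).comp measurable_fst
    · simpa [joinModes, Function.comp_def] using (measurable_pi_apply i).comp measurable_snd

lemma measurePreserving_join (h : m + k = n) :
    MeasurePreserving (fun z : (Fin m → ℝ) × (Fin k → ℝ) => joinModes h z.1 z.2) :=
  MeasurePreserving.symm (splitEquiv h) (measurePreserving_split h)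

lemma integral_eq_integral_join {F : Type*} [NormedAddCommGroup F] [NormedSpace ℝ F]
    (h : m + k = n) (f : (Fin n → ℝ) → F) :
    ∫ y, f y = ∫ z : (Fin m → ℝ) × (Fin k → ℝ), f (joinModes h z.1 z.2) :=
  ((measurePreserving_join h).integral_comp (splitEquiv h).symm.measurableEmbedding f).symm

lemma integrable_comp_join {F : Type*} [NormedAddCommGroup F]
    (h : m + k = n) {f : (Fin n → ℝ) → F} :
    Integrable (fun z : (Fin m → ℝ) × (Fin k → ℝ) => f (joinModes h z.1 z.2)) ↔ Integrable f :=
  (measurePreserving_join h).integrable_comp_emb (splitEquiv h).symm.measurableEmbedding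

lemma tensor_coeFn (h : m + k = n) (f : Modes m) (g : Modes k) :
    tensor h f g =ᵐ[volume] fun y => f (headModes h y) * g (tailModes h y) :=
  MemLp.coeFn_toLp _

lemma quasiMeasurePreserving_head (h : m + k = n) :
    Measure.QuasiMeasurePreserving (headModes (k := k) h) volume volume :=
  Measure.quasiMeasurePreserving_fst.comp (measurePreserving_split h).quasiMeasurePreserving

lemma quasiMeasurePreserving_tail (h : m + k = n) :
    Measure.QuasiMeasurePreserving (tailModes (m := m) h) volume volume :=
  Measure.quasiMeasurePreserving_snd.comp (measurePreserving_split h).quasiMeasurePreserving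

lemma tensor_coeFn_of_ae (h : m + k = n) {f : Modes m} {g : Modes k} {F : (Fin m → ℝ) → ℂ}
    {G : (Fin k → ℝ) → ℂ} (hf : f =ᵐ[volume] F) (hg : g =ᵐ[volume] G) :
    tensor h f g =ᵐ[volume] fun y => F (headModes h y) * G (tailModes h y) := by
  filter_upwards [tensor_coeFn h f g, (quasiMeasurePreserving_head h).ae_eq_comp hf,
    (quasiMeasurePreserving_tail h).ae_eq_comp hg] with y h₁ h₂ h₃
  simp only [Function.comp_apply] at h₂ h₃
  rw [h₁, h₂, h₃]

lemma inner_tensor (h : m + k = n) (f f' : Modes m) (g g' : Modes k) :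
    ⟪tensor h f g, tensor h f' g'⟫_ℂ = ⟪f, f'⟫_ℂ * ⟪g, g'⟫_ℂ := by
  rw [inner_eq_integral_of_ae (tensor_coeFn h f g) (tensor_coeFn h f' g'),
    integral_eq_integral_join h, inner_eq_integral, inner_eq_integral, ← integral_prod_mul]
  refine integral_congr_ae (Eventually.of_forall fun z => ?_)
  simp only [headModes_joinModes, tailModes_joinModes, map_mul]
  ring

/-- The first `m` out of `n = m + k` complex coordinates. -/
def headC (h : m + k = n) (ξ : Fin n → ℂ) : Fin m → ℂ :=
  fun i => ξ (Fin.cast h (Fin.castAdd k i))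

/-- The last `k` out of `n = m + k` complex coordinates. -/
def tailC (h : m + k = n) (ξ : Fin n → ℂ) : Fin k → ℂ :=
  fun i => ξ (Fin.cast h (Fin.natAdd m i))

/-- Concatenation of complex coordinates. -/
def joinC (h : m + k = n) (ξ : Fin m → ℂ) (η : Fin k → ℂ) : Fin n → ℂ :=
  fun i => Fin.append ξ η (Fin.cast h.symm i)

@[simp] lemma headC_joinC (h : m + k = n) (u : Fin m → ℂ) (v : Fin k → ℂ) :
    headC h (joinC h u v) = u := by
  subst h; ext i; simp [headC, joinC]

@[simp] lemma tailC_joinC (h : m + k = n) (u : Fin m → ℂ) (v : Fin k → ℂ) :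
    tailC h (joinC h u v) = v := by
  subst h; ext i; simp [tailC, joinC]

lemma sum_split {M : Type*} [AddCommMonoid M] (h : m + k = n) (f : Fin n → M) :
    ∑ j, f j = (∑ i, f (Fin.cast h (Fin.castAdd k i))) + ∑ i, f (Fin.cast h (Fin.natAdd m i)) := by
  subst h; simp [Fin.sum_univ_add]

lemma prod_split {M : Type*} [CommMonoid M] (h : m + k = n) (f : Fin n → M) :
    ∏ j, f j = (∏ i, f (Fin.cast h (Fin.castAdd k i))) * ∏ i, f (Fin.cast h (Fin.natAdd m i)) := by
  subst h; simp [Fin.prod_univ_add]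

lemma weylPhase_split (h : m + k = n) (x p y : Fin n → ℝ) :
    weylPhase x p y = weylPhase (headModes h x) (headModes h p) (headModes h y) *
      weylPhase (tailModes h x) (tailModes h p) (tailModes h y) := by
  rw [weylPhase_eq_prod, weylPhase_eq_prod, weylPhase_eq_prod, prod_split h]
  rfl

lemma displacement_tensor (h : m + k = n) (ξ : Fin n → ℂ) (f : Modes m) (g : Modes k) :
    displacement ξ (tensor h f g) =
      tensor h (displacement (headC h ξ) f) (displacement (tailC h ξ) g) := by
  apply Lp.ext
  filter_upwards [displacement_coeFn_of_ae ξ (tensor_coeFn h f g),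
    tensor_coeFn_of_ae h (displacement_coeFn (headC h ξ) f) (displacement_coeFn (tailC h ξ) g)]
    with y h₁ h₂
  rw [h₁, h₂, weylPhase_split h]
  have e : ∀ a b c d : ℂ, a * b * (c * d) = a * c * (b * d) := fun a b c d => by ring
  exact e _ _ _ _

lemma tensor_coherent (h : m + k = n) (ξ : Fin n → ℂ) :
    tensor h (coherent (headC h ξ)) (coherent (tailC h ξ)) = coherent ξ := by
  apply Lp.ext
  filter_upwards [tensor_coeFn_of_ae h (coherent_coeFn (headC h ξ)) (coherent_coeFn (tailC h ξ)),
    coherent_coeFn ξ] with y h₁ h₂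
  rw [h₁, h₂, coherentFun, coherentFun, coherentFun, prod_split h]
  rfl

/-- Tensor powers of coherent vectors are coherent. -/
lemma tensorPower_coherent (a : ℂ) (n : ℕ) :
    tensorPower (coherent fun _ => a) n = coherent fun _ => a := by
  induction n with
  | zero =>
    rw [tensorPower, vacuum_eq_coherent]
    congr 1
    exact Subsingleton.elim _ _
  | succ n ih =>
    rw [tensorPower, ih]
    exact tensor_coherent rfl fun _ => a

end Split

end

section

/-! ### Measurability of vector-valued maps from scalar data -/

section WeakMeasurability

variable {X E : Type*} [MeasurableSpace X] [NormedAddCommGroup E] [InnerProductSpace ℂ E]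
  [SecondCountableTopology E] [MeasurableSpace E] [BorelSpace E]

/-- A function to a separable metric space is measurable if the distances to all points are. -/
lemma measurable_of_dist {Y : Type*} [PseudoMetricSpace Y] [SecondCountableTopology Y]
    [MeasurableSpace Y] [BorelSpace Y] {s : X → Y}
    (h : ∀ e, Measurable fun x => dist (s x) e) : Measurable s := by
  refine measurable_of_isOpen fun U hU => ?_
  rcases isEmpty_or_nonempty Y with hY | hY
  · rw [Set.eq_empty_of_isEmpty U]; simp
  -- By separability `U` is the countable union of the balls inside it that have centres in a dense
  -- sequence and rational radii.
  have hUeq : s ⁻¹' U = ⋃ (i : ℕ × ℚ) (_ : Metric.ball (TopologicalSpace.denseSeq Y i.1) i.2 ⊆ U),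
      {x | dist (s x) (TopologicalSpace.denseSeq Y i.1) < i.2} := by
    ext x
    simp only [Set.mem_preimage, Set.mem_iUnion, Set.mem_ofPred_eq, exists_prop]
    constructor
    · intro hx
      obtain ⟨ε, hε, hball⟩ := Metric.isOpen_iff.1 hU _ hx
      -- With a centre within `ε/3` of `s x` and a radius between `ε/3` and `ε/2`, the ball contains
      -- `s x` and stays inside the `ε`-ball around `s x`.
      obtain ⟨i, hi⟩ := Metric.denseRange_iff.1 (TopologicalSpace.denseRange_denseSeq Y) (s x) (ε / 3)
        (by positivity)
      obtain ⟨q, hq₁, hq₂⟩ := exists_rat_btwn (show ε / 3 < ε / 2 by linarith)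
      refine ⟨(i, q), fun z hz => hball ?_, hi.trans hq₁⟩
      rw [Metric.mem_ball] at hz ⊢
      have := dist_triangle z (TopologicalSpace.denseSeq Y i) (s x)
      rw [dist_comm (TopologicalSpace.denseSeq Y i)] at this
      simp only at hz
      linarith
    · rintro ⟨i, hi, hx⟩
      exact hi hx
  rw [hUeq]
  exact MeasurableSet.iUnion fun i => MeasurableSet.iUnion fun _ =>
    measurableSet_lt (h _) measurable_const

/-- The squared distance `‖s x - e‖²` expands into the norm of `s x`, the inner product with `e` and
a constant. -/
lemma measurable_of_inner {s : X → E} (hn : Measurable fun x => ‖s x‖)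
    (hw : ∀ e, Measurable fun x => ⟪e, s x⟫_ℂ) : Measurable s := by
  refine measurable_of_dist fun e => ?_
  have h : (fun x => dist (s x) e) =
      fun x => √(‖s x‖ ^ 2 - 2 * (⟪e, s x⟫_ℂ).re + ‖e‖ ^ 2) := by
    ext x
    have h1 := norm_sub_sq (𝕜 := ℂ) (s x) e
    rw [inner_re_symm] at h1
    have h2 : RCLike.re ⟪e, s x⟫_ℂ = (⟪e, s x⟫_ℂ).re := rfl
    rw [dist_eq_norm, ← h2, ← h1, Real.sqrt_sq (norm_nonneg _)]
  rw [h]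
  exact (((hn.pow_const 2).sub ((Complex.measurable_re.comp (hw e)).const_mul 2)).add_const _).sqrt

/-- The exceptional null set of `⟪e, s x⟫` depends on `e`, so only countably many `e` from a dense
sequence are used. Off a single null set all of these agree with measurable functions; the remaining
`e` are reached by pointwise limits. -/
lemma aemeasurable_of_inner {μ : Measure X} {s : X → E} (hn : AEMeasurable (fun x => ‖s x‖) μ)
    (hw : ∀ e, AEMeasurable (fun x => ⟪e, s x⟫_ℂ) μ) : AEMeasurable s μ := by
  let d := TopologicalSpace.denseSeq E
  have hall : ∀ᵐ x ∂μ, ‖s x‖ = hn.mk _ x ∧ ∀ i, ⟪d i, s x⟫_ℂ = (hw (d i)).mk _ x :=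
    hn.ae_eq_mk.and (ae_all_iff.2 fun i => (hw (d i)).ae_eq_mk)
  obtain ⟨t, ht, htm, ht0⟩ := exists_measurable_superset_of_null hall
  have htc : ∀ x ∉ t, ‖s x‖ = hn.mk _ x ∧ ∀ i, ⟪d i, s x⟫_ℂ = (hw (d i)).mk _ x := fun x hx => by
    by_contra hcon
    exact hx (ht hcon)
  refine ⟨tᶜ.indicator s, ?_, ?_⟩
  · have hnorm : Measurable fun x => ‖tᶜ.indicator s x‖ := by
      have : (fun x => ‖tᶜ.indicator s x‖) = tᶜ.indicator (hn.mk _) := by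
        ext x
        by_cases hx : x ∈ t
        · simp [hx]
        · simp [hx, htc x hx]
      rw [this]
      exact hn.measurable_mk.indicator htm.compl
    refine measurable_of_inner hnorm fun e => ?_
    have hi : ∀ i, Measurable fun x => ⟪d i, tᶜ.indicator s x⟫_ℂ := fun i => by
      have : (fun x => ⟪d i, tᶜ.indicator s x⟫_ℂ) = tᶜ.indicator ((hw (d i)).mk _) := by
        ext x
        by_cases hx : x ∈ t
        · simp [hx]
        · simp [hx, (htc x hx).2 i]
      rw [this]
      exact (hw (d i)).measurable_mk.indicator htm.compl
    have hmem : e ∈ closure (Set.range d) := TopologicalSpace.denseRange_denseSeq E e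
    obtain ⟨a, ha, hlim⟩ := mem_closure_iff_seq_limit.1 hmem
    choose i hi' using ha
    refine measurable_of_tendsto_metrizable (f := fun n x => ⟪a n, tᶜ.indicator s x⟫_ℂ)
      (fun n => ?_) (tendsto_pi_nhds.2 fun x => ?_)
    · simp only [← hi' n]
      exact hi _
    · exact hlim.inner tendsto_const_nhds
  · have : ∀ᵐ x ∂μ, x ∉ t := by rw [ae_iff]; simpa using ht0
    filter_upwards [this] with x hx
    simp [hx]

/-- Expectation values of a weakly measurable family of operators in a measurable family of vectors
are measurable. -/
lemma aemeasurable_inner_apply {μ : Measure X} {s : X → E} {N : X → E →L[ℂ] E}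
    (hs : AEMeasurable s μ) (hN : ∀ φ, Measurable fun x => ⟪φ, N x φ⟫_ℂ) :
    AEMeasurable (fun x => ⟪s x, N x (s x)⟫_ℂ) μ := by
  -- A function continuous in the vector and measurable in the parameter is jointly measurable when
  -- the vectors form a separable metrizable space.
  have h : Measurable (Function.uncurry fun (φ : E) (x : X) => ⟪φ, N x φ⟫_ℂ) :=
    measurable_uncurry_of_continuous_of_measurable (fun x => by fun_prop) hN
  exact h.comp_aemeasurable (hs.prodMk aemeasurable_id)

end WeakMeasurability

/-! ### Slices of a wave function at a homodyne outcome -/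

section Slice

instance secondCountableTopology_modes (m : ℕ) : SecondCountableTopology (Modes m) :=
  haveI : Fact ((2 : ℝ≥0∞) ≠ ∞) := ⟨by simp⟩
  inferInstance

variable {m k n : ℕ}

lemma stronglyMeasurable_comp_join (h : m + k = n) (φ : Modes n) :
    StronglyMeasurable fun z : (Fin m → ℝ) × (Fin k → ℝ) => φ (joinModes h z.1 z.2) :=
  (Lp.stronglyMeasurable φ).comp_measurable (splitEquiv h).symm.measurable

lemma ae_slice (h : m + k = n) {p : (Fin n → ℝ) → Prop} (hp : ∀ᵐ y, p y) :
    ∀ᵐ x : Fin k → ℝ, ∀ᵐ u : Fin m → ℝ, p (joinModes h u x) := by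
  have h1 : ∀ᵐ z : (Fin m → ℝ) × (Fin k → ℝ), p (joinModes h z.1 z.2) :=
    (measurePreserving_join h).quasiMeasurePreserving.ae hp
  have h2 : ∀ᵐ z : (Fin k → ℝ) × (Fin m → ℝ), p (joinModes h z.2 z.1) :=
    (Measure.measurePreserving_swap (μ := (volume : Measure (Fin k → ℝ)))
      (ν := (volume : Measure (Fin m → ℝ)))).quasiMeasurePreserving.ae h1
  exact Measure.ae_ae_of_ae_prod h2

lemma ae_memLp_slice (h : m + k = n) (φ : Modes n) :
    ∀ᵐ x : Fin k → ℝ, MemLp (fun u => φ (joinModes h u x)) 2 volume := by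
  have h1 := (integrable_comp_join h).2
    ((memLp_two_iff_integrable_sq_norm (Lp.memLp φ).1).1 (Lp.memLp φ))
  filter_upwards [h1.prod_left_ae] with x hx
  rw [memLp_two_iff_integrable_sq_norm]
  · exact hx
  · exact ((stronglyMeasurable_comp_join h φ).comp_measurable
      measurable_prodMk_right).aestronglyMeasurable

lemma slice_coeFn (h : m + k = n) (φ : Modes n) :
    ∀ᵐ x : Fin k → ℝ, slice h φ x =ᵐ[volume] fun u => φ (joinModes h u x) := by
  filter_upwards [ae_memLp_slice h φ] with x hx
  rw [slice, dif_pos hx]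
  exact hx.coeFn_toLp

lemma slice_coeFn_of_ae (h : m + k = n) {φ : Modes n} {F : (Fin n → ℝ) → ℂ}
    (hF : φ =ᵐ[volume] F) :
    ∀ᵐ x : Fin k → ℝ, slice h φ x =ᵐ[volume] fun u => F (joinModes h u x) := by
  filter_upwards [slice_coeFn h φ, ae_slice h hF] with x h₁ h₂
  exact h₁.trans h₂

lemma inner_slice_ae (h : m + k = n) (φ φ' : Modes n) :
    (fun x : Fin k → ℝ => ⟪slice h φ x, slice h φ' x⟫_ℂ) =ᵐ[volume]
      fun x => ∫ u, (starRingEnd ℂ) (φ (joinModes h u x)) * φ' (joinModes h u x) := by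
  filter_upwards [slice_coeFn h φ, slice_coeFn h φ'] with x h₁ h₂
  exact inner_eq_integral_of_ae h₁ h₂

lemma integrable_inner_slice (h : m + k = n) (φ φ' : Modes n) :
    Integrable fun x : Fin k → ℝ => ⟪slice h φ x, slice h φ' x⟫_ℂ :=
  ((integrable_comp_join h).2 (integrable_conj_mul φ φ')).integral_prod_right.congr
    (inner_slice_ae h φ φ').symm

/-- The inner product of two vectors is the integral of the inner products of their slices. -/
lemma integral_inner_slice (h : m + k = n) (φ φ' : Modes n) :
    ∫ x : Fin k → ℝ, ⟪slice h φ x, slice h φ' x⟫_ℂ = ⟪φ, φ'⟫_ℂ := by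
  rw [integral_congr_ae (inner_slice_ae h φ φ'), inner_eq_integral, integral_eq_integral_join h]
  exact (integral_prod_symm _ ((integrable_comp_join h).2 (integrable_conj_mul φ φ'))).symm

lemma inner_self_complex {E : Type*} [NormedAddCommGroup E] [InnerProductSpace ℂ E] (φ : E) :
    ⟪φ, φ⟫_ℂ = ((‖φ‖ ^ 2 : ℝ) : ℂ) := by
  rw [inner_self_eq_norm_sq_to_K]; simp

lemma integrable_norm_sq_slice (h : m + k = n) (φ : Modes n) :
    Integrable fun x : Fin k → ℝ => ‖slice h φ x‖ ^ 2 := by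
  refine (integrable_inner_slice h φ φ).re.congr (Eventually.of_forall fun x => ?_)
  simp only [inner_self_complex]
  exact Complex.ofReal_re _

lemma integral_norm_sq_slice (h : m + k = n) (φ : Modes n) :
    ∫ x : Fin k → ℝ, ‖slice h φ x‖ ^ 2 = ‖φ‖ ^ 2 := by
  have h1 := integral_inner_slice h φ φ
  simp only [inner_self_complex] at h1
  rw [integral_complex_ofReal] at h1
  exact_mod_cast h1

/-- Protocols only assume measurability for a fixed vector, whereas the conditional state varies
with the outcome. This makes the integrands of outcome probabilities measurable, so that a norm
bound yields integrability. -/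
lemma aemeasurable_inner_slice (h : m + k = n) (φ : Modes n) {N : (Fin k → ℝ) → Modes m →L[ℂ] Modes m}
    (hN : ∀ ψ, Measurable fun x => ⟪ψ, N x ψ⟫_ℂ) :
    AEMeasurable fun x => ⟪slice h φ x, N x (slice h φ x)⟫_ℂ := by
  borelize (Modes m)
  refine aemeasurable_inner_apply (aemeasurable_of_inner ?_ fun e => ?_) hN
  · refine (integrable_norm_sq_slice h φ).aestronglyMeasurable.aemeasurable.sqrt.congr
      (Eventually.of_forall fun x => ?_)
    exact Real.sqrt_sq (norm_nonneg _)
  · have h1 : (fun x => ⟪e, slice h φ x⟫_ℂ) =ᵐ[volume]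
        fun x => ∫ u, (starRingEnd ℂ) (e u) * φ (joinModes h u x) := by
      filter_upwards [slice_coeFn h φ] with x hx
      exact inner_eq_integral_of_ae (ae_eq_refl _) hx
    refine AEMeasurable.congr ?_ h1.symm
    refine (StronglyMeasurable.integral_prod_left' (μ := (volume : Measure (Fin m → ℝ)))
      (f := fun z : (Fin m → ℝ) × (Fin k → ℝ) => (starRingEnd ℂ) (e z.1) *
        φ (joinModes h z.1 z.2)) ?_).measurable.aemeasurable
    exact (Complex.continuous_conj.comp_stronglyMeasurable
      ((Lp.stronglyMeasurable e).comp_measurable measurable_fst)).mul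
      (stronglyMeasurable_comp_join h φ)

/-- A displacement that does not move the measured positions commutes with slicing, up to the phase
that its momentum part picks up at the outcome `x`. -/
lemma slice_displacement (h : m + k = n) (ξ : Fin n → ℂ) (hξ : ∀ j, (tailC (k := k) h ξ j).re = 0)
    (φ : Modes n) :
    ∀ᵐ x : Fin k → ℝ, slice h (displacement ξ φ) x =
      Complex.exp ((∑ j, √2 * (tailC h ξ j).im * x j : ℝ) * Complex.I) •
        displacement (headC h ξ) (slice h φ x) := by
  filter_upwards [slice_coeFn_of_ae h (displacement_coeFn ξ φ), slice_coeFn h φ] with x h₁ h₂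
  apply Lp.ext
  filter_upwards [h₁, displacement_coeFn_of_ae (headC h ξ) h₂, Lp.coeFn_smul
    (Complex.exp ((∑ j, √2 * (tailC h ξ j).im * x j : ℝ) * Complex.I))
    (displacement (headC h ξ) (slice h φ x))] with u h₃ h₄ h₅
  rw [h₃, h₅, Pi.smul_apply, h₄, weylPhase_split h, smul_eq_mul]
  have h0 : tailModes (m := m) h (fun j => √2 * (ξ j).re) = (0 : Fin k → ℝ) := by
    ext j
    have := hξ j
    simp only [tailC] at this
    simp [tailModes, this]
  have e1 : weylPhase (tailModes (m := m) h fun j => √2 * (ξ j).re)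
      (tailModes (m := m) h fun j => √2 * (ξ j).im) (tailModes h (joinModes h u x)) =
      Complex.exp ((∑ j, √2 * (tailC h ξ j).im * x j : ℝ) * Complex.I) := by
    rw [h0, tailModes_joinModes, weylPhase]
    simp [tailModes, tailC]
  have e2 : joinModes h u x - (fun j => √2 * (ξ j).re) =
      joinModes h (u - fun j => √2 * (headC h ξ j).re) x := by
    have a1 : headModes h (joinModes h u x - (fun j => √2 * (ξ j).re)) =
        headModes h (joinModes h u x) - fun j => √2 * (headC h ξ j).re := rfl
    have a2 : tailModes h (joinModes h u x - (fun j => √2 * (ξ j).re)) =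
        tailModes h (joinModes h u x) - tailModes (m := m) h (fun j => √2 * (ξ j).re) := rfl
    rw [← joinModes_head_tail h (joinModes h u x - _), a1, a2, h0]
    simp
  rw [e1, e2, headModes_joinModes, mul_assoc, mul_left_comm]
  rfl

end Slice

end

section

/-! ### Uniqueness of Fourier transforms of integrable functions -/

section FourierUniqueness

variable {V : Type*} [NormedAddCommGroup V] [NormedSpace ℝ V] [CompleteSpace V]
  [SecondCountableTopology V] [MeasurableSpace V] [BorelSpace V] {μ : Measure V}

lemma norm_cexp_dual (L : StrongDual ℝ V) (v : V) : ‖Complex.exp ((L v : ℂ) * Complex.I)‖ = 1 :=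
  Complex.norm_exp_ofReal_mul_I _

lemma integrable_cexp_dual_mul (L : StrongDual ℝ V) {f : V → ℂ} (hf : Integrable f μ) :
    Integrable (fun v => Complex.exp ((L v : ℂ) * Complex.I) * f v) μ := by
  refine hf.bdd_mul (c := 1) ?_ (Eventually.of_forall fun v => (norm_cexp_dual L v).le)
  exact Continuous.aestronglyMeasurable (by fun_prop)

/-- The positive and negative parts of `g` are densities of finite measures with equal
characteristic functions, hence of equal measures. At almost every point the two parts agree, while
at least one of them is zero. -/
lemma ae_eq_zero_of_fourier_real {g : V → ℝ} (hg : Integrable g μ)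
    (h : ∀ L : StrongDual ℝ V, ∫ v, Complex.exp ((L v : ℂ) * Complex.I) * (g v : ℂ) ∂μ = 0) :
    g =ᵐ[μ] 0 := by
  have hfin : ∀ f : V → ℝ, Integrable f μ → ∫⁻ v, ENNReal.ofReal (f v) ∂μ ≠ ∞ := fun f hf =>
    hf.lintegral_lt_top.ne
  have hm : ∀ f : V → ℝ, Integrable f μ → AEMeasurable (fun v => ENNReal.ofReal (f v)) μ :=
    fun f hf => hf.aestronglyMeasurable.aemeasurable.ennreal_ofReal
  have hI : ∀ f : V → ℝ, Integrable f μ → ∀ L : StrongDual ℝ V,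
      charFunDual (μ.withDensity fun v => ENNReal.ofReal (f v)) L =
        ∫ v, Complex.exp ((L v : ℂ) * Complex.I) * ((max (f v) 0 : ℝ) : ℂ) ∂μ := fun f hf L => by
    rw [charFunDual_apply, integral_withDensity_eq_integral_toReal_smul₀ (hm f hf)
      (Eventually.of_forall fun v => ENNReal.ofReal_lt_top)]
    refine integral_congr_ae (Eventually.of_forall fun v => ?_)
    simp only [ENNReal.toReal_ofReal', Complex.real_smul]
    ring
  have := isFiniteMeasure_withDensity (hfin g hg)
  have := isFiniteMeasure_withDensity (hfin (-g) hg.neg)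
  have heq : (μ.withDensity fun v => ENNReal.ofReal (g v)) =
      μ.withDensity fun v => ENNReal.ofReal ((-g) v) := by
    refine Measure.ext_of_charFunDual (funext fun L => ?_)
    rw [hI g hg, hI (-g) hg.neg, ← sub_eq_zero, ← integral_sub, ← h L]
    · refine integral_congr_ae (Eventually.of_forall fun v => ?_)
      simp only [← mul_sub, Pi.neg_apply, ← Complex.ofReal_sub]
      congr 2
      rcases le_total (g v) 0 with h0 | h0
      · rw [max_eq_right h0, max_eq_left (by linarith)]; ring
      · rw [max_eq_left h0, max_eq_right (by linarith)]; ring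
    · exact integrable_cexp_dual_mul L hg.pos_part.ofReal
    · exact integrable_cexp_dual_mul L hg.neg.pos_part.ofReal
  rw [withDensity_eq_iff (hm g hg) (hm (-g) hg.neg) (hfin g hg)] at heq
  filter_upwards [heq] with v hv
  simp only [Pi.neg_apply] at hv
  rcases lt_trichotomy (g v) 0 with h0 | h0 | h0
  · rw [ENNReal.ofReal_of_nonpos h0.le, eq_comm, ENNReal.ofReal_eq_zero] at hv
    linarith
  · exact h0
  · rw [ENNReal.ofReal_of_nonpos (by linarith : -g v ≤ 0), ENNReal.ofReal_eq_zero] at hv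
    linarith

/-- An integrable function with vanishing Fourier transform vanishes almost everywhere. -/
lemma ae_eq_zero_of_fourier {f : V → ℂ} (hf : Integrable f μ)
    (h : ∀ L : StrongDual ℝ V, ∫ v, Complex.exp ((L v : ℂ) * Complex.I) * f v ∂μ = 0) :
    f =ᵐ[μ] 0 := by
  -- Conjugating the hypothesis at `-L` shows that the conjugate of `f` has vanishing Fourier
  -- transform too, which separates real and imaginary parts.
  have hconj : ∀ L : StrongDual ℝ V,
      ∫ v, Complex.exp ((L v : ℂ) * Complex.I) * (starRingEnd ℂ) (f v) ∂μ = 0 := fun L => by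
    have h1 := congr_arg (starRingEnd ℂ) (h (-L))
    rw [← integral_conj, map_zero] at h1
    rw [← h1]
    refine integral_congr_ae (Eventually.of_forall fun v => ?_)
    simp only [map_mul, ← Complex.exp_conj, Complex.conj_I, Complex.conj_ofReal, neg_apply]
    congr 2
    push_cast
    ring
  have hci : Integrable (fun v => (starRingEnd ℂ) (f v)) μ :=
    Complex.conjCLE.toContinuousLinearMap.integrable_comp hf
  have hre : (fun v => (f v).re) =ᵐ[μ] 0 := by
    refine ae_eq_zero_of_fourier_real hf.re fun L => ?_
    have h1 := integral_add (integrable_cexp_dual_mul L hf) (integrable_cexp_dual_mul L hci)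
    rw [h L, hconj L, add_zero] at h1
    have h2 := congr_arg (fun z => (1 / 2 : ℂ) * z) h1
    simp only [mul_zero, ← integral_const_mul] at h2
    rw [← h2]
    refine integral_congr_ae (Eventually.of_forall fun v => ?_)
    simp only
    rw [← mul_add, Complex.add_conj]
    push_cast
    ring
  have him : (fun v => (f v).im) =ᵐ[μ] 0 := by
    refine ae_eq_zero_of_fourier_real hf.im fun L => ?_
    have h1 := integral_sub (integrable_cexp_dual_mul L hf) (integrable_cexp_dual_mul L hci)
    rw [h L, hconj L, sub_zero] at h1
    have h2 := congr_arg (fun z => (1 / (2 * Complex.I) : ℂ) * z) h1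
    simp only [mul_zero, ← integral_const_mul] at h2
    rw [← h2]
    refine integral_congr_ae (Eventually.of_forall fun v => ?_)
    simp only
    rw [← mul_sub, Complex.sub_conj]
    have := Complex.I_ne_zero
    push_cast
    field_simp
  filter_upwards [hre, him] with v h1 h2
  exact Complex.ext h1 h2

/-- Two integrable functions with the same Fourier transform agree almost everywhere. -/
lemma ae_eq_of_fourier {f g : V → ℂ} (hf : Integrable f μ) (hg : Integrable g μ)
    (h : ∀ L : StrongDual ℝ V, ∫ v, Complex.exp ((L v : ℂ) * Complex.I) * f v ∂μ =
      ∫ v, Complex.exp ((L v : ℂ) * Complex.I) * g v ∂μ) :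
    f =ᵐ[μ] g := by
  have h0 := ae_eq_zero_of_fourier (hf.sub hg) fun L => by
    have h1 := integral_sub (integrable_cexp_dual_mul L hf) (integrable_cexp_dual_mul L hg)
    rw [h L, sub_self] at h1
    rw [← h1]
    refine integral_congr_ae (Eventually.of_forall fun v => ?_)
    simp only [Pi.sub_apply]
    ring
  filter_upwards [h0] with v hv
  exact sub_eq_zero.1 hv

end FourierUniqueness

/-! ### Weak continuity of displacements -/

section Continuity

variable {m : ℕ}

/-- Displacement is translation followed by a phase. Translation is continuous in `L²` norm and the
phase is a contraction, so the translated vector may be frozen; the phase then converges by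
dominated convergence. -/
lemma continuous_inner_displacement (g f : Modes m) :
    Continuous fun ξ : Fin m → ℂ => ⟪g, displacement ξ f⟫_ℂ := by
  rw [continuous_iff_continuousAt]
  intro ξ₀
  let T : (Fin m → ℂ) → Modes m := fun ξ => translation (fun j => √2 * (ξ j).re) f
  let D : (Fin m → ℂ) → Modes m →L[ℂ] Modes m := fun ξ =>
    mulOp (weylPhase (fun j => √2 * (ξ j).re) (fun j => √2 * (ξ j).im))
      (measurable_weylPhase _ _) (norm_weylPhase_le _ _)
  have hD : ∀ ξ φ, ‖D ξ φ‖ ≤ ‖φ‖ := fun ξ φ => by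
    refine Lp.norm_le_norm_of_ae_le ?_
    filter_upwards [mulOp_coeFn _ (measurable_weylPhase _ _) (norm_weylPhase_le _ _) φ] with y hy
    rw [hy, norm_mul]
    exact mul_le_of_le_one_left (norm_nonneg _) (norm_weylPhase_le _ _ _)
  have hT : Continuous T := by
    have hc : Continuous fun ξ : Fin m → ℂ =>
        (⟨fun y => y - fun j => √2 * (ξ j).re, by fun_prop⟩ : C(Fin m → ℝ, Fin m → ℝ)) := by
      refine ContinuousMap.continuous_of_continuous_uncurry _ ?_
      simp only [Function.uncurry_def, ContinuousMap.coe_mk]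
      fun_prop
    exact Continuous.compMeasurePreservingLp (f := fun _ => f) (p := 2) continuous_const hc
      (fun ξ => measurePreserving_sub_right volume _) (by simp)
  have h1 : Tendsto (fun ξ => ⟪g, D ξ (T ξ₀)⟫_ℂ) (𝓝 ξ₀) (𝓝 ⟪g, D ξ₀ (T ξ₀)⟫_ℂ) := by
    have hrep : ∀ ξ, ⟪g, D ξ (T ξ₀)⟫_ℂ = ∫ y, (starRingEnd ℂ) (g y) *
        (weylPhase (fun j => √2 * (ξ j).re) (fun j => √2 * (ξ j).im) y * T ξ₀ y) := fun ξ =>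
      inner_eq_integral_of_ae (ae_eq_refl _) (mulOp_coeFn _ (measurable_weylPhase _ _) (norm_weylPhase_le _ _) _)
    simp only [hrep]
    refine tendsto_integral_filter_of_dominated_convergence
      (fun y => ‖(starRingEnd ℂ) (g y) * T ξ₀ y‖) (Eventually.of_forall fun ξ => ?_)
      (Eventually.of_forall fun ξ => Eventually.of_forall fun y => ?_)
      (integrable_conj_mul g (T ξ₀)).norm (Eventually.of_forall fun y => ?_)
    · exact (Complex.continuous_conj.comp_aestronglyMeasurable (Lp.memLp g).1).mul
        ((measurable_weylPhase _ _).aestronglyMeasurable.mul (Lp.memLp (T ξ₀)).1)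
    · rw [norm_mul, norm_mul, norm_mul]
      gcongr
      exact mul_le_of_le_one_left (norm_nonneg _) (norm_weylPhase_le _ _ _)
    · refine ContinuousAt.tendsto (Continuous.continuousAt ?_)
      unfold weylPhase
      fun_prop
  have h2 : Tendsto (fun ξ => ⟪g, D ξ (T ξ - T ξ₀)⟫_ℂ) (𝓝 ξ₀) (𝓝 0) := by
    refine squeeze_zero_norm (a := fun ξ => ‖g‖ * ‖T ξ - T ξ₀‖) (fun ξ => ?_) ?_
    · exact (norm_inner_le_norm _ _).trans (by gcongr; exact hD _ _)
    · have hc : Continuous fun ξ => ‖g‖ * ‖T ξ - T ξ₀‖ := by fun_prop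
      simpa using hc.tendsto ξ₀
  have h3 := h1.add h2
  rw [add_zero] at h3
  refine h3.congr fun ξ => ?_
  rw [← inner_add_right, ← map_add, add_sub_cancel]
  rfl

end Continuity

/-! ### Coordinates on the phase space of joined modes -/

section PhaseSpace

variable {m k n : ℕ}

/-- The phase space of `m` modes. -/
abbrev Phase (m : ℕ) : Type := (Fin m → ℝ) × (Fin m → ℝ)

/-- Phase space of `n = m + k` modes as a product of phase spaces. -/
def phaseTensor (h : m + k = n) : Phase m × Phase k ≃ᵐ Phase n where
  toFun z := (joinModes h z.1.1 z.2.1, joinModes h z.1.2 z.2.2)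
  invFun z := ((headModes h z.1, headModes h z.2), (tailModes h z.1, tailModes h z.2))
  left_inv z := by simp
  right_inv z := by simp
  measurable_toFun := by
    have := (splitEquiv h).symm.measurable
    exact (this.comp (measurable_fst.fst.prodMk measurable_snd.fst)).prodMk
      (this.comp (measurable_fst.snd.prodMk measurable_snd.snd))
  measurable_invFun := by
    have := (measurePreserving_split h).measurable
    exact ((this.comp measurable_fst).fst.prodMk (this.comp measurable_snd).fst).prodMk
      ((this.comp measurable_fst).snd.prodMk (this.comp measurable_snd).snd)

/-- Phase space of `n = m + k` modes, with the positions `x` and momenta `p` of the last `k` modes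
separated: `(x, (a, p))` with a phase space point `a` of the first `m` modes. -/
def phaseSlice (h : m + k = n) : (Fin k → ℝ) × (Phase m × (Fin k → ℝ)) ≃ᵐ Phase n where
  toFun z := (joinModes h z.2.1.1 z.1, joinModes h z.2.1.2 z.2.2)
  invFun z := (tailModes h z.1, ((headModes h z.1, headModes h z.2), tailModes h z.2))
  left_inv z := by simp
  right_inv z := by simp
  measurable_toFun := by
    have := (splitEquiv h).symm.measurable
    exact (this.comp (measurable_snd.fst.fst.prodMk measurable_fst)).prodMk
      (this.comp (measurable_snd.fst.snd.prodMk measurable_snd.snd))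
  measurable_invFun := by
    have := (measurePreserving_split h).measurable
    exact (this.comp measurable_fst).snd.prodMk
      (((this.comp measurable_fst).fst.prodMk (this.comp measurable_snd).fst).prodMk
      (this.comp measurable_snd).snd)

lemma measurePreserving_assoc {A B C : Type*} [MeasureSpace A] [MeasureSpace B] [MeasureSpace C]
    [SFinite (volume : Measure A)] [SFinite (volume : Measure B)] [SFinite (volume : Measure C)] :
    MeasurePreserving (MeasurableEquiv.prodAssoc : (A × B) × C ≃ᵐ A × B × C) :=
  ⟨MeasurableEquiv.prodAssoc.measurable, Measure.prodAssoc_prod⟩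

lemma measurePreserving_phaseSlice (h : m + k = n) : MeasurePreserving (phaseSlice h) := by
  have h1 := (MeasurePreserving.id (volume : Measure (Fin k → ℝ))).prod
    (measurePreserving_assoc (A := Fin m → ℝ) (B := Fin m → ℝ) (C := Fin k → ℝ))
  have h2 := (measurePreserving_assoc (A := Fin k → ℝ) (B := Fin m → ℝ)
    (C := (Fin m → ℝ) × (Fin k → ℝ))).symm
  have h3 := ((measurePreserving_join h).comp (Measure.measurePreserving_swap
    (μ := (volume : Measure (Fin k → ℝ))) (ν := (volume : Measure (Fin m → ℝ))))).prod
    (measurePreserving_join h)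
  exact h3.comp (h2.comp h1)

lemma measurePreserving_phaseTensor (h : m + k = n) : MeasurePreserving (phaseTensor h) := by
  have h1 := measurePreserving_assoc (A := Fin m → ℝ) (B := Fin m → ℝ) (C := Phase k)
  have h2 := (measurePreserving_assoc (A := Fin m → ℝ) (B := Fin k → ℝ) (C := Fin k → ℝ)).symm
  have h3 := (Measure.measurePreserving_swap (μ := (volume : Measure (Fin m → ℝ)))
    (ν := (volume : Measure (Fin k → ℝ)))).prod (MeasurePreserving.id (volume : Measure (Fin k → ℝ)))
  have h4 := measurePreserving_assoc (A := Fin k → ℝ) (B := Fin m → ℝ) (C := Fin k → ℝ)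
  have h5 := (MeasurePreserving.id (volume : Measure (Fin m → ℝ))).prod (h4.comp (h3.comp h2))
  have h6 := (measurePreserving_assoc (A := Fin m → ℝ) (B := Fin k → ℝ)
    (C := (Fin m → ℝ) × (Fin k → ℝ))).symm
  have h7 := (measurePreserving_join h).prod (measurePreserving_join h)
  exact h7.comp (h6.comp (h5.comp h1))

end PhaseSpace

end

/-! ### Wigner densities of vectors: tensor products and homodyne slices -/

section

variable {m k n : ℕ}

/-- The pairing of phase space with displacement amplitudes for which
`⟨D(ξ)⟩ = ∫ exp(i ⟨ξ, z⟩) W(z) dz`. -/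
def pairing (ξ : Fin m → ℂ) (z : Phase m) : ℝ :=
  ∑ j, (√2 * (ξ j).im * z.1 j - √2 * (ξ j).re * z.2 j)

lemma continuous_pairing (ξ : Fin m → ℂ) : Continuous (pairing ξ) := by
  unfold pairing
  fun_prop

lemma continuous_pairing_left (z : Phase m) : Continuous fun ξ => pairing ξ z := by
  unfold pairing
  fun_prop

lemma pairing_phaseTensor (h : m + k = n) (ξ : Fin n → ℂ) (z : Phase m × Phase k) :
    pairing ξ (phaseTensor h z) = pairing (headC h ξ) z.1 + pairing (tailC h ξ) z.2 := by
  have h1 : phaseTensor h z = (joinModes h z.1.1 z.2.1, joinModes h z.1.2 z.2.2) := rfl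
  rw [pairing, sum_split h, h1]
  subst h
  simp [pairing, headC, tailC, joinModes]

lemma pairing_phaseSlice (h : m + k = n) (ξ : Fin n → ℂ) (x : Fin k → ℝ)
    (z : Phase m × (Fin k → ℝ)) :
    pairing ξ (phaseSlice h (x, z)) = pairing (headC h ξ) z.1 + pairing (tailC h ξ) (x, z.2) := by
  exact pairing_phaseTensor h ξ (z.1, (x, z.2))

/-- The function `w` is an integrable density on phase space whose Fourier transform is the
characteristic function `ξ ↦ ⟨ψ, D(ξ) ψ⟩` of `ψ`; that is, `w` is the Wigner function of `ψ`. -/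
def IsWignerDensity (ψ : Modes m) (w : Phase m → ℝ) : Prop :=
  Integrable w ∧ ∀ ξ : Fin m → ℂ, ⟪ψ, displacement ξ ψ⟫_ℂ =
    ∫ z, Complex.exp ((pairing ξ z : ℂ) * Complex.I) * (w z : ℂ)

lemma integrable_cexp_mul {X : Type*} [MeasurableSpace X] {μ : Measure X} {f : X → ℝ}
    (hf : AEMeasurable f μ) {g : X → ℂ} (hg : Integrable g μ) :
    Integrable (fun x => Complex.exp ((f x : ℂ) * Complex.I) * g x) μ := by
  refine hg.bdd_mul (c := 1) ?_ (Eventually.of_forall fun v =>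
    (Complex.norm_exp_ofReal_mul_I _).le)
  exact (Complex.measurable_exp.comp_aemeasurable
    ((Complex.measurable_ofReal.comp_aemeasurable hf).mul_const _)).aestronglyMeasurable

lemma integrable_cexp_pairing_mul (ξ : Fin m → ℂ) {w : Phase m → ℝ} (hw : Integrable w) :
    Integrable fun z => Complex.exp ((pairing ξ z : ℂ) * Complex.I) * (w z : ℂ) :=
  integrable_cexp_mul (continuous_pairing ξ).measurable.aemeasurable hw.ofReal

lemma pairing_zero (z : Phase m) : pairing 0 z = 0 := by simp [pairing]

/-- Total mass is the Fourier transform at `ξ = 0`, where the displacement is the identity. -/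
lemma IsWignerDensity.integral_eq {ψ : Modes m} {w : Phase m → ℝ} (h : IsWignerDensity ψ w) :
    ∫ z, w z = ‖ψ‖ ^ 2 := by
  have h1 := h.2 0
  rw [displacement_zero, inner_self_complex] at h1
  simp only [pairing_zero, Complex.ofReal_zero, zero_mul, Complex.exp_zero, one_mul] at h1
  rw [integral_complex_ofReal] at h1
  exact_mod_cast h1.symm

section Tensor

/-- The product of two densities on phase space. -/
def tensorDensity (h : m + k = n) (w : Phase m → ℝ) (v : Phase k → ℝ) (z : Phase n) : ℝ :=
  w ((phaseTensor h).symm z).1 * v ((phaseTensor h).symm z).2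

lemma integrable_tensorDensity (h : m + k = n) {w : Phase m → ℝ} {v : Phase k → ℝ}
    (hw : Integrable w) (hv : Integrable v) : Integrable (tensorDensity h w v) := by
  rw [← (measurePreserving_phaseTensor h).integrable_comp_emb (phaseTensor h).measurableEmbedding]
  refine (hw.mul_prod hv).congr (Eventually.of_forall fun z => ?_)
  simp [tensorDensity]

lemma integral_tensorDensity (h : m + k = n) (w : Phase m → ℝ) (v : Phase k → ℝ) :
    ∫ z, tensorDensity h w v z = (∫ z, w z) * ∫ z, v z := by
  rw [← (measurePreserving_phaseTensor h).integral_comp (phaseTensor h).measurableEmbedding,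
    ← integral_prod_mul]
  simp [tensorDensity, Measure.volume_eq_prod]

/-- Displacements of product vectors factorise and the pairing is additive, so characteristic
functions and Fourier integrals both multiply. -/
lemma IsWignerDensity.tensor (h : m + k = n) {ψ : Modes m} {φ : Modes k} {w : Phase m → ℝ}
    {v : Phase k → ℝ} (hw : IsWignerDensity ψ w) (hv : IsWignerDensity φ v) :
    IsWignerDensity (tensor h ψ φ) (tensorDensity h w v) := by
  refine ⟨integrable_tensorDensity h hw.1 hv.1, fun ξ => ?_⟩
  rw [displacement_tensor, inner_tensor, hw.2, hv.2, ← integral_prod_mul,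
    ← (measurePreserving_phaseTensor h).integral_comp (phaseTensor h).measurableEmbedding]
  refine integral_congr_ae (Eventually.of_forall fun z => ?_)
  simp only [pairing_phaseTensor, tensorDensity, MeasurableEquiv.symm_apply_apply]
  push_cast
  rw [add_mul, Complex.exp_add]
  ring

lemma tensorDensity_ae_le (h : m + k = n) {w w' : Phase m → ℝ} {v : Phase k → ℝ}
    (hv : ∀ z, 0 ≤ v z) (hw : w ≤ᵐ[volume] w') :
    tensorDensity h w v ≤ᵐ[volume] tensorDensity h w' v := by
  have h1 : Measure.QuasiMeasurePreserving (fun z => ((phaseTensor h).symm z).1) volume volume :=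
    Measure.quasiMeasurePreserving_fst.comp
      ((measurePreserving_phaseTensor h).symm _).quasiMeasurePreserving
  filter_upwards [h1.ae hw] with z hz
  exact mul_le_mul_of_nonneg_right hz (hv _)

end Tensor

section Slice

/-- The density obtained by fixing the positions of the last `k` modes and integrating out their
momenta. -/
def sliceDensity (h : m + k = n) (w : Phase n → ℝ) (x : Fin k → ℝ) (a : Phase m) : ℝ :=
  ∫ p, w (phaseSlice h (x, (a, p)))

lemma integrable_comp_phaseSlice (h : m + k = n) {w : Phase n → ℝ} (hw : Integrable w) :
    Integrable fun z : (Fin k → ℝ) × (Phase m × (Fin k → ℝ)) => w (phaseSlice h z) :=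
  ((measurePreserving_phaseSlice h).integrable_comp_emb (phaseSlice h).measurableEmbedding).2 hw

lemma ae_integrable_sliceDensity (h : m + k = n) {w : Phase n → ℝ} (hw : Integrable w) :
    ∀ᵐ x : Fin k → ℝ, Integrable (sliceDensity h w x) := by
  filter_upwards [(integrable_comp_phaseSlice h hw).prod_right_ae] with x hx
  exact hx.integral_prod_left

lemma ae_integral_sliceDensity (h : m + k = n) {w : Phase n → ℝ} (hw : Integrable w) :
    ∀ᵐ x : Fin k → ℝ, ∫ a, sliceDensity h w x a =
      ∫ z : Phase m × (Fin k → ℝ), w (phaseSlice h (x, z)) := by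
  filter_upwards [(integrable_comp_phaseSlice h hw).prod_right_ae] with x hx
  exact (integral_prod _ hx).symm

lemma integrable_integral_sliceDensity (h : m + k = n) {w : Phase n → ℝ} (hw : Integrable w) :
    Integrable fun x : Fin k → ℝ => ∫ a, sliceDensity h w x a := by
  refine (integrable_comp_phaseSlice h hw).integral_prod_left.congr ?_
  filter_upwards [ae_integral_sliceDensity h hw] with x hx
  exact hx.symm

lemma integral_integral_sliceDensity (h : m + k = n) {w : Phase n → ℝ} (hw : Integrable w) :
    ∫ x : Fin k → ℝ, ∫ a, sliceDensity h w x a = ∫ z, w z := by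
  rw [integral_congr_ae (ae_integral_sliceDensity h hw),
    ← (measurePreserving_phaseSlice h).integral_comp (phaseSlice h).measurableEmbedding]
  exact (integral_prod _ (integrable_comp_phaseSlice h hw)).symm

lemma sliceDensity_ae_le (h : m + k = n) {w w' : Phase n → ℝ} (hw : Integrable w)
    (hw' : Integrable w') (hle : w ≤ᵐ[volume] w') :
    ∀ᵐ x : Fin k → ℝ, sliceDensity h w x ≤ᵐ[volume] sliceDensity h w' x := by
  have h1 : ∀ᵐ z, w (phaseSlice h z) ≤ w' (phaseSlice h z) :=
    (measurePreserving_phaseSlice h).quasiMeasurePreserving.ae hle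
  filter_upwards [Measure.ae_ae_of_ae_prod h1, (integrable_comp_phaseSlice h hw).prod_right_ae,
    (integrable_comp_phaseSlice h hw').prod_right_ae] with x h2 h3 h4
  filter_upwards [Measure.ae_ae_of_ae_prod h2, h3.prod_right_ae, h4.prod_right_ae] with a h5 h6 h7
  exact integral_mono_ae h6 h7 h5

lemma dual_eq_sum (L : StrongDual ℝ (Fin k → ℝ)) (x : Fin k → ℝ) :
    L x = ∑ j, L (Pi.single j 1) * x j := by
  have := LinearMap.pi_apply_eq_sum_univ (L : (Fin k → ℝ) →ₗ[ℝ] ℝ) x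
  simp only [ContinuousLinearMap.coe_coe, smul_eq_mul] at this
  rw [this]
  refine Finset.sum_congr rfl fun j _ => ?_
  rw [mul_comm]
  congr 2
  ext i
  simp [Pi.single_apply, eq_comm]

/-- Both sides are integrable functions of the outcome `x` with the same Fourier transform. Testing
against a character of `x` amounts to adding a momentum displacement of the measured modes, and this
turns the claim into the Wigner property of the unsliced vector `φ`. -/
lemma ae_inner_displacement_slice (h : m + k = n) {φ : Modes n} {w : Phase n → ℝ}
    (hw : IsWignerDensity φ w) (ξ : Fin m → ℂ) :
    ∀ᵐ x : Fin k → ℝ, ⟪slice h φ x, displacement ξ (slice h φ x)⟫_ℂ =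
      ∫ a, Complex.exp ((pairing ξ a : ℂ) * Complex.I) * (sliceDensity h w x a : ℂ) := by
  have hint : Integrable fun z : (Fin k → ℝ) × (Phase m × (Fin k → ℝ)) =>
      Complex.exp ((pairing ξ z.2.1 : ℂ) * Complex.I) * (w (phaseSlice h z) : ℂ) :=
    integrable_cexp_mul ((continuous_pairing ξ).measurable.comp
      measurable_snd.fst).aemeasurable (integrable_comp_phaseSlice h hw.1).ofReal
  let G : (Fin k → ℝ) → ℂ := fun x => ∫ z : Phase m × (Fin k → ℝ),
    Complex.exp ((pairing ξ z.1 : ℂ) * Complex.I) * (w (phaseSlice h (x, z)) : ℂ)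
  have hG : Integrable G := hint.integral_prod_left
  have hGeq : ∀ᵐ x, G x =
      ∫ a, Complex.exp ((pairing ξ a : ℂ) * Complex.I) * (sliceDensity h w x a : ℂ) := by
    filter_upwards [hint.prod_right_ae] with x hx
    refine (integral_prod _ hx).trans (integral_congr_ae (Eventually.of_forall fun a => ?_))
    simp only
    rw [integral_const_mul, integral_complex_ofReal]
    rfl
  have hslice : ∀ η : Fin k → ℂ, (∀ j, (η j).re = 0) →
      (fun x : Fin k → ℝ => ⟪slice h φ x, slice h (displacement (joinC h ξ η) φ) x⟫_ℂ) =ᵐ[volume]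
      fun x => Complex.exp ((∑ j, √2 * (η j).im * x j : ℝ) * Complex.I) *
        ⟪slice h φ x, displacement ξ (slice h φ x)⟫_ℂ := fun η hη => by
    filter_upwards [slice_displacement h (joinC h ξ η) (by simpa using hη) φ] with x hx
    rw [hx, inner_smul_right]
    simp
  have hF : Integrable fun x : Fin k → ℝ => ⟪slice h φ x, displacement ξ (slice h φ x)⟫_ℂ := by
    refine (integrable_inner_slice h φ (displacement (joinC h ξ 0) φ)).congr
      ((hslice 0 (by simp)).trans (Eventually.of_forall fun x => ?_))
    simp
  have key := ae_eq_of_fourier hF hG fun L => by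
    -- Purely imaginary amplitudes displace only momenta; the factor `1/√2` makes the phase produced
    -- by slicing equal to `exp(i L x)`.
    let η : Fin k → ℂ := fun j => ((L (Pi.single j 1) / √2 : ℝ) : ℂ) * Complex.I
    have hη : ∀ j, (η j).re = 0 := fun j => by simp [η]
    have hηi : ∀ j, √2 * (η j).im = L (Pi.single j 1) := fun j => by
      simp only [η, Complex.im_ofReal_mul, Complex.I_im, mul_one]
      field_simp
    have hL : ∀ x : Fin k → ℝ, L x = ∑ j, √2 * (η j).im * x j := fun x => by
      rw [dual_eq_sum]
      simp only [hηi]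
    have h1 : ∫ x : Fin k → ℝ, Complex.exp ((L x : ℂ) * Complex.I) *
        ⟪slice h φ x, displacement ξ (slice h φ x)⟫_ℂ = ⟪φ, displacement (joinC h ξ η) φ⟫_ℂ := by
      rw [← integral_inner_slice h, integral_congr_ae (hslice η hη)]
      simp only [hL]
    rw [h1, hw.2, ← (measurePreserving_phaseSlice h).integral_comp
      (phaseSlice h).measurableEmbedding]
    have hint2 : Integrable fun z : (Fin k → ℝ) × (Phase m × (Fin k → ℝ)) =>
        Complex.exp ((pairing (joinC h ξ η) (phaseSlice h z) : ℂ) * Complex.I) *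
          (w (phaseSlice h z) : ℂ) :=
      ((measurePreserving_phaseSlice h).integrable_comp_emb
        (phaseSlice h).measurableEmbedding).2 (integrable_cexp_pairing_mul (joinC h ξ η) hw.1)
    refine (integral_prod _ hint2).trans (integral_congr_ae (Eventually.of_forall fun x => ?_))
    simp only [G]
    rw [← integral_const_mul]
    refine integral_congr_ae (Eventually.of_forall fun z => ?_)
    simp only [pairing_phaseSlice, headC_joinC, tailC_joinC]
    -- Because `η` has no real part, the measured modes' momenta drop out of the pairing.
    have h2 : pairing η (x, z.2) = L x := by
      rw [hL, pairing]
      refine Finset.sum_congr rfl fun j _ => ?_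
      rw [hη]
      ring
    rw [h2]
    push_cast
    rw [add_mul, Complex.exp_add]
    ring
  filter_upwards [key, hGeq] with x h1 h2
  exact h1.trans h2

lemma continuous_integral_cexp_pairing {w : Phase m → ℝ} (hw : Integrable w) :
    Continuous fun ξ : Fin m → ℂ =>
      ∫ a, Complex.exp ((pairing ξ a : ℂ) * Complex.I) * (w a : ℂ) := by
  refine continuous_of_dominated (bound := fun a => ‖w a‖)
    (fun ξ => (integrable_cexp_pairing_mul ξ hw).aestronglyMeasurable)
    (fun ξ => Eventually.of_forall fun a => ?_) hw.norm (Eventually.of_forall fun a => ?_)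
  · rw [norm_mul, Complex.norm_exp_ofReal_mul_I, one_mul, Complex.norm_real]
  · have := continuous_pairing_left a
    fun_prop

lemma continuous_inner_displacement_self (ψ : Modes m) :
    Continuous fun ξ : Fin m → ℂ => ⟪ψ, displacement ξ ψ⟫_ℂ :=
  continuous_inner_displacement ψ ψ

/-- Homodyne detection maps Wigner densities to conditional Wigner densities. -/
lemma IsWignerDensity.ae_slice (h : m + k = n) {φ : Modes n} {w : Phase n → ℝ}
    (hw : IsWignerDensity φ w) :
    ∀ᵐ x : Fin k → ℝ, IsWignerDensity (slice h φ x) (sliceDensity h w x) := by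
  -- The null set of outcomes depends on `ξ`. A dense sequence of `ξ` gives one null set, and
  -- continuity of both sides in `ξ` covers the rest.
  have h1 : ∀ᵐ x : Fin k → ℝ, ∀ i : ℕ,
      ⟪slice h φ x, displacement (TopologicalSpace.denseSeq (Fin m → ℂ) i) (slice h φ x)⟫_ℂ =
      ∫ a, Complex.exp ((pairing (TopologicalSpace.denseSeq (Fin m → ℂ) i) a : ℂ) * Complex.I) *
        (sliceDensity h w x a : ℂ) :=
    ae_all_iff.2 fun i => ae_inner_displacement_slice h hw _
  filter_upwards [h1, ae_integrable_sliceDensity h hw.1] with x hx hi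
  refine ⟨hi, fun ξ => ?_⟩
  refine congr_fun (Continuous.ext_on (TopologicalSpace.denseRange_denseSeq (Fin m → ℂ))
    (continuous_inner_displacement_self _) (continuous_integral_cexp_pairing hi) ?_) ξ
  rintro _ ⟨i, rfl⟩
  exact hx i

end Slice

end

section

variable {m k n : ℕ}

/-! ### Gaussian Wigner densities of coherent vectors -/

section CoherentDensity

/-- The Gaussian Wigner function of the coherent vector `|β⟩`. -/
def coherentDensity (β : Fin m → ℂ) (z : Phase m) : ℝ :=
  (∏ j, (√Real.pi)⁻¹ * Real.exp (-(z.1 j - √2 * (β j).re) ^ 2)) *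
    ∏ j, (√Real.pi)⁻¹ * Real.exp (-(z.2 j - √2 * (β j).im) ^ 2)

lemma coherentDensity_nonneg (β : Fin m → ℂ) (z : Phase m) : 0 ≤ coherentDensity β z :=
  mul_nonneg (Finset.prod_nonneg fun j _ => by positivity)
    (Finset.prod_nonneg fun j _ => by positivity)

lemma integrable_gaussian (a : ℝ) :
    Integrable fun t : ℝ => (√Real.pi)⁻¹ * Real.exp (-(t - a) ^ 2) := by
  have h := (integrable_exp_neg_mul_sq (b := 1) one_pos).comp_sub_right a
  simp only [neg_mul, one_mul] at h
  exact h.const_mul _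

lemma integral_gaussian_eq_one (a : ℝ) :
    ∫ t : ℝ, (√Real.pi)⁻¹ * Real.exp (-(t - a) ^ 2) = 1 := by
  rw [integral_const_mul, integral_sub_right_eq_self (fun t : ℝ => Real.exp (-t ^ 2))]
  have h := integral_gaussian 1
  simp only [neg_mul, one_mul, div_one] at h
  rw [h, inv_mul_cancel₀ (Real.sqrt_pos.2 Real.pi_pos).ne']

lemma integrable_pi_gaussian (a : Fin m → ℝ) : Integrable fun y : Fin m → ℝ =>
    ∏ j, (√Real.pi)⁻¹ * Real.exp (-(y j - a j) ^ 2) :=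
  Integrable.fintype_prod_dep (fun j => integrable_gaussian (a j))

lemma integral_pi_gaussian (a : Fin m → ℝ) :
    ∫ y : Fin m → ℝ, ∏ j, (√Real.pi)⁻¹ * Real.exp (-(y j - a j) ^ 2) = 1 := by
  rw [integral_fintype_prod_volume_eq_prod
    (fun j (t : ℝ) => (√Real.pi)⁻¹ * Real.exp (-(t - a j) ^ 2))]
  simp [integral_gaussian_eq_one]

lemma integrable_coherentDensity (β : Fin m → ℂ) : Integrable (coherentDensity β) :=
  (integrable_pi_gaussian fun j => √2 * (β j).re).mul_prod
    (integrable_pi_gaussian fun j => √2 * (β j).im)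

lemma integral_coherentDensity (β : Fin m → ℂ) : ∫ z, coherentDensity β z = 1 := by
  have h := integral_prod_mul (μ := (volume : Measure (Fin m → ℝ)))
    (ν := (volume : Measure (Fin m → ℝ)))
    (fun y : Fin m → ℝ => ∏ j, (√Real.pi)⁻¹ * Real.exp (-(y j - √2 * (β j).re) ^ 2))
    (fun y : Fin m → ℝ => ∏ j, (√Real.pi)⁻¹ * Real.exp (-(y j - √2 * (β j).im) ^ 2))
  rw [integral_pi_gaussian, integral_pi_gaussian, mul_one] at h
  exact h

lemma integral_cexp_gaussian (a t : ℝ) :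
    ∫ y : ℝ, Complex.exp ((t * y : ℝ) * Complex.I) *
      (((√Real.pi)⁻¹ * Real.exp (-(y - a) ^ 2) : ℝ) : ℂ) =
      Complex.exp (t * a * Complex.I - t ^ 2 / 4) := by
  have h : ∀ y : ℝ, Complex.exp ((t * y : ℝ) * Complex.I) *
      (((√Real.pi)⁻¹ * Real.exp (-(y - a) ^ 2) : ℝ) : ℂ) = (((√Real.pi)⁻¹ : ℝ) : ℂ) *
      Complex.exp (-(y : ℂ) ^ 2 + (2 * a + t * Complex.I) * y + (-(a : ℂ) ^ 2)) := fun y => by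
    rw [Complex.ofReal_mul (√Real.pi)⁻¹, mul_left_comm, Complex.ofReal_exp, ← Complex.exp_add]
    congr 2
    push_cast
    ring
  simp only [h]
  rw [integral_const_mul, integral_gaussian_linear, ← mul_assoc, ← Complex.ofReal_mul,
    inv_mul_cancel₀ (Real.sqrt_pos.2 Real.pi_pos).ne', Complex.ofReal_one, one_mul]
  congr 1
  have := Complex.I_sq
  linear_combination (t ^ 2 / 4 : ℂ) * this

/-- The right side is arranged as the product of the characteristic functions of a position Gaussian
at `a` (argument `p`) and a momentum Gaussian at `b` (argument `-x`), ready to match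
`integral_cexp_gaussian`. -/
lemma integral_coherentWave_displaced (x p a b : ℝ) :
    ∫ y : ℝ, (starRingEnd ℂ) (coherentWave a b y) *
      (Complex.exp ((p * y - x * p / 2 : ℝ) * Complex.I) * coherentWave a b (y - x)) =
    Complex.exp (p * a * Complex.I - p ^ 2 / 4) * Complex.exp ((-x : ℝ) * b * Complex.I - x ^ 2 / 4) := by
  have h : ∀ y : ℝ, (starRingEnd ℂ) (coherentWave a b y) *
      (Complex.exp ((p * y - x * p / 2 : ℝ) * Complex.I) * coherentWave a b (y - x)) =
      (((√Real.pi)⁻¹ : ℝ) : ℂ) * Complex.exp (-(y : ℂ) ^ 2 + (2 * a + x + p * Complex.I) * y +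
        (-(a : ℂ) ^ 2 - a * x - x ^ 2 / 2 - (x * p / 2 + b * x) * Complex.I)) := fun y => by
    simp only [coherentWave, map_mul, Complex.conj_ofReal, ← Complex.exp_conj, map_add, map_sub,
      map_div₀, map_neg, map_pow, Complex.conj_I, map_ofNat]
    rw [← pi_rpow_mul_self, mul_mul_mul_comm, mul_left_comm (Complex.exp _) _ (Complex.exp _),
      mul_mul_mul_comm, mul_assoc, mul_assoc]
    congr 2
    rw [← Complex.exp_add, ← Complex.exp_add]
    congr 1
    push_cast
    ring
  simp only [h]
  rw [integral_const_mul, integral_gaussian_linear, ← mul_assoc, ← Complex.ofReal_mul,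
    inv_mul_cancel₀ (Real.sqrt_pos.2 Real.pi_pos).ne', Complex.ofReal_one, one_mul,
    ← Complex.exp_add]
  congr 1
  have := Complex.I_sq
  push_cast
  linear_combination (p ^ 2 / 4 : ℂ) * this

lemma inner_coherent_displacement (β ξ : Fin m → ℂ) :
    ⟪coherent β, displacement ξ (coherent β)⟫_ℂ = ∏ j,
      (Complex.exp ((√2 * (ξ j).im : ℝ) * (√2 * (β j).re : ℝ) * Complex.I -
          (√2 * (ξ j).im : ℝ) ^ 2 / 4) *
        Complex.exp ((-(√2 * (ξ j).re) : ℝ) * (√2 * (β j).im : ℝ) * Complex.I -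
          (√2 * (ξ j).re : ℝ) ^ 2 / 4)) := by
  rw [inner_eq_integral_of_ae (coherent_coeFn β)
    (displacement_coeFn_of_ae ξ (coherent_coeFn β))]
  simp only [weylPhase_eq_prod, coherentFun, map_prod, ← Finset.prod_mul_distrib, Pi.sub_apply,
    ← integral_coherentWave_displaced]
  exact integral_fintype_prod_volume_eq_prod (𝕜 := ℂ) (fun j (t : ℝ) =>
    (starRingEnd ℂ) (coherentWave (√2 * (β j).re) (√2 * (β j).im) t) *
      (Complex.exp ((√2 * (ξ j).im * t - √2 * (ξ j).re * (√2 * (ξ j).im) / 2 : ℝ) * Complex.I) *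
        coherentWave (√2 * (β j).re) (√2 * (β j).im) (t - √2 * (ξ j).re)))

/-- Used to see that a displacement acts on the vacuum as a phase only if its amplitude vanishes. -/
lemma norm_inner_vacuum_displacement (ξ : Fin m → ℂ) :
    ‖⟪vacuum m, displacement ξ (vacuum m)⟫_ℂ‖ = Real.exp (-(∑ j, ‖ξ j‖ ^ 2) / 2) := by
  rw [vacuum_eq_coherent, inner_coherent_displacement, norm_prod, neg_div, Finset.sum_div,
    ← Finset.sum_neg_distrib, Real.exp_sum]
  refine Finset.prod_congr rfl fun j _ => ?_
  rw [norm_mul, Complex.norm_exp, Complex.norm_exp, ← Real.exp_add]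
  congr 1
  rw [← Complex.normSq_eq_norm_sq, Complex.normSq_apply]
  have h2 : √2 ^ 2 = (2 : ℝ) := Real.sq_sqrt (by norm_num)
  have e1 : ((√2 * (ξ j).im : ℝ) : ℂ) ^ 2 / 4 = (((√2 * (ξ j).im) ^ 2 / 4 : ℝ) : ℂ) := by
    push_cast; ring
  have e2 : ((√2 * (ξ j).re : ℝ) : ℂ) ^ 2 / 4 = (((√2 * (ξ j).re) ^ 2 / 4 : ℝ) : ℂ) := by
    push_cast; ring
  rw [e1, e2, Complex.sub_re, Complex.sub_re, Complex.ofReal_re, Complex.ofReal_re]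
  simp only [Pi.zero_apply, Complex.zero_re, Complex.zero_im, mul_zero, Complex.ofReal_zero,
    zero_mul]
  rw [mul_pow, mul_pow, h2]
  ring

lemma isWignerDensity_coherent (β : Fin m → ℂ) :
    IsWignerDensity (coherent β) (coherentDensity β) := by
  refine ⟨integrable_coherentDensity β, fun ξ => ?_⟩
  have h2 := integral_prod_mul (μ := (volume : Measure (Fin m → ℝ)))
    (ν := (volume : Measure (Fin m → ℝ)))
    (fun y : Fin m → ℝ => ∏ j, (Complex.exp ((√2 * (ξ j).im * y j : ℝ) * Complex.I) *
      (((√Real.pi)⁻¹ * Real.exp (-(y j - √2 * (β j).re) ^ 2) : ℝ) : ℂ)))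
    (fun y : Fin m → ℝ => ∏ j, (Complex.exp ((-(√2 * (ξ j).re) * y j : ℝ) * Complex.I) *
      (((√Real.pi)⁻¹ * Real.exp (-(y j - √2 * (β j).im) ^ 2) : ℝ) : ℂ)))
  rw [integral_fintype_prod_volume_eq_prod (fun j (t : ℝ) =>
      Complex.exp ((√2 * (ξ j).im * t : ℝ) * Complex.I) *
      (((√Real.pi)⁻¹ * Real.exp (-(t - √2 * (β j).re) ^ 2) : ℝ) : ℂ)),
    integral_fintype_prod_volume_eq_prod (fun j (t : ℝ) =>
      Complex.exp ((-(√2 * (ξ j).re) * t : ℝ) * Complex.I) *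
      (((√Real.pi)⁻¹ * Real.exp (-(t - √2 * (β j).im) ^ 2) : ℝ) : ℂ))] at h2
  simp only [integral_cexp_gaussian] at h2
  rw [inner_coherent_displacement, Finset.prod_mul_distrib]
  refine Eq.trans ?_ (h2.symm.trans (integral_congr_ae (Eventually.of_forall fun z => ?_)))
  · congr 1
    refine Finset.prod_congr rfl fun j _ => ?_
    congr 2
    push_cast
    ring
  · simp only [coherentDensity, Finset.prod_mul_distrib (f := fun j => Complex.exp _), pairing]
    rw [← Complex.exp_sum, ← Complex.exp_sum, mul_mul_mul_comm, ← Complex.exp_add,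
      ← Complex.ofReal_prod, ← Complex.ofReal_prod, ← Complex.ofReal_mul]
    congr 2
    rw [← Finset.sum_add_distrib, Complex.ofReal_sum, Finset.sum_mul]
    refine Finset.sum_congr rfl fun j _ => ?_
    push_cast
    ring

lemma norm_coherent (β : Fin m → ℂ) : ‖coherent β‖ = 1 := by
  have h := (isWignerDensity_coherent β).integral_eq
  rw [integral_coherentDensity] at h
  nlinarith [norm_nonneg (coherent β)]

end CoherentDensity

end

section

variable {m k n : ℕ}

/-! ### Gaussian unitaries as affine maps of phase space -/

section GaussianUnitary

/-- The pairing as a linear map from phase space to the dual of the space of displacements. -/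
def pairingLin (n : ℕ) : Phase n →ₗ[ℝ] Module.Dual ℝ (Fin n → ℂ) :=
  LinearMap.mk₂ ℝ (fun z ξ => pairing ξ z)
    (fun z z' ξ => by
      simp only [pairing, Prod.fst_add, Prod.snd_add, Pi.add_apply, ← Finset.sum_add_distrib]
      exact Finset.sum_congr rfl fun j _ => by ring)
    (fun c z ξ => by
      simp only [pairing, Prod.smul_fst, Prod.smul_snd, Pi.smul_apply, smul_eq_mul,
        Finset.mul_sum]
      exact Finset.sum_congr rfl fun j _ => by ring)
    (fun z ξ ξ' => by
      simp only [pairing, Pi.add_apply, Complex.add_re, Complex.add_im, ← Finset.sum_add_distrib]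
      exact Finset.sum_congr rfl fun j _ => by ring)
    (fun c z ξ => by
      simp only [pairing, Pi.smul_apply, Complex.real_smul, Complex.re_ofReal_mul,
        Complex.im_ofReal_mul, smul_eq_mul, Finset.mul_sum]
      exact Finset.sum_congr rfl fun j _ => by ring)

@[simp] lemma pairingLin_apply (z : Phase n) (ξ : Fin n → ℂ) : pairingLin n z ξ = pairing ξ z := rfl

lemma pairingLin_injective (n : ℕ) : Function.Injective (pairingLin n) := by
  rw [injective_iff_map_eq_zero]
  intro z hz
  have h : ∀ ξ, pairing ξ z = 0 := fun ξ => by rw [← pairingLin_apply, hz]; rfl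
  have h2 : √2 ≠ (0 : ℝ) := by positivity
  refine Prod.ext (funext fun j => ?_) (funext fun j => ?_)
  · have := h (Pi.single j Complex.I)
    rw [pairing, Finset.sum_eq_single j (fun i _ hi => by simp [hi]) (by simp)] at this
    simpa using this
  · have := h (Pi.single j 1)
    rw [pairing, Finset.sum_eq_single j (fun i _ hi => by simp [hi]) (by simp)] at this
    simpa using this

/-- Phase space as the dual of the space of displacements. -/
def pairingEquiv (n : ℕ) : Phase n ≃ₗ[ℝ] Module.Dual ℝ (Fin n → ℂ) :=
  LinearMap.linearEquivOfInjective (pairingLin n) (pairingLin_injective n) (by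
    rw [Subspace.dual_finrank_eq, Module.finrank_prod, Module.finrank_pi_fintype]
    rw [Module.finrank_pi_fintype]
    simp [Complex.finrank_real_complex]
    ring)

lemma pairing_pairingEquiv_symm (f : Module.Dual ℝ (Fin n → ℂ)) (ξ : Fin n → ℂ) :
    pairing ξ ((pairingEquiv n).symm f) = f ξ := by
  have h : pairingEquiv n ((pairingEquiv n).symm f) = f := LinearEquiv.apply_symm_apply _ _
  exact congr_arg (fun g : Module.Dual ℝ (Fin n → ℂ) => g ξ) h

instance isAddHaarMeasure_phase (n : ℕ) : (volume : Measure (Phase n)).IsAddHaarMeasure :=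
  Measure.prod.instIsAddHaarMeasure (volume : Measure (Fin n → ℝ)) (volume : Measure (Fin n → ℝ))

/-- If `S α = 0`, then `D(α)` is a scalar of modulus one on the vacuum. The vacuum expectation of
`D(α)` has modulus `exp(-∑ |αⱼ|²/2)`, so `α = 0`. -/
lemma gaussian_linear_injective {U : Modes n ≃ₗᵢ[ℂ] Modes n}
    {S : (Fin n → ℂ) →ₗ[ℝ] (Fin n → ℂ)} {lam : (Fin n → ℂ) →ₗ[ℝ] ℝ}
    (hU : ∀ (α : Fin n → ℂ) (ψ : Modes n),
      U (displacement α ψ) = Complex.exp ((lam α : ℂ) * Complex.I) • displacement (S α) (U ψ)) :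
    Function.Injective S := by
  rw [injective_iff_map_eq_zero]
  intro α hα
  have h1 := hU α (vacuum n)
  rw [hα, displacement_zero, ← map_smul] at h1
  have h2 := U.injective h1
  have h3 := norm_inner_vacuum_displacement α
  have hv : ‖vacuum n‖ = 1 := by rw [vacuum_eq_coherent, norm_coherent]
  rw [h2, inner_smul_right, norm_mul, Complex.norm_exp_ofReal_mul_I, inner_self_complex, hv] at h3
  simp only [one_pow, Complex.ofReal_one, norm_one, mul_one] at h3
  rw [eq_comm, Real.exp_eq_one_iff] at h3
  have h4 : ∑ j, ‖α j‖ ^ 2 = 0 := by linarith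
  rw [Finset.sum_eq_zero_iff_of_nonneg (fun j _ => by positivity)] at h4
  ext1 j
  simpa using h4 j (Finset.mem_univ j)

/-- Gaussian unitaries act on Wigner densities by affine changes of variables. -/
lemma IsGaussianUnitary.exists_affine {U : Modes n ≃ₗᵢ[ℂ] Modes n} (hU : IsGaussianUnitary U) :
    ∃ (A : Phase n ≃ᵐ Phase n) (κ : ℝ), 0 < κ ∧
      Measure.map A volume = ENNReal.ofReal κ • (volume : Measure (Phase n)) ∧
      ∀ ψ w, IsWignerDensity ψ w → IsWignerDensity (U ψ) fun z => κ * w (A.symm z) := by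
  obtain ⟨S, lam, hS⟩ := hU
  let Se := LinearEquiv.ofInjectiveEndo S (gaussian_linear_injective hS)
  have hSe : ∀ α, S (Se.symm α) = α := fun α => Se.apply_symm_apply α
  -- `T` is the transpose of `S⁻¹` under the pairing and `c` represents `lam ∘ S⁻¹`. The affine map
  -- `A` is designed so that pairing `ξ` with `A z` gives the pairing of `S⁻¹ ξ` with `z`, shifted
  -- by `-lam (S⁻¹ ξ)`.
  let T : Phase n ≃ₗ[ℝ] Phase n :=
    (pairingEquiv n).trans (Se.symm.dualMap.trans (pairingEquiv n).symm)
  let c : Phase n := (pairingEquiv n).symm (lam ∘ₗ (Se.symm : (Fin n → ℂ) →ₗ[ℝ] (Fin n → ℂ)))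
  let A : Phase n ≃ᵐ Phase n := T.toContinuousLinearEquiv.toHomeomorph.toMeasurableEquiv.trans
    (MeasurableEquiv.subRight c)
  have hA : ∀ z, A z = T z - c := fun z => rfl
  have hpair : ∀ ξ z, pairing ξ (A z) = pairing (Se.symm ξ) z - lam (Se.symm ξ) := fun ξ z => by
    have h1 : pairing ξ (T z) = pairing (Se.symm ξ) z := pairing_pairingEquiv_symm _ _
    have h2 : pairing ξ c = lam (Se.symm ξ) := pairing_pairingEquiv_symm _ _
    rw [hA, ← pairingLin_apply, map_sub, LinearMap.sub_apply, pairingLin_apply, pairingLin_apply,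
      h1, h2]
  have hdet : LinearMap.det (T : Phase n →ₗ[ℝ] Phase n) ≠ 0 := (LinearEquiv.isUnit_det' T).ne_zero
  -- The Jacobian factor of `A⁻¹`. Symplecticity of `S` would give `κ = 1`, but positivity is
  -- enough.
  let κ : ℝ := |(LinearMap.det (T : Phase n →ₗ[ℝ] Phase n))⁻¹|
  have hκ : 0 < κ := abs_pos.2 (inv_ne_zero hdet)
  have hmap : Measure.map A volume = ENNReal.ofReal κ • (volume : Measure (Phase n)) := by
    have h1 : Measure.map T volume = ENNReal.ofReal κ • (volume : Measure (Phase n)) :=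
      Measure.map_linearMap_addHaar_eq_smul_addHaar volume hdet
    have h2 : Measure.map (fun z => z - c) (volume : Measure (Phase n)) = volume :=
      (measurePreserving_sub_right volume c).map_eq
    have hTm : Measurable T := T.toContinuousLinearEquiv.toHomeomorph.toMeasurableEquiv.measurable
    have h3 : (A : Phase n → Phase n) = (fun z => z - c) ∘ T := rfl
    rw [h3, ← Measure.map_map (by fun_prop) hTm, h1, Measure.map_smul, h2]
  refine ⟨A, κ, hκ, hmap, fun ψ w hw => ⟨?_, fun ξ => ?_⟩⟩
  · refine Integrable.const_mul ?_ κ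
    have h1 : Integrable (fun z => w (A.symm z)) (Measure.map A volume) := by
      rw [integrable_map_equiv]
      refine hw.1.congr (Eventually.of_forall fun z => ?_)
      simp
    rw [hmap] at h1
    exact (integrable_smul_measure (by simpa using hκ) ENNReal.ofReal_ne_top).1 h1
  -- The intertwining relation solved for `D(ξ) U`, which reduces the characteristic function of `U
  -- ψ` at `ξ` to that of `ψ` at `S⁻¹ ξ`.
  · have h1 : displacement ξ (U ψ) = Complex.exp ((-lam (Se.symm ξ) : ℝ) * Complex.I) •
        U (displacement (Se.symm ξ) ψ) := by
      rw [hS, hSe, smul_smul, ← Complex.exp_add]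
      simp
    rw [h1, inner_smul_right, LinearIsometryEquiv.inner_map_map, hw.2, ← integral_const_mul]
    have h2 : ∫ z, Complex.exp ((pairing ξ z : ℂ) * Complex.I) * (w (A.symm z) : ℂ)
        ∂(Measure.map A volume) = ∫ z, Complex.exp ((pairing ξ (A z) : ℂ) * Complex.I) * (w z : ℂ) := by
      rw [integral_map_equiv]
      simp
    rw [hmap, integral_smul_measure, ENNReal.toReal_ofReal hκ.le, ← integral_smul] at h2
    refine Eq.trans (integral_congr_ae (Eventually.of_forall fun z => ?_))
      (h2.symm.trans (integral_congr_ae (Eventually.of_forall fun z => ?_)))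
    · simp only [hpair]
      rw [← mul_assoc, ← Complex.exp_add]
      congr 2
      push_cast
      ring
    · simp only [Complex.real_smul]
      push_cast
      ring

lemma integral_affine {A : Phase n ≃ᵐ Phase n} {κ : ℝ} (hκ : 0 < κ)
    (hA : Measure.map A volume = ENNReal.ofReal κ • (volume : Measure (Phase n)))
    (w : Phase n → ℝ) : ∫ z, κ * w (A.symm z) = ∫ z, w z := by
  have h : ∫ z, w (A.symm z) ∂(Measure.map A volume) = ∫ z, w z := by
    rw [integral_map_equiv]; simp
  rw [hA, integral_smul_measure, ENNReal.toReal_ofReal hκ.le, ← integral_smul] at h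
  exact h

lemma integrable_affine {A : Phase n ≃ᵐ Phase n} {κ : ℝ} (hκ : 0 < κ)
    (hA : Measure.map A volume = ENNReal.ofReal κ • (volume : Measure (Phase n)))
    {w : Phase n → ℝ} (hw : Integrable w) : Integrable fun z => κ * w (A.symm z) := by
  refine Integrable.const_mul ?_ κ
  have h1 : Integrable (fun z => w (A.symm z)) (Measure.map A volume) := by
    rw [integrable_map_equiv]
    refine hw.congr (Eventually.of_forall fun z => ?_)
    simp
  rw [hA] at h1
  exact (integrable_smul_measure (by simpa using hκ) ENNReal.ofReal_ne_top).1 h1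

lemma affine_ae_le {A : Phase n ≃ᵐ Phase n} {κ : ℝ} (hκ : 0 < κ)
    (hA : Measure.map A volume = ENNReal.ofReal κ • (volume : Measure (Phase n)))
    {w w' : Phase n → ℝ} (h : w ≤ᵐ[volume] w') :
    (fun z => κ * w (A.symm z)) ≤ᵐ[volume] fun z => κ * w' (A.symm z) := by
  have h1 : ∀ᵐ z ∂(Measure.map A volume), w (A.symm z) ≤ w' (A.symm z) := by
    rw [A.measurableEmbedding.ae_map_iff]
    simp only [MeasurableEquiv.symm_apply_apply]
    exact h
  rw [hA, Measure.ae_ennreal_smul_measure_eq (by simpa using hκ)] at h1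
  filter_upwards [h1] with z hz
  exact mul_le_mul_of_nonneg_left hz hκ.le

end GaussianUnitary

/-! ### The classical lower bound on the error of GOCC measurements -/

section GOCC


/-- The expectation values of a family of operators in the slices of a vector are integrable if
they are bounded by the squared norms. -/
lemma integrable_re_inner_slice (h : m + k = n) (φ : Modes n)
    {N : (Fin k → ℝ) → Modes m →L[ℂ] Modes m} (hN : ∀ ψ, Measurable fun x => ⟪ψ, N x ψ⟫_ℂ)
    (hb : ∀ x ψ, ‖⟪ψ, N x ψ⟫_ℂ‖ ≤ ‖ψ‖ ^ 2) :
    Integrable fun x : Fin k → ℝ => ⟪slice h φ x, N x (slice h φ x)⟫_ℂ :=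
  (integrable_norm_sq_slice h φ).mono' (aemeasurable_inner_slice h φ hN).aestronglyMeasurable
    (Eventually.of_forall fun x => hb x _)

lemma norm_tensor_vacuum (h : m + k = n) (ψ : Modes m) : ‖tensor h ψ (vacuum k)‖ = ‖ψ‖ := by
  have h1 := inner_tensor h ψ ψ (vacuum k) (vacuum k)
  rw [inner_self_complex, inner_self_complex, inner_self_complex, vacuum_eq_coherent,
    norm_coherent] at h1
  have h2 : ‖tensor h ψ (coherent (0 : Fin k → ℂ))‖ ^ 2 = ‖ψ‖ ^ 2 := by
    rw [← Complex.ofReal_mul] at h1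
    have := Complex.ofReal_injective h1
    simpa using this
  rw [vacuum_eq_coherent]
  exact (pow_left_inj₀ (norm_nonneg _) (norm_nonneg _) two_ne_zero).1 h2

lemma norm_inner_le_of_expectation {M : Fin 2 → Modes m →L[ℂ] Modes m} {ψ : Modes m}
    (h : (∀ ω, (⟪ψ, M ω ψ⟫_ℂ).im = 0 ∧ 0 ≤ (⟪ψ, M ω ψ⟫_ℂ).re) ∧
      (⟪ψ, M 0 ψ⟫_ℂ).re + (⟪ψ, M 1 ψ⟫_ℂ).re = ‖ψ‖ ^ 2) (ω : Fin 2) :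
    ‖⟪ψ, M ω ψ⟫_ℂ‖ ≤ ‖ψ‖ ^ 2 := by
  have h1 : ⟪ψ, M ω ψ⟫_ℂ = (((⟪ψ, M ω ψ⟫_ℂ).re : ℝ) : ℂ) := Complex.ext rfl (by simp [(h.1 ω).1])
  rw [h1, Complex.norm_real, Real.norm_eq_abs, abs_of_nonneg (h.1 ω).2, ← h.2]
  fin_cases ω
  · exact le_add_of_nonneg_right (h.1 1).2
  · exact le_add_of_nonneg_left (h.1 0).2

/-- The outcome probabilities of a GOCC protocol with two outcomes are non-negative and add up
to one. -/
lemma GOCCProtocol.expectation {R m : ℕ} {M : Fin 2 → Modes m →L[ℂ] Modes m}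
    (hM : GOCCProtocol R m M) (ψ : Modes m) :
    (∀ ω, (⟪ψ, M ω ψ⟫_ℂ).im = 0 ∧ 0 ≤ (⟪ψ, M ω ψ⟫_ℂ).re) ∧
      (⟪ψ, M 0 ψ⟫_ℂ).re + (⟪ψ, M 1 ψ⟫_ℂ).re = ‖ψ‖ ^ 2 := by
  induction hM with
  | announce ω₀ =>
    have h1 : (⟪ψ, ψ⟫_ℂ).re = ‖ψ‖ ^ 2 := by rw [inner_self_complex, Complex.ofReal_re]
    have h2 : (⟪ψ, ψ⟫_ℂ).im = 0 := by rw [inner_self_complex, Complex.ofReal_im]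
    refine ⟨fun ω => ?_, ?_⟩
    · beta_reduce
      split_ifs
      · simp only [one_apply_eq_self, h1, h2]
        exact ⟨trivial, by positivity⟩
      · simp
    · fin_cases ω₀ <;> simp [← Complex.ofReal_pow, Complex.ofReal_re]
  | @round R m k n m' l h h' U hU N hN hmeas M hM ih =>
    set φ := U (tensor h ψ (vacuum k)) with hφ
    -- The induction hypothesis bounds each conditional expectation by the squared norm of the
    -- slice, whose integral is finite.
    have hint : ∀ ω, Integrable fun x => ⟪slice h' φ x, N x ω (slice h' φ x)⟫_ℂ := fun ω =>
      integrable_re_inner_slice h' φ (hmeas ω) fun x χ => norm_inner_le_of_expectation (ih x χ) ω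
    have hint' : ∀ ω, Integrable fun x => (⟪slice h' φ x, N x ω (slice h' φ x)⟫_ℂ).re :=
      fun ω => (hint ω).re
    have hre : ∀ ω, (⟪ψ, M ω ψ⟫_ℂ).re = ∫ x, (⟪slice h' φ x, N x ω (slice h' φ x)⟫_ℂ).re :=
      fun ω => by
        rw [hM]
        exact (integral_re (hint ω)).symm
    have him : ∀ ω, (⟪ψ, M ω ψ⟫_ℂ).im = ∫ x, (⟪slice h' φ x, N x ω (slice h' φ x)⟫_ℂ).im :=
      fun ω => by
        rw [hM]
        exact (integral_im (hint ω)).symm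
    refine ⟨fun ω => ⟨?_, ?_⟩, ?_⟩
    · rw [him]
      simp only [((ih _ _).1 ω).1, integral_zero]
    · rw [hre]
      exact integral_nonneg fun x => ((ih x _).1 ω).2
    · rw [hre, hre, ← integral_add (hint' 0) (hint' 1)]
      refine (integral_congr_ae (Eventually.of_forall fun x => (ih x _).2)).trans ?_
      rw [integral_norm_sq_slice, hφ, LinearIsometryEquiv.norm_map, norm_tensor_vacuum]

/-- GOCC protocols cannot distinguish two states with Wigner functions `w₀`, `w₁` better than
these phase space densities can be distinguished classically. -/
lemma GOCCProtocol.integral_le {R m : ℕ} {M : Fin 2 → Modes m →L[ℂ] Modes m}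
    (hM : GOCCProtocol R m M) {ψ₀ ψ₁ : Modes m} {w₀ w₁ v : Phase m → ℝ}
    (h₀ : IsWignerDensity ψ₀ w₀) (h₁ : IsWignerDensity ψ₁ w₁) (hv : Integrable v)
    (hv₀ : v ≤ᵐ[volume] w₀) (hv₁ : v ≤ᵐ[volume] w₁) :
    ∫ z, v z ≤ (⟪ψ₀, M 1 ψ₀⟫_ℂ).re + (⟪ψ₁, M 0 ψ₁⟫_ℂ).re := by
  induction hM with
  | announce ω₀ =>
    -- A fixed announcement is always wrong under one of the hypotheses, where its error term is the
    -- whole squared norm `∫ wᵢ ≥ ∫ v`.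
    have e₀ : ∫ z, v z ≤ (⟪ψ₀, ψ₀⟫_ℂ).re := by
      rw [inner_self_complex, Complex.ofReal_re, ← h₀.integral_eq]
      exact integral_mono_ae hv h₀.1 hv₀
    have e₁ : ∫ z, v z ≤ (⟪ψ₁, ψ₁⟫_ℂ).re := by
      rw [inner_self_complex, Complex.ofReal_re, ← h₁.integral_eq]
      exact integral_mono_ae hv h₁.1 hv₁
    fin_cases ω₀
    · simpa using e₁
    · simpa using e₀
  | @round R m k n m' l h h' U hU N hN hmeas M hM ih =>
    obtain ⟨A, κ, hκ, hA, hUw⟩ := hU.exists_affine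
    have hvac : IsWignerDensity (vacuum k) (coherentDensity (0 : Fin k → ℂ)) := by
      rw [vacuum_eq_coherent]
      exact isWignerDensity_coherent 0
    have hd := coherentDensity_nonneg (0 : Fin k → ℂ)
    have hint : ∀ (φ : Modes n) ω, Integrable fun x => ⟪slice h' φ x, N x ω (slice h' φ x)⟫_ℂ :=
      fun φ ω => integrable_re_inner_slice h' φ (hmeas ω)
        fun x χ => norm_inner_le_of_expectation ((hN x).expectation χ) ω
    have hint' : ∀ (φ : Modes n) ω,
        Integrable fun x => (⟪slice h' φ x, N x ω (slice h' φ x)⟫_ℂ).re :=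
      fun φ ω => (hint φ ω).re
    have g₀ := hUw _ _ (h₀.tensor h hvac)
    have g₁ := hUw _ _ (h₁.tensor h hvac)
    -- The common lower bound `v` undergoes the same order-preserving linear operations as `w₀` and
    -- `w₁`. Carrying an arbitrary `v` keeps the induction closed, since a slice of the minimum of
    -- two densities need not be the minimum of their slices.
    have gv := integrable_affine hκ hA (integrable_tensorDensity h hv hvac.1)
    have gv₀ := affine_ae_le hκ hA (tensorDensity_ae_le h hd hv₀)
    have gv₁ := affine_ae_le hκ hA (tensorDensity_ae_le h hd hv₁)
    have hvint : ∫ z, v z = ∫ z, κ * tensorDensity h v (coherentDensity 0) (A.symm z) := by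
      rw [integral_affine hκ hA, integral_tensorDensity, integral_coherentDensity, mul_one]
    rw [hvint, ← integral_integral_sliceDensity h' gv, hM, hM]
    set φ₀ := U (tensor h ψ₀ (vacuum k))
    set φ₁ := U (tensor h ψ₁ (vacuum k))
    have e₀ : (∫ x, ⟪slice h' φ₀ x, N x 1 (slice h' φ₀ x)⟫_ℂ).re =
        ∫ x, (⟪slice h' φ₀ x, N x 1 (slice h' φ₀ x)⟫_ℂ).re := (integral_re (hint φ₀ 1)).symm
    have e₁ : (∫ x, ⟪slice h' φ₁ x, N x 0 (slice h' φ₁ x)⟫_ℂ).re =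
        ∫ x, (⟪slice h' φ₁ x, N x 0 (slice h' φ₁ x)⟫_ℂ).re := (integral_re (hint φ₁ 0)).symm
    rw [e₀, e₁, ← integral_add (hint' φ₀ 1) (hint' φ₁ 0)]
    refine integral_mono_ae (integrable_integral_sliceDensity h' gv)
      ((hint' φ₀ 1).add (hint' φ₁ 0)) ?_
    -- For almost every outcome the slices again have Wigner densities dominating the sliced bound,
    -- so the induction hypothesis applies outcome by outcome.
    filter_upwards [g₀.ae_slice h', g₁.ae_slice h', ae_integrable_sliceDensity h' gv,
      sliceDensity_ae_le h' gv g₀.1 gv₀, sliceDensity_ae_le h' gv g₁.1 gv₁] with x a₀ a₁ b c₀ c₁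
    exact ih x a₀ a₁ b c₀ c₁

/-- The bound for GOCC protocols extends to all binary GOCC measurements. -/
lemma integral_le_of_mem_GOCC {M : Modes m →L[ℂ] Modes m} (hM : M ∈ GOCC m)
    {ψ₀ ψ₁ : Modes m} {w₀ w₁ v : Phase m → ℝ}
    (h₀ : IsWignerDensity ψ₀ w₀) (h₁ : IsWignerDensity ψ₁ w₁) (hv : Integrable v)
    (hv₀ : v ≤ᵐ[volume] w₀) (hv₁ : v ≤ᵐ[volume] w₁) :
    ∫ z, v z ≤ 2 * errorProb (pureState ψ₀) (pureState ψ₁) M := by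
  -- The closure is taken for pointwise convergence on vectors, and twice the error only involves
  -- values at `ψ₀` and `ψ₁`; the bound is thus a closed condition.
  let f : (Fin 2 → Modes m → Modes m) → ℝ := fun T =>
    (⟪ψ₀, T 1 ψ₀⟫_ℂ).re + (⟪ψ₁, T 0 ψ₁⟫_ℂ).re
  have hf : Continuous f := by
    have hc : ∀ (ω : Fin 2) (ψ : Modes m),
        Continuous fun T : Fin 2 → Modes m → Modes m => (⟪ψ, T ω ψ⟫_ℂ).re := fun ω ψ =>
      Complex.continuous_re.comp (continuous_const.inner
        ((continuous_apply ψ).comp (continuous_apply ω)))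
    exact (hc 1 ψ₀).add (hc 0 ψ₁)
  have hcl : IsClosed {T | ∫ z, v z ≤ f T} := isClosed_le continuous_const hf
  have hsub := closure_minimal (s := {T : Fin 2 → Modes m → Modes m |
      ∃ (R : ℕ) (M' : Fin 2 → Modes m →L[ℂ] Modes m),
        GOCCProtocol R m M' ∧ T = fun ω ψ => M' ω ψ}) (by
    rintro _ ⟨R, M', hM', rfl⟩
    exact hM'.integral_le h₀ h₁ hv hv₀ hv₁) hcl
  have h := hsub hM
  rw [errorProb_pureState]
  change _ ≤ (⟪ψ₀, (1 - M) ψ₀⟫_ℂ).re + (⟪ψ₁, M ψ₁⟫_ℂ).re at h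
  linarith

end GOCC

end

section

variable {m k n : ℕ}

/-! ### Homodyne tests as GOCC measurements -/

section Homodyne

lemma homodyneTest_coeFn {A : Set (Fin m → ℝ)} (hA : MeasurableSet A) (f : Modes m) :
    homodyneTest A hA f =ᵐ[volume] A.indicator f := by
  classical
  refine (mulOp_coeFn (fun y => if y ∈ A then 1 else 0)
    (Measurable.ite hA measurable_const measurable_const)
    (fun y => by split_ifs <;> simp) f).trans (Eventually.of_forall fun y => ?_)
  simp only [Set.indicator_apply, ite_mul, one_mul, zero_mul]

lemma inner_homodyneTest {A : Set (Fin m → ℝ)} (hA : MeasurableSet A) (f g : Modes m) :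
    ⟪f, homodyneTest A hA g⟫_ℂ = ∫ y, A.indicator (fun y => (starRingEnd ℂ) (f y) * g y) y := by
  rw [inner_eq_integral_of_ae (ae_eq_refl _) (homodyneTest_coeFn hA g)]
  refine integral_congr_ae (Eventually.of_forall fun y => ?_)
  by_cases hy : y ∈ A <;> simp [hy]

lemma one_sub_homodyneTest {A : Set (Fin m → ℝ)} (hA : MeasurableSet A) :
    1 - homodyneTest A hA = homodyneTest Aᶜ hA.compl := by
  ext1 f
  apply Lp.ext
  filter_upwards [homodyneTest_coeFn hA f, homodyneTest_coeFn hA.compl f,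
    Lp.coeFn_sub f (homodyneTest A hA f)] with y h₁ h₂ h₃
  rw [h₂]
  change (f - homodyneTest A hA f : Modes m) y = _
  rw [h₃, Pi.sub_apply, h₁]
  by_cases hy : y ∈ A <;> simp [hy]

lemma homodyneTest_univ : homodyneTest Set.univ MeasurableSet.univ = (1 : Modes m →L[ℂ] Modes m) := by
  ext1 f
  apply Lp.ext
  filter_upwards [homodyneTest_coeFn MeasurableSet.univ f] with y h
  rw [h]
  simp

lemma homodyneTest_nonneg {A : Set (Fin m → ℝ)} (hA : MeasurableSet A) :
    0 ≤ homodyneTest A hA := by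
  rw [ContinuousLinearMap.nonneg_iff_isPositive, ContinuousLinearMap.isPositive_iff_complex]
  intro f
  have h : ⟪homodyneTest A hA f, f⟫_ℂ = ((∫ y, A.indicator (fun y => ‖f y‖ ^ 2) y : ℝ) : ℂ) := by
    rw [inner_eq_integral_of_ae (homodyneTest_coeFn hA f) (ae_eq_refl _),
      ← integral_complex_ofReal]
    refine integral_congr_ae (Eventually.of_forall fun y => ?_)
    by_cases hy : y ∈ A
    · simp [hy, Complex.conj_mul']
    · simp [hy]
  rw [h]
  refine ⟨by simp, ?_⟩
  simp only [RCLike.re_to_complex, Complex.ofReal_re]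
  exact integral_nonneg fun y => Set.indicator_nonneg (fun _ _ => by positivity) y

lemma tensor_vacuum_zero (ψ : Modes n) : tensor (Nat.add_zero n) ψ (vacuum 0) = ψ := by
  apply Lp.ext
  filter_upwards [tensor_coeFn_of_ae (Nat.add_zero n) (ae_eq_refl ψ) (vacuum_coeFn 0)] with y hy
  rw [hy, vacuumFun, Finset.univ_eq_empty, Finset.prod_empty, mul_one]
  rfl

/-- When all modes are measured, the remaining space is `L²` of a one-point space with Dirac
measure, so the slice is the scalar `ψ x`. -/
lemma inner_slice_self_of_all (ψ : Modes n) :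
    (fun x : Fin n → ℝ => ⟪slice (Nat.zero_add n) ψ x, slice (Nat.zero_add n) ψ x⟫_ℂ) =ᵐ[volume]
      fun x => (starRingEnd ℂ) (ψ x) * ψ x := by
  filter_upwards [inner_slice_ae (Nat.zero_add n) ψ ψ] with x hx
  have h : joinModes (Nat.zero_add n) (default : Fin 0 → ℝ) x = x := by
    have h1 := joinModes_head_tail (Nat.zero_add n) x
    have h2 : tailModes (m := 0) (Nat.zero_add n) x = x := by
      ext i
      simp only [tailModes]
      congr 1
      ext
      simp
    rw [h2, Subsingleton.elim (headModes (Nat.zero_add n) x) default] at h1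
    exact h1
  rw [hx, Measure.volume_pi_eq_dirac default, integral_dirac, h]

lemma isGaussianUnitary_refl : IsGaussianUnitary (LinearIsometryEquiv.refl ℂ (Modes n)) :=
  ⟨LinearMap.id, 0, fun α ψ => by simp⟩

open Classical in
/-- Homodyning all modes and deciding by the outcome is a GOCC protocol with a single round. -/
lemma goccProtocol_homodyneTest {A : Set (Fin n → ℝ)} (hA : MeasurableSet A) :
    GOCCProtocol 1 n ![homodyneTest A hA, 1 - homodyneTest A hA] := by
  -- One round without ancillas and with the identity unitary, in which all modes are measured;
  -- outcome `0` is announced exactly on `A`.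
  refine GOCCProtocol.round (Nat.add_zero n) (Nat.zero_add n) (LinearIsometryEquiv.refl ℂ _)
    isGaussianUnitary_refl (fun x ω => if ω = (if x ∈ A then 0 else 1) then 1 else 0)
    (fun x => GOCCProtocol.announce _) (fun ω φ => ?_) _ fun ω ψ => ?_
  · have h : (fun x => ⟪φ, (if ω = (if x ∈ A then (0 : Fin 2) else 1) then
        (1 : Modes 0 →L[ℂ] Modes 0) else 0) φ⟫_ℂ) =
        fun x => if x ∈ A then ⟪φ, (if ω = 0 then (1 : Modes 0 →L[ℂ] Modes 0) else 0) φ⟫_ℂ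
          else ⟪φ, (if ω = 1 then (1 : Modes 0 →L[ℂ] Modes 0) else 0) φ⟫_ℂ := by
      ext x
      by_cases hx : x ∈ A <;> simp [hx]
    rw [h]
    exact Measurable.ite hA measurable_const measurable_const
  · rw [tensor_vacuum_zero, one_sub_homodyneTest]
    simp only [LinearIsometryEquiv.coe_refl, id_eq]
    fin_cases ω
    · refine (inner_homodyneTest hA ψ ψ).trans (integral_congr_ae ?_)
      filter_upwards [inner_slice_self_of_all ψ] with x hx
      by_cases hxA : x ∈ A
      · simp [hxA, ← hx, -inner_self_eq_norm_sq_to_K]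
      · simp [hxA]
    · refine (inner_homodyneTest hA.compl ψ ψ).trans (integral_congr_ae ?_)
      filter_upwards [inner_slice_self_of_all ψ] with x hx
      by_cases hxA : x ∈ A
      · simp [hxA]
      · simp [hxA, ← hx, -inner_self_eq_norm_sq_to_K]

lemma homodyneTest_mem_GOCC {A : Set (Fin n → ℝ)} (hA : MeasurableSet A) :
    homodyneTest A hA ∈ GOCC n :=
  subset_closure ⟨1, _, goccProtocol_homodyneTest hA, rfl⟩

end Homodyne

/-! ### Adjoint displacements and displaced parity -/

section Adjoint

lemma weylPhase_neg_conj (x p y : Fin m → ℝ) :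
    (starRingEnd ℂ) (weylPhase (-x) (-p) y) = weylPhase x p (y + x) := by
  rw [weylPhase_eq_prod, weylPhase_eq_prod, map_prod]
  refine Finset.prod_congr rfl fun j _ => ?_
  rw [← Complex.exp_conj, map_mul, Complex.conj_ofReal, Complex.conj_I]
  congr 1
  simp only [Pi.neg_apply, Pi.add_apply]
  push_cast
  ring

lemma star_displacement (ξ : Fin m → ℂ) : star (displacement ξ) = displacement (-ξ) := by
  symm
  refine (ContinuousLinearMap.eq_adjoint_iff _ _).2 fun f g => ?_
  set x : Fin m → ℝ := fun j => √2 * (ξ j).re with hx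
  set p : Fin m → ℝ := fun j => √2 * (ξ j).im with hp
  have h1 : (fun j => √2 * ((-ξ) j).re) = -x := by ext j; simp [hx]
  have h2 : (fun j => √2 * ((-ξ) j).im) = -p := by ext j; simp [hp]
  rw [inner_eq_integral_of_ae (displacement_coeFn (-ξ) f) (ae_eq_refl _),
    inner_eq_integral_of_ae (ae_eq_refl _) (displacement_coeFn ξ g), h1, h2,
    ← integral_add_right_eq_self (fun y => (starRingEnd ℂ) (f y) * _) x]
  refine integral_congr_ae (Eventually.of_forall fun y => ?_)
  change _ = (starRingEnd ℂ) (f (y + x)) * (weylPhase x p (y + x) * g (y + x - x))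
  simp only [map_mul, weylPhase_neg_conj, sub_neg_eq_add, add_sub_cancel_right]
  ring

lemma weylPhase_parity (x p y : Fin m → ℝ) :
    weylPhase x p y * weylPhase (-x) (-p) (-(y - x)) =
      ∏ j, Complex.exp ((2 * p j * (y j - x j) : ℝ) * Complex.I) := by
  rw [weylPhase_eq_prod, weylPhase_eq_prod, ← Finset.prod_mul_distrib]
  refine Finset.prod_congr rfl fun j _ => ?_
  rw [← Complex.exp_add]
  congr 1
  simp only [Pi.neg_apply, Pi.sub_apply]
  push_cast
  ring

/-- Wave functions under the displaced parity operator. -/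
lemma displaced_parity_coeFn (ξ : Fin m → ℂ) {f : Modes m} {F : (Fin m → ℝ) → ℂ}
    (hF : f =ᵐ[volume] F) :
    (displacement ξ * parity m * star (displacement ξ)) f =ᵐ[volume] fun y =>
      (∏ j, Complex.exp ((2 * (√2 * (ξ j).im) * (y j - √2 * (ξ j).re) : ℝ) * Complex.I)) *
        F (fun j => 2 * (√2 * (ξ j).re) - y j) := by
  have h1 := displacement_coeFn_of_ae (-ξ) hF
  have h2 : parity m (displacement (-ξ) f) =ᵐ[volume] _ :=
    (parity_coeFn (displacement (-ξ) f)).trans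
      ((Measure.measurePreserving_neg (volume : Measure (Fin m → ℝ))).quasiMeasurePreserving.ae_eq_comp h1)
  have h3 := displacement_coeFn_of_ae ξ h2
  rw [star_displacement]
  refine h3.trans (Eventually.of_forall fun y => ?_)
  set x : Fin m → ℝ := fun j => √2 * (ξ j).re with hx
  set p : Fin m → ℝ := fun j => √2 * (ξ j).im with hp
  have e1 : (fun j => √2 * ((-ξ) j).re) = -x := by ext j; simp [hx]
  have e2 : (fun j => √2 * ((-ξ) j).im) = -p := by ext j; simp [hp]
  simp only [Function.comp_apply]
  rw [e1, e2, ← mul_assoc, weylPhase_parity]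
  congr 2
  ext j
  simp only [Pi.sub_apply, Pi.neg_apply, hx]
  ring

end Adjoint

/-! ### Wigner functions of `|β⟩⟨γ|` for coherent vectors -/

section CoherentWigner

lemma wigner_ketBra (φ ψ : Modes m) (z : Phase m) :
    wigner (ketBra φ ψ) z = ((Real.pi ^ m)⁻¹ : ℝ) *
      ⟪ψ, (displacement (phasePoint z) * parity m * star (displacement (phasePoint z))) φ⟫_ℂ := by
  rw [wigner, mul_assoc, mul_assoc, tr_ketBra_mul, mul_assoc]

lemma sqrt_two_mul_phasePoint (z : Phase m) (j : Fin m) :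
    √2 * (phasePoint z j).re = z.1 j ∧ √2 * (phasePoint z j).im = z.2 j := by
  have h : phasePoint z j = ((z.1 j / √2 : ℝ) : ℂ) + ((z.2 j / √2 : ℝ) : ℂ) * Complex.I := by
    rw [phasePoint]
    push_cast
    ring
  have h2 : √2 ≠ (0 : ℝ) := by positivity
  rw [h]
  constructor
  · simp
    field_simp
  · simp
    field_simp

/-- The position-dependent part of the Wigner function of `|a + ib⟩⟨c + id|` (up to `√2`). -/
def crossPosition (a b c d x : ℝ) : ℂ :=
  Complex.exp (-(x : ℂ) ^ 2 + ((c + a : ℝ) + (b - d : ℝ) * Complex.I) * x +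
    ((((c - a) / 2 : ℝ) - ((b + d) / 2 : ℝ) * Complex.I) ^ 2 - ((a ^ 2 + c ^ 2) / 2 : ℝ) +
      ((c * d - a * b) / 2 : ℝ) * Complex.I))

/-- The momentum-dependent part of the Wigner function of `|a + ib⟩⟨c + id|` (up to `√2`). -/
def crossMomentum (a b c d p : ℝ) : ℂ :=
  Complex.exp (-(p : ℂ) ^ 2 + ((b + d : ℝ) + (c - a : ℝ) * Complex.I) * p + 0)

/-- Completing the square in `y` separates the result into a function of `x` times a function of
`p`. This separation is what later allows momenta to be integrated out on their own. -/
lemma integral_coherentWave_parity (a b c d x p : ℝ) :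
    ∫ y : ℝ, (starRingEnd ℂ) (coherentWave c d y) *
      (Complex.exp ((2 * p * (y - x) : ℝ) * Complex.I) * coherentWave a b (2 * x - y)) =
    crossPosition a b c d x * crossMomentum a b c d p := by
  have h : ∀ y : ℝ, (starRingEnd ℂ) (coherentWave c d y) *
      (Complex.exp ((2 * p * (y - x) : ℝ) * Complex.I) * coherentWave a b (2 * x - y)) =
      (((√Real.pi)⁻¹ : ℝ) : ℂ) * Complex.exp (-(y : ℂ) ^ 2 +
        (c + 2 * x - a + (2 * p - d - b) * Complex.I) * y +
        (-(c : ℂ) ^ 2 / 2 - (2 * x - a) ^ 2 / 2 +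
          (c * d / 2 - 2 * p * x + 2 * b * x - a * b / 2) * Complex.I)) := fun y => by
    simp only [coherentWave, map_mul, Complex.conj_ofReal, ← Complex.exp_conj, map_add, map_sub,
      map_div₀, map_neg, map_pow, Complex.conj_I, map_ofNat]
    have e : ∀ q A B C : ℂ, q * A * (B * (q * C)) = q * q * (A * B * C) := by intros; ring
    rw [← pi_rpow_mul_self, e, ← Complex.exp_add, ← Complex.exp_add]
    congr 2
    push_cast
    ring
  simp only [h]
  rw [integral_const_mul, integral_gaussian_linear, ← mul_assoc, ← Complex.ofReal_mul,
    inv_mul_cancel₀ (Real.sqrt_pos.2 Real.pi_pos).ne', Complex.ofReal_one, one_mul,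
    crossPosition, crossMomentum, ← Complex.exp_add]
  congr 1
  have := Complex.I_sq
  push_cast
  linear_combination (p ^ 2 - b * p - d * p : ℂ) * this

lemma wigner_coherent (β γ : Fin m → ℂ) (z : Phase m) :
    wigner (ketBra (coherent β) (coherent γ)) z =
      (∏ j, (((Real.pi)⁻¹ : ℝ) : ℂ) * crossPosition (√2 * (β j).re) (√2 * (β j).im) (√2 * (γ j).re)
        (√2 * (γ j).im) (z.1 j)) *
      ∏ j, crossMomentum (√2 * (β j).re) (√2 * (β j).im) (√2 * (γ j).re) (√2 * (γ j).im)
        (z.2 j) := by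
  rw [wigner_ketBra, inner_eq_integral_of_ae (coherent_coeFn γ)
    (displaced_parity_coeFn _ (coherent_coeFn β))]
  simp only [(sqrt_two_mul_phasePoint z _).1, (sqrt_two_mul_phasePoint z _).2, coherentFun,
    map_prod, ← Finset.prod_mul_distrib]
  have h := integral_fintype_prod_volume_eq_prod (𝕜 := ℂ) (fun (j : Fin m) (t : ℝ) =>
    (starRingEnd ℂ) (coherentWave (√2 * (γ j).re) (√2 * (γ j).im) t) *
      (Complex.exp ((2 * z.2 j * (t - z.1 j) : ℝ) * Complex.I) *
        coherentWave (√2 * (β j).re) (√2 * (β j).im) (2 * z.1 j - t)))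
  rw [h]
  simp only [integral_coherentWave_parity]
  simp only [mul_assoc]
  rw [Finset.prod_mul_distrib (f := fun _ => (((Real.pi)⁻¹ : ℝ) : ℂ)), Finset.prod_const]
  congr 1
  simp

end CoherentWigner

end

section

variable {m k n : ℕ}

/-! ### Wigner functions of measurements and the lower bound for W+ -/

section WignerFunctions

lemma integrable_crossPosition (a b c d : ℝ) : Integrable (crossPosition a b c d) :=
  integrable_gaussian_linear _ _

lemma integrable_crossMomentum (a b c d : ℝ) : Integrable (crossMomentum a b c d) :=
  integrable_gaussian_linear _ _

/-- The position marginal of a Wigner function is the position kernel on the diagonal; for this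
reason functions of position alone are Wigner functions of multiplication operators. -/
lemma crossPosition_mul_integral (a b c d x : ℝ) :
    (((Real.pi)⁻¹ : ℝ) : ℂ) * crossPosition a b c d x * ∫ p, crossMomentum a b c d p =
      (starRingEnd ℂ) (coherentWave c d x) * coherentWave a b x := by
  have h1 : ∫ p, crossMomentum a b c d p = _ := integral_gaussian_linear _ _
  have e : ∀ q A B : ℂ, q * A * (q * B) = q * q * (A * B) := by intros; ring
  have e' : ∀ q A r B : ℂ, q * A * (r * B) = q * r * (A * B) := by intros; ring
  have h2 : (((Real.pi)⁻¹ : ℝ) : ℂ) * ((√Real.pi : ℝ) : ℂ) = (((√Real.pi)⁻¹ : ℝ) : ℂ) := by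
    rw [← Complex.ofReal_mul]
    congr 1
    have h3 := Real.mul_self_sqrt Real.pi_pos.le
    have h4 := (Real.sqrt_pos.2 Real.pi_pos).ne'
    have h5 := Real.pi_pos.ne'
    field_simp
    rw [sq, h3]
  simp only [h1, coherentWave, map_mul, Complex.conj_ofReal, ← Complex.exp_conj, map_add, map_sub,
    map_div₀, map_neg, map_pow, Complex.conj_I, map_ofNat]
  rw [e, e', pi_rpow_mul_self, h2, crossPosition, ← Complex.exp_add, ← Complex.exp_add]
  congr 2
  have := Complex.I_sq
  push_cast
  linear_combination ((b + d) ^ 2 / 4 + (c - a) ^ 2 / 4 : ℂ) * this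

lemma integrable_prod_crossPosition (a b c d : Fin m → ℝ) :
    Integrable fun x : Fin m → ℝ =>
      ∏ j, (((Real.pi)⁻¹ : ℝ) : ℂ) * crossPosition (a j) (b j) (c j) (d j) (x j) :=
  Integrable.fintype_prod_dep fun j => (integrable_crossPosition (a j) (b j) (c j) (d j)).const_mul _

lemma integrable_prod_crossMomentum (a b c d : Fin m → ℝ) :
    Integrable fun p : Fin m → ℝ => ∏ j, crossMomentum (a j) (b j) (c j) (d j) (p j) :=
  Integrable.fintype_prod_dep fun j => integrable_crossMomentum (a j) (b j) (c j) (d j)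

lemma prod_crossPosition_mul_integral (a b c d x : Fin m → ℝ) :
    (∏ j, (((Real.pi)⁻¹ : ℝ) : ℂ) * crossPosition (a j) (b j) (c j) (d j) (x j)) *
      ∫ p : Fin m → ℝ, ∏ j, crossMomentum (a j) (b j) (c j) (d j) (p j) =
      (starRingEnd ℂ) (∏ j, coherentWave (c j) (d j) (x j)) *
        ∏ j, coherentWave (a j) (b j) (x j) := by
  rw [integral_fintype_prod_volume_eq_prod (fun j => crossMomentum (a j) (b j) (c j) (d j)),
    map_prod, ← Finset.prod_mul_distrib, ← Finset.prod_mul_distrib]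
  exact Finset.prod_congr rfl fun j _ => crossPosition_mul_integral _ _ _ _ _

/-- The Wigner function of a homodyne test. -/
def homodyneWigner (A : Set (Fin m → ℝ)) (z : Phase m) : ℝ :=
  A.indicator (fun _ => ((2 * Real.pi) ^ m)⁻¹) z.1

lemma homodyneWigner_nonneg (A : Set (Fin m → ℝ)) (z : Phase m) : 0 ≤ homodyneWigner A z :=
  Set.indicator_nonneg (fun _ _ => by positivity) _

/-- The candidate does not depend on momentum, so integrating momenta out leaves the position
marginal restricted to `A`; its constant value on `A` cancels the `(2π)^m` of the duality. -/
lemma isWignerFunction_homodyneTest {A : Set (Fin m → ℝ)} (hA : MeasurableSet A) :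
    IsWignerFunction (homodyneTest A hA) (homodyneWigner A) := by
  have hmeas : Measurable (homodyneWigner A) :=
    (measurable_const.indicator hA).comp measurable_fst
  refine ⟨hmeas, fun β γ => ?_⟩
  let f : (Fin m → ℝ) → ℂ := fun x => ∏ j, (((Real.pi)⁻¹ : ℝ) : ℂ) *
    crossPosition (√2 * (β j).re) (√2 * (β j).im) (√2 * (γ j).re) (√2 * (γ j).im) (x j)
  let g : (Fin m → ℝ) → ℂ := fun p => ∏ j,
    crossMomentum (√2 * (β j).re) (√2 * (β j).im) (√2 * (γ j).re) (√2 * (γ j).im) (p j)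
  have hf : Integrable f := integrable_prod_crossPosition _ _ _ _
  have hg : Integrable g := integrable_prod_crossMomentum _ _ _ _
  have hw : ∀ z : Phase m, (homodyneWigner A z : ℂ) * wigner (ketBra (coherent β) (coherent γ)) z =
      A.indicator (fun x => ((((2 * Real.pi) ^ m)⁻¹ : ℝ) : ℂ) * f x) z.1 * g z.2 := fun z => by
    rw [wigner_coherent, homodyneWigner]
    by_cases hz : z.1 ∈ A
    · simp only [hz, Set.indicator_of_mem, f, g]
      ring
    · simp [hz]
  simp only [hw]
  refine ⟨((hf.const_mul _).indicator hA).mul_prod hg, ?_⟩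
  have h1 := integral_prod_mul (μ := (volume : Measure (Fin m → ℝ)))
    (ν := (volume : Measure (Fin m → ℝ)))
    (A.indicator (fun x => ((((2 * Real.pi) ^ m)⁻¹ : ℝ) : ℂ) * f x)) g
  have h2 : coherent γ =ᵐ[volume] coherentFun γ := coherent_coeFn γ
  have h3 : homodyneTest A hA (coherent β) =ᵐ[volume] A.indicator (coherentFun β) :=
    (homodyneTest_coeFn hA _).trans (by
      filter_upwards [coherent_coeFn β] with y hy
      by_cases hyA : y ∈ A <;> simp [hyA, hy])
  rw [tr_mul_ketBra, inner_eq_integral_of_ae h2 h3]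
  rw [Measure.volume_eq_prod, h1, ← integral_mul_const, ← integral_const_mul]
  refine integral_congr_ae (Eventually.of_forall fun x => ?_)
  by_cases hx : x ∈ A
  · have h4 := prod_crossPosition_mul_integral (fun j => √2 * (β j).re) (fun j => √2 * (β j).im)
      (fun j => √2 * (γ j).re) (fun j => √2 * (γ j).im) x
    simp only [hx, Set.indicator_of_mem, coherentFun]
    rw [← h4]
    have h5 : (2 * (Real.pi : ℂ)) ^ m * ((((2 * Real.pi) ^ m)⁻¹ : ℝ) : ℂ) = 1 := by
      push_cast
      rw [mul_inv_cancel₀]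
      have : (Real.pi : ℂ) ≠ 0 := by exact_mod_cast Real.pi_pos.ne'
      exact pow_ne_zero _ (mul_ne_zero two_ne_zero this)
    rw [mul_assoc _ (f x), ← mul_assoc, h5, one_mul]
  · simp [hx]

lemma homodyneTest_mem_WPlus {A : Set (Fin m → ℝ)} (hA : MeasurableSet A) :
    homodyneTest A hA ∈ WPlus m := by
  refine ⟨homodyneTest_nonneg hA, ?_, homodyneWigner A, homodyneWigner Aᶜ,
    isWignerFunction_homodyneTest hA, ?_, homodyneWigner_nonneg A, homodyneWigner_nonneg Aᶜ⟩
  · rw [← sub_nonneg, one_sub_homodyneTest]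
    exact homodyneTest_nonneg hA.compl
  · rw [one_sub_homodyneTest]
    exact isWignerFunction_homodyneTest hA.compl

lemma tr_add_mul_ketBra {E : Type*} [NormedAddCommGroup E] [InnerProductSpace ℂ E] [CompleteSpace E]
    (M N : E →L[ℂ] E) (φ ψ : E) :
    tr ((M + N) * ketBra φ ψ) = tr (M * ketBra φ ψ) + tr (N * ketBra φ ψ) := by
  rw [tr_mul_ketBra, tr_mul_ketBra, tr_mul_ketBra, ← inner_add_right]
  rfl

lemma IsWignerFunction.add {M N : Modes m →L[ℂ] Modes m} {W V : Phase m → ℝ}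
    (hW : IsWignerFunction M W) (hV : IsWignerFunction N V) :
    IsWignerFunction (M + N) fun z => W z + V z := by
  refine ⟨hW.1.add hV.1, fun β γ => ?_⟩
  have h : ∀ z, ((W z + V z : ℝ) : ℂ) * wigner (ketBra (coherent β) (coherent γ)) z =
      (W z : ℂ) * wigner (ketBra (coherent β) (coherent γ)) z +
        (V z : ℂ) * wigner (ketBra (coherent β) (coherent γ)) z := fun z => by
    push_cast; ring
  simp only [h]
  refine ⟨(hW.2 β γ).1.add (hV.2 β γ).1, ?_⟩
  rw [integral_add (hW.2 β γ).1 (hV.2 β γ).1, tr_add_mul_ketBra, (hW.2 β γ).2, (hV.2 β γ).2,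
    mul_add]

/-- The Wigner function of the vacuum, up to normalisation. -/
def vacuumGaussian (z : Phase m) : ℂ :=
  (∏ j, Complex.exp (-(z.1 j : ℂ) ^ 2)) * ∏ j, Complex.exp (-(z.2 j : ℂ) ^ 2)

/-- The Wigner functions of the operators `|β⟩⟨γ|` include all Fourier characters times a fixed
Gaussian. -/
lemma exists_wigner_eq_character (t r : Fin m → ℝ) : ∃ (β γ : Fin m → ℂ) (C : ℂ), C ≠ 0 ∧
    ∀ z, wigner (ketBra (coherent β) (coherent γ)) z =
      C * (Complex.exp ((∑ j, (t j * z.1 j + r j * z.2 j) : ℝ) * Complex.I) *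
        vacuumGaussian z) := by
  have h2 : √2 ≠ (0 : ℝ) := by positivity
  -- With `γ = -β` the real linear terms of `crossPosition` and `crossMomentum` cancel, as do the
  -- constant ones. The frequencies left over are differences of the two amplitudes, namely `t` in
  -- position and `r` in momentum.
  let β : Fin m → ℂ := fun j => ⟨-r j / 2 / √2, t j / 2 / √2⟩
  let γ : Fin m → ℂ := fun j => ⟨r j / 2 / √2, -t j / 2 / √2⟩
  have e1 : ∀ j, √2 * (β j).re = -r j / 2 := fun j => by simp only [β]; field_simp
  have e2 : ∀ j, √2 * (β j).im = t j / 2 := fun j => by simp only [β]; field_simp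
  have e3 : ∀ j, √2 * (γ j).re = r j / 2 := fun j => by simp only [γ]; field_simp
  have e4 : ∀ j, √2 * (γ j).im = -t j / 2 := fun j => by simp only [γ]; field_simp
  refine ⟨β, γ, ∏ _j : Fin m, (((Real.pi)⁻¹ : ℝ) : ℂ), ?_, fun z => ?_⟩
  · rw [Finset.prod_ne_zero_iff]
    intro j _
    exact_mod_cast inv_ne_zero Real.pi_pos.ne'
  have h3 : ∀ j, crossPosition (-r j / 2) (t j / 2) (r j / 2) (-t j / 2) (z.1 j) =
      Complex.exp ((t j * z.1 j : ℝ) * Complex.I) * Complex.exp (-(z.1 j : ℂ) ^ 2) := fun j => by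
    rw [crossPosition, ← Complex.exp_add]
    congr 1
    push_cast
    ring
  have h4 : ∀ j, crossMomentum (-r j / 2) (t j / 2) (r j / 2) (-t j / 2) (z.2 j) =
      Complex.exp ((r j * z.2 j : ℝ) * Complex.I) * Complex.exp (-(z.2 j : ℂ) ^ 2) := fun j => by
    rw [crossMomentum, ← Complex.exp_add]
    congr 1
    push_cast
    ring
  have h5 : Complex.exp ((∑ j, (t j * z.1 j + r j * z.2 j) : ℝ) * Complex.I) =
      (∏ j, Complex.exp ((t j * z.1 j : ℝ) * Complex.I)) *
        ∏ j, Complex.exp ((r j * z.2 j : ℝ) * Complex.I) := by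
    rw [← Finset.prod_mul_distrib, Complex.ofReal_sum, Finset.sum_mul, Complex.exp_sum]
    refine Finset.prod_congr rfl fun j _ => ?_
    rw [← Complex.exp_add]
    congr 1
    push_cast
    ring
  rw [wigner_coherent]
  simp only [e1, e2, e3, e4, h3, h4, Finset.prod_mul_distrib]
  rw [h5, vacuumGaussian]
  ring

lemma vacuumGaussian_ne_zero (z : Phase m) : vacuumGaussian z ≠ 0 := by
  refine mul_ne_zero ?_ ?_ <;>
  · rw [Finset.prod_ne_zero_iff]
    intro j _
    exact Complex.exp_ne_zero _

lemma dual_phase_eq_sum (L : StrongDual ℝ (Phase m)) : ∃ t r : Fin m → ℝ, ∀ z : Phase m,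
    L z = ∑ j, (t j * z.1 j + r j * z.2 j) := by
  refine ⟨fun j => L (Pi.single j 1, 0), fun j => L (0, Pi.single j 1), fun z => ?_⟩
  have h1 := dual_eq_sum (L.comp (ContinuousLinearMap.inl ℝ (Fin m → ℝ) (Fin m → ℝ))) z.1
  have h2 := dual_eq_sum (L.comp (ContinuousLinearMap.inr ℝ (Fin m → ℝ) (Fin m → ℝ))) z.2
  simp only [ContinuousLinearMap.comp_apply, ContinuousLinearMap.inl_apply,
    ContinuousLinearMap.inr_apply] at h1 h2
  rw [Finset.sum_add_distrib, ← h1, ← h2, ← map_add]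
  simp

/-- The Wigner function of an operator is determined up to null sets. -/
lemma IsWignerFunction.ae_eq {M : Modes m →L[ℂ] Modes m} {W V : Phase m → ℝ}
    (hW : IsWignerFunction M W) (hV : IsWignerFunction M V) : W =ᵐ[volume] V := by
  have hint : ∀ {W : Phase m → ℝ}, IsWignerFunction M W →
      Integrable fun z => (W z : ℂ) * vacuumGaussian z := fun {W} hW => by
    obtain ⟨β, γ, C, hC, h⟩ := exists_wigner_eq_character (m := m) 0 0
    refine ((hW.2 β γ).1.const_mul C⁻¹).congr (Eventually.of_forall fun z => ?_)
    simp only [h z]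
    simp only [Pi.zero_apply, zero_mul, add_zero, Finset.sum_const_zero, Complex.ofReal_zero,
      Complex.exp_zero, one_mul]
    field_simp
  have h0 : (2 * Real.pi : ℂ) ^ m ≠ 0 := by
    have : (Real.pi : ℂ) ≠ 0 := by exact_mod_cast Real.pi_pos.ne'
    exact pow_ne_zero _ (mul_ne_zero two_ne_zero this)
  -- `W` itself need not be integrable, but its product with the vacuum Gaussian is. The duality
  -- condition prescribes all Fourier coefficients of that product, and the Gaussian vanishes
  -- nowhere.
  have key := ae_eq_of_fourier (hint hW) (hint hV) fun L => by
    obtain ⟨t, r, hL⟩ := dual_phase_eq_sum L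
    obtain ⟨β, γ, C, hC, h⟩ := exists_wigner_eq_character t r
    have h1 := mul_left_cancel₀ h0 (((hW.2 β γ).2).symm.trans (hV.2 β γ).2)
    have h2 : ∀ {W : Phase m → ℝ}, IsWignerFunction M W →
        ∫ z, Complex.exp ((L z : ℂ) * Complex.I) * ((W z : ℂ) * vacuumGaussian z) =
        C⁻¹ * ∫ z, (W z : ℂ) * wigner (ketBra (coherent β) (coherent γ)) z := fun {W} hW => by
      rw [← integral_const_mul]
      refine integral_congr_ae (Eventually.of_forall fun z => ?_)
      simp only [h z, hL]
      field_simp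
    rw [h2 hW, h2 hV, h1]
  filter_upwards [key] with z hz
  exact_mod_cast mul_right_cancel₀ (vacuumGaussian_ne_zero z) hz

/-- Links the trace definition of the Wigner function to the density defined through characteristic
functions. -/
lemma wigner_coherent_self (β : Fin m → ℂ) (z : Phase m) :
    wigner (ketBra (coherent β) (coherent β)) z = (coherentDensity β z : ℂ) := by
  rw [wigner_coherent, ← Finset.prod_mul_distrib, coherentDensity, ← Finset.prod_mul_distrib,
    Complex.ofReal_prod]
  refine Finset.prod_congr rfl fun j _ => ?_
  have h2 : (√Real.pi)⁻¹ * (√Real.pi)⁻¹ = Real.pi⁻¹ := by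
    rw [← mul_inv, Real.mul_self_sqrt Real.pi_pos.le]
  rw [mul_mul_mul_comm, h2, mul_assoc, Complex.ofReal_mul, crossPosition, crossMomentum,
    ← Complex.exp_add, ← Real.exp_add, Complex.ofReal_exp]
  congr 2
  have := Complex.I_sq
  push_cast
  linear_combination (2 * (β j).im ^ 2 * 0 + ((√2 : ℝ) * (β j).im : ℂ) ^ 2) * this

/-- The expectation value of an operator in a coherent state is the overlap of the Wigner
functions. -/
lemma IsWignerFunction.re_inner_coherent {N : Modes m →L[ℂ] Modes m} {V : Phase m → ℝ}
    (hN : IsWignerFunction N V) (δ : Fin m → ℂ) :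
    Integrable (fun z => V z * coherentDensity δ z) ∧
      (⟪coherent δ, N (coherent δ)⟫_ℂ).re =
        (2 * Real.pi) ^ m * ∫ z, V z * coherentDensity δ z := by
  obtain ⟨h1, h2⟩ := hN.2 δ δ
  simp only [wigner_coherent_self, ← Complex.ofReal_mul] at h1 h2
  refine ⟨by simpa using h1.re, ?_⟩
  rw [tr_mul_ketBra, integral_complex_ofReal] at h2
  rw [h2]
  norm_cast

/-- Measurements with non-negative Wigner functions cannot distinguish two coherent states better
than their Wigner functions can be distinguished classically. -/
lemma integral_le_of_mem_WPlus {M : Modes m →L[ℂ] Modes m} (hM : M ∈ WPlus m)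
    {β γ : Fin m → ℂ} {v : Phase m → ℝ} (hv : Integrable v)
    (hv₀ : v ≤ coherentDensity β) (hv₁ : v ≤ coherentDensity γ) :
    ∫ z, v z ≤ 2 * errorProb (pureState (coherent β)) (pureState (coherent γ)) M := by
  obtain ⟨-, -, W, W', hW, hW', hpos, hpos'⟩ := hM
  have hsum := hW.add hW'
  -- The identity is the homodyne test of the whole space, so `W + W'` equals its Wigner function,
  -- the constant `(2π)^{-m}`, almost everywhere.
  rw [add_sub_cancel, ← homodyneTest_univ] at hsum
  have hae := hsum.ae_eq (isWignerFunction_homodyneTest MeasurableSet.univ)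
  rw [errorProb_pureState, (hW'.re_inner_coherent β).2, (hW.re_inner_coherent γ).2]
  have e : ∀ a b : ℝ, 2 * (1 / 2 * ((2 * Real.pi) ^ m * a) + 1 / 2 * ((2 * Real.pi) ^ m * b)) =
      (2 * Real.pi) ^ m * (a + b) := fun a b => by ring
  rw [e, ← integral_add (hW'.re_inner_coherent β).1 (hW.re_inner_coherent γ).1, ← integral_const_mul]
  refine integral_mono_ae hv (((hW'.re_inner_coherent β).1.add (hW.re_inner_coherent γ).1).const_mul _) ?_
  filter_upwards [hae] with z hz
  simp only [homodyneWigner, Set.indicator_univ] at hz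
  have h1 : v z = (2 * Real.pi) ^ m * ((W z + W' z) * v z) := by
    rw [hz, ← mul_assoc, mul_inv_cancel₀ (by positivity), one_mul]
  rw [h1]
  -- Here non-negativity of both Wigner functions enters: `W' v ≤ W' w₀` and `W v ≤ W w₁`.
  have h3 := mul_le_mul_of_nonneg_left (hv₀ z) (hpos' z)
  have h4 := mul_le_mul_of_nonneg_left (hv₁ z) (hpos z)
  refine mul_le_mul_of_nonneg_left ?_ (by positivity)
  linarith

end WignerFunctions

end

section

variable {m k n : ℕ}

/-! ### Asymptotics of the error probabilities -/

section ErrorFunction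

lemma integrable_exp_neg_sq : Integrable fun t : ℝ => Real.exp (-t ^ 2) := by
  simpa using integrable_exp_neg_mul_sq (b := 1) one_pos

lemma integral_exp_neg_sq_Ioi : ∫ t in Set.Ioi (0 : ℝ), Real.exp (-t ^ 2) = √Real.pi / 2 := by
  simpa using integral_gaussian_Ioi 1

lemma one_sub_erf (c : ℝ) :
    1 - erf c = 2 / √Real.pi * ∫ t in Set.Ioi c, Real.exp (-t ^ 2) := by
  have h := intervalIntegral.integral_Ioi_sub_Ioi' (a := 0) (b := c) (μ := volume)
    integrable_exp_neg_sq.integrableOn integrable_exp_neg_sq.integrableOn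
  rw [integral_exp_neg_sq_Ioi] at h
  have hp := (Real.sqrt_pos.2 Real.pi_pos).ne'
  rw [erf, ← h]
  field_simp
  ring

/-- Shift the tail integral to start at `0` and drop the cross term `2ct ≥ 0` in `(t + c)²`. -/
lemma one_sub_erf_le {c : ℝ} (hc : 0 ≤ c) : 1 - erf c ≤ Real.exp (-c ^ 2) := by
  have h1 : ∫ t in Set.Ioi c, Real.exp (-t ^ 2) =
      ∫ t in Set.Ioi (0 : ℝ), Real.exp (-(t + c) ^ 2) := by
    have h := (measurePreserving_add_right volume c).setIntegral_preimage_emb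
      (measurableEmbedding_addRight c) (fun t => Real.exp (-t ^ 2)) (Set.Ioi c)
    rw [← h]
    simp
  have h2 : ∫ t in Set.Ioi (0 : ℝ), Real.exp (-(t + c) ^ 2) ≤
      ∫ t in Set.Ioi (0 : ℝ), Real.exp (-c ^ 2) * Real.exp (-t ^ 2) := by
    refine setIntegral_mono_on ?_ (integrable_exp_neg_sq.const_mul _).integrableOn
      measurableSet_Ioi fun t ht => ?_
    · exact (integrable_exp_neg_sq.comp_add_right c).integrableOn
    · rw [← Real.exp_add, Real.exp_le_exp]
      have : 0 < t := ht
      nlinarith [mul_nonneg this.le hc]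
  rw [integral_const_mul, integral_exp_neg_sq_Ioi] at h2
  rw [one_sub_erf, h1]
  have hp := Real.sqrt_pos.2 Real.pi_pos
  calc 2 / √Real.pi * ∫ t in Set.Ioi (0 : ℝ), Real.exp (-(t + c) ^ 2)
      ≤ 2 / √Real.pi * (Real.exp (-c ^ 2) * (√Real.pi / 2)) := by gcongr
    _ = Real.exp (-c ^ 2) := by field_simp

/-- Only the unit interval after `c` is kept, where the integrand is at least its right end value;
`2/√π ≥ 1` because `π < 4`. -/
lemma exp_le_one_sub_erf {c : ℝ} (hc : 0 ≤ c) : Real.exp (-(c + 1) ^ 2) ≤ 1 - erf c := by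
  have h1 : Real.exp (-(c + 1) ^ 2) ≤ ∫ t in Set.Ioc c (c + 1), Real.exp (-t ^ 2) := by
    have h : ∫ _t in Set.Ioc c (c + 1), Real.exp (-(c + 1) ^ 2) ≤
        ∫ t in Set.Ioc c (c + 1), Real.exp (-t ^ 2) := by
      refine setIntegral_mono_on (integrableOn_const (by simp))
        integrable_exp_neg_sq.integrableOn measurableSet_Ioc fun t ht => ?_
      rw [Real.exp_le_exp]
      have h1 := ht.1
      have h2 := ht.2
      nlinarith
    simpa using h
  have h2 : ∫ t in Set.Ioc c (c + 1), Real.exp (-t ^ 2) ≤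
      ∫ t in Set.Ioi c, Real.exp (-t ^ 2) :=
    setIntegral_mono_set integrable_exp_neg_sq.integrableOn
      (Eventually.of_forall fun t => (Real.exp_pos _).le)
      (Set.Ioc_subset_Ioi_self).eventuallyLE
  have hp := Real.sqrt_pos.2 Real.pi_pos
  have h3 : 1 ≤ 2 / √Real.pi := by
    rw [le_div_iff₀ hp, one_mul, Real.sqrt_le_left (by norm_num)]
    linarith [Real.pi_lt_four]
  rw [one_sub_erf]
  calc Real.exp (-(c + 1) ^ 2) ≤ ∫ t in Set.Ioi c, Real.exp (-t ^ 2) := h1.trans h2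
    _ ≤ _ := le_mul_of_one_le_left ((Real.exp_pos _).le.trans (h1.trans h2)) h3

/-- The two tail bounds at `c = a√n` squeeze the sequence between `a²` and `(a + 1/√n)²`. -/
lemma tendsto_log_one_sub_erf {a : ℝ} (ha : 0 ≤ a) :
    Tendsto (fun n : ℕ => -(1 / (n : ℝ)) * Real.log (1 - erf (a * √n))) atTop (𝓝 (a ^ 2)) := by
  have hup : Tendsto (fun n : ℕ => (a + 1 / √(n : ℝ)) ^ 2) atTop (𝓝 (a ^ 2)) := by
    have h1 : Tendsto (fun n : ℕ => 1 / √(n : ℝ)) atTop (𝓝 0) := by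
      simp only [one_div]
      exact tendsto_inv_atTop_zero.comp
        (Real.tendsto_sqrt_atTop.comp tendsto_natCast_atTop_atTop)
    simpa using (h1.const_add a).pow 2
  refine tendsto_of_tendsto_of_tendsto_of_le_of_le' tendsto_const_nhds hup ?_ ?_
  all_goals
    filter_upwards [eventually_gt_atTop 0] with n hn
    have hn' : (0 : ℝ) < n := by exact_mod_cast hn
    have hs : √(n : ℝ) ^ 2 = n := Real.sq_sqrt hn'.le
    have hs0 : 0 < √(n : ℝ) := Real.sqrt_pos.2 hn'
    have hc : 0 ≤ a * √(n : ℝ) := by positivity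
    have hlow := exp_le_one_sub_erf hc
    have hpos : 0 < 1 - erf (a * √(n : ℝ)) := (Real.exp_pos _).trans_le hlow
  · have h := Real.log_le_log hpos (one_sub_erf_le hc)
    rw [Real.log_exp, mul_pow, hs] at h
    have h2 := mul_le_mul_of_nonneg_left h (by positivity : 0 ≤ 1 / (n : ℝ))
    have h3 : 1 / (n : ℝ) * -(a ^ 2 * n) = -a ^ 2 := by field_simp
    linarith
  · have h := Real.log_le_log (Real.exp_pos _) hlow
    rw [Real.log_exp] at h
    have h2 := mul_le_mul_of_nonneg_left h (by positivity : 0 ≤ 1 / (n : ℝ))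
    have h3 : 1 / (n : ℝ) * -(a * √(n : ℝ) + 1) ^ 2 = -(a + 1 / √(n : ℝ)) ^ 2 := by
      have : a + 1 / √(n : ℝ) = (a * √(n : ℝ) + 1) / √(n : ℝ) := by field_simp
      rw [this, div_pow, hs]
      ring
    linarith

/-- With `s = exp(-bn)`, the bounds `s/2 ≤ 1 - √(1 - s) ≤ s` squeeze the sequence between `b` and `b
+ (ln 2)/n`. -/
lemma tendsto_log_one_sub_sqrt {b : ℝ} (hb : 0 < b) :
    Tendsto (fun n : ℕ => -(1 / (n : ℝ)) * Real.log (1 - √(1 - Real.exp (-b * n))))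
      atTop (𝓝 b) := by
  have hup : Tendsto (fun n : ℕ => b + Real.log 2 * (1 / (n : ℝ))) atTop (𝓝 b) := by
    simpa using (tendsto_one_div_atTop_nhds_zero_nat.const_mul (Real.log 2)).const_add b
  refine tendsto_of_tendsto_of_tendsto_of_le_of_le' tendsto_const_nhds hup ?_ ?_
  all_goals
    filter_upwards [eventually_gt_atTop 0] with n hn
    have hn' : (0 : ℝ) < n := by exact_mod_cast hn
    set s := Real.exp (-b * n) with hs
    have hs0 : 0 < s := Real.exp_pos _
    have hs1 : s ≤ 1 := by
      rw [hs, Real.exp_le_one_iff]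
      nlinarith
    have hq : √(1 - s) ^ 2 = 1 - s := Real.sq_sqrt (by linarith)
    have hq0 := Real.sqrt_nonneg (1 - s)
    have hlow : s / 2 ≤ 1 - √(1 - s) := by nlinarith [sq_nonneg (1 - √(1 - s))]
    have hpos : 0 < 1 - √(1 - s) := by linarith
  · have hq1 : √(1 - s) ≤ 1 := by linarith
    have hle : 1 - √(1 - s) ≤ s := by nlinarith
    have h := Real.log_le_log hpos hle
    rw [hs, Real.log_exp, ← hs] at h
    have h2 := mul_le_mul_of_nonneg_left h (by positivity : 0 ≤ 1 / (n : ℝ))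
    have h3 : 1 / (n : ℝ) * (-b * n) = -b := by field_simp
    linarith
  · have h := Real.log_le_log (by positivity) hlow
    rw [Real.log_div hs0.ne' two_ne_zero, hs, Real.log_exp, ← hs] at h
    have h2 := mul_le_mul_of_nonneg_left h (by positivity : 0 ≤ 1 / (n : ℝ))
    have h3 : 1 / (n : ℝ) * (-b * n - Real.log 2) = -b - Real.log 2 * (1 / (n : ℝ)) := by
      field_simp
    linarith

end ErrorFunction

/-! ### The law of the sum of the homodyne outcomes -/

section GaussianSums

open ProbabilityTheory

/-- The density of a product of normal distributions with variance one half. -/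
def gaussianProd (a : Fin m → ℝ) (y : Fin m → ℝ) : ℝ :=
  ∏ j, (√Real.pi)⁻¹ * Real.exp (-(y j - a j) ^ 2)

lemma gaussianProd_nonneg (a y : Fin m → ℝ) : 0 ≤ gaussianProd a y :=
  Finset.prod_nonneg fun j _ => by positivity

/-- The sum of independent normal variables with variance one half is normal. -/
lemma map_sum_gaussianProd (a : ℝ) :
    ((volume : Measure (Fin m → ℝ)).withDensity
      fun y => ENNReal.ofReal (gaussianProd (fun _ => a) y)).map (fun y => ∑ j, y j) =
      gaussianReal (m * a) (m * (1 / 2)) := by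
  have hint : Integrable (gaussianProd fun _ : Fin m => a) := integrable_pi_gaussian _
  have hfin : IsFiniteMeasure ((volume : Measure (Fin m → ℝ)).withDensity
      fun y => ENNReal.ofReal (gaussianProd (fun _ => a) y)) :=
    isFiniteMeasure_withDensity hint.lintegral_lt_top.ne
  refine Measure.ext_of_charFun (funext fun t => ?_)
  rw [charFun_gaussianReal, charFun_apply_real, integral_map (by fun_prop)
    (Continuous.aestronglyMeasurable (by fun_prop)), integral_withDensity_eq_integral_toReal_smul₀
    hint.aestronglyMeasurable.aemeasurable.ennreal_ofReal
    (Eventually.of_forall fun v => ENNReal.ofReal_lt_top)]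
  have h1 : ∀ y : Fin m → ℝ, (ENNReal.ofReal (gaussianProd (fun _ => a) y)).toReal •
      Complex.exp (t * ((∑ j, y j : ℝ) : ℂ) * Complex.I) =
      ∏ j, Complex.exp ((t * y j : ℝ) * Complex.I) *
        (((√Real.pi)⁻¹ * Real.exp (-(y j - a) ^ 2) : ℝ) : ℂ) := fun y => by
    rw [ENNReal.toReal_ofReal (gaussianProd_nonneg _ _), Finset.prod_mul_distrib,
      ← Complex.exp_sum, ← Finset.sum_mul, ← Complex.ofReal_sum, ← Finset.mul_sum,
      ← Complex.ofReal_prod, Complex.real_smul, mul_comm, Complex.ofReal_mul]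
    rfl
  simp only [h1]
  rw [integral_fintype_prod_volume_eq_prod (fun (_ : Fin m) (s : ℝ) =>
    Complex.exp ((t * s : ℝ) * Complex.I) * (((√Real.pi)⁻¹ * Real.exp (-(s - a) ^ 2) : ℝ) : ℂ))]
  simp only [integral_cexp_gaussian, Finset.prod_const, ← Complex.exp_nat_mul]
  congr 1
  simp
  ring

/-- Variance one half gives the density `π^{-1/2} exp(-t²)`, whose tail is the complementary error
function; shift and reflect. -/
lemma gaussianReal_Iic_zero {b : ℝ} :
    (gaussianReal b (1 / 2)).real (Set.Iic 0) = 1 / 2 * (1 - erf b) := by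
  have h1 : gaussianReal b (1 / 2) = (gaussianReal 0 (1 / 2)).map (b + ·) := by
    rw [gaussianReal_map_const_add, zero_add]
  have h2 : (b + ·) ⁻¹' Set.Iic (0 : ℝ) = Set.Iic (-b) := by
    ext x
    simp only [Set.mem_preimage, Set.mem_Iic]
    constructor <;> intro h <;> linarith
  have h3 : ∀ x : ℝ, gaussianPDFReal 0 (1 / 2) x = (√Real.pi)⁻¹ * Real.exp (-(-x) ^ 2) := fun x => by
    rw [gaussianPDFReal]
    congr 2
    · push_cast; ring_nf
    · push_cast; ring
  rw [h1, measureReal_def, Measure.map_apply (by fun_prop) measurableSet_Iic, h2,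
    gaussianReal_apply_eq_integral _ (by norm_num), ENNReal.toReal_ofReal
      (setIntegral_nonneg measurableSet_Iic fun x _ => gaussianPDFReal_nonneg _ _ _)]
  simp only [h3]
  rw [integral_comp_neg_Iic (-b) (fun x => (√Real.pi)⁻¹ * Real.exp (-x ^ 2)), neg_neg,
    integral_const_mul, one_sub_erf]
  ring

/-- The distribution is the image of one with variance one half under multiplication by `√m > 0`,
which preserves the half line. -/
lemma gaussianReal_mul_Iic_zero (hm : 0 < m) (a : ℝ) :
    (gaussianReal (m * a) (m * (1 / 2))).real (Set.Iic 0) = 1 / 2 * (1 - erf (a * √m)) := by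
  have hm' : (0 : ℝ) < m := by exact_mod_cast hm
  have hs : √(m : ℝ) ^ 2 = m := Real.sq_sqrt hm'.le
  have hs0 : 0 < √(m : ℝ) := Real.sqrt_pos.2 hm'
  have h1 : gaussianReal (m * a) (m * (1 / 2)) =
      (gaussianReal (a * √m) (1 / 2)).map (√(m : ℝ) * ·) := by
    rw [gaussianReal_map_const_mul]
    congr 1
    · rw [mul_comm a, ← mul_assoc, ← sq, hs]
    · congr 1
      ext
      simp [hs]
  have h2 : (√(m : ℝ) * ·) ⁻¹' Set.Iic (0 : ℝ) = Set.Iic 0 := by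
    ext x
    simp only [Set.mem_preimage, Set.mem_Iic]
    constructor
    · intro h
      by_contra hx
      push Not at hx
      nlinarith [mul_pos hs0 hx]
    · intro h
      nlinarith
  rw [h1, map_measureReal_apply (by fun_prop) measurableSet_Iic, h2, gaussianReal_Iic_zero]

/-- The half space of positive sums. -/
def positiveSum (m : ℕ) : Set (Fin m → ℝ) := {y | 0 < ∑ j, y j}

lemma measurableSet_positiveSum (m : ℕ) : MeasurableSet (positiveSum m) :=
  measurableSet_lt measurable_const (by fun_prop)

lemma integral_indicator_gaussianProd {B : Set ℝ} (hB : MeasurableSet B) (a : ℝ) :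
    ∫ y : Fin m → ℝ, {y : Fin m → ℝ | ∑ j, y j ∈ B}.indicator (gaussianProd fun _ => a) y =
      (gaussianReal (m * a) (m * (1 / 2))).real B := by
  have hs : Measurable fun y : Fin m → ℝ => ∑ j, y j := by fun_prop
  have hint : Integrable (gaussianProd fun _ : Fin m => a) := integrable_pi_gaussian _
  have hB' : MeasurableSet {y : Fin m → ℝ | ∑ j, y j ∈ B} := hs hB
  rw [← map_sum_gaussianProd, map_measureReal_apply hs hB, integral_indicator hB', measureReal_def,
    withDensity_apply _ (hs hB), ← ofReal_integral_eq_lintegral_ofReal hint.integrableOn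
      (Eventually.of_forall fun y => gaussianProd_nonneg _ _), ENNReal.toReal_ofReal
      (integral_nonneg fun y => gaussianProd_nonneg _ _)]
  rfl

/-- Reflection at the origin; the end point `0` is negligible since the variance is positive for `m
> 0`. It makes the two error terms of the sign test equal. -/
lemma gaussianReal_neg_Ioi_zero (hm : 0 < m) (a : ℝ) :
    (gaussianReal (m * -a) (m * (1 / 2))).real (Set.Ioi 0) =
      (gaussianReal (m * a) (m * (1 / 2))).real (Set.Iic 0) := by
  have hv : (m * (1 / 2) : NNReal) ≠ 0 := by
    have : (m : NNReal) ≠ 0 := by exact_mod_cast hm.ne'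
    positivity
  have := nullSingletonClass_gaussianReal (μ := m * a) hv
  have h2 : (fun x : ℝ => -x) ⁻¹' Set.Ioi 0 = Set.Iio 0 := by ext x; simp
  rw [mul_neg, ← gaussianReal_map_neg, map_measureReal_apply (by fun_prop) measurableSet_Ioi, h2]
  exact measureReal_congr Iio_ae_eq_Iic

end GaussianSums

end

section

variable {m k n : ℕ}

/-! ### Exact distances for the states `|±a⟩^{⊗m}` -/

section RealCoherentStates

lemma coherentDensity_real (a : ℝ) (z : Phase m) :
    coherentDensity (fun _ => (a : ℂ)) z =
      gaussianProd (fun _ => √2 * a) z.1 * gaussianProd (fun _ => 0) z.2 := by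
  simp [coherentDensity, gaussianProd]

lemma gaussianProd_const (a : ℝ) (y : Fin m → ℝ) :
    gaussianProd (fun _ => a) y = (√Real.pi)⁻¹ ^ m * Real.exp (-∑ j, (y j - a) ^ 2) := by
  simp only [gaussianProd, Finset.prod_mul_distrib, Finset.prod_const, Finset.card_univ,
    Fintype.card_fin, ← Real.exp_sum, Finset.sum_neg_distrib]

/-- The log-likelihood ratio of the two product Gaussians is `4a ∑ yⱼ`. -/
lemma gaussianProd_neg_le {a : ℝ} {y : Fin m → ℝ} (h : 0 ≤ a * ∑ j, y j) :
    gaussianProd (fun _ => -a) y ≤ gaussianProd (fun _ => a) y := by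
  rw [gaussianProd_const, gaussianProd_const]
  refine mul_le_mul_of_nonneg_left (Real.exp_le_exp.2 ?_) (by positivity)
  have h1 : ∑ j, (y j - -a) ^ 2 - ∑ j, (y j - a) ^ 2 = 4 * (a * ∑ j, y j) := by
    rw [← Finset.sum_sub_distrib, Finset.mul_sum, Finset.mul_sum]
    exact Finset.sum_congr rfl fun j _ => by ring
  linarith

/-- Deciding by the sign of the sum of the positions attains the classical error probability of
the Wigner functions of `|a⟩^{⊗m}` and `|-a⟩^{⊗m}`, since these are ordered by that sign. -/
lemma integral_min_coherentDensity {a : ℝ} (ha : 0 ≤ a) :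
    2 * errorProb (pureState (coherent fun _ : Fin m => (a : ℂ)))
      (pureState (coherent fun _ => ((-a : ℝ) : ℂ)))
      (homodyneTest (positiveSum m) (measurableSet_positiveSum m)) =
      ∫ z : Phase m, min (coherentDensity (fun _ => (a : ℂ)) z)
        (coherentDensity (fun _ => ((-a : ℝ) : ℂ)) z) := by
  have hA := measurableSet_positiveSum m
  have h0 := (isWignerFunction_homodyneTest hA.compl).re_inner_coherent fun _ => (a : ℂ)
  have h1 := (isWignerFunction_homodyneTest hA).re_inner_coherent fun _ => ((-a : ℝ) : ℂ)
  rw [errorProb_pureState, one_sub_homodyneTest, h0.2, h1.2, ← mul_assoc, mul_add]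
  have e : ∀ x y : ℝ, 2 * (1 / 2 * ((2 * Real.pi) ^ m * x)) +
      2 * (1 / 2 * ((2 * Real.pi) ^ m * y)) = (2 * Real.pi) ^ m * (x + y) := fun x y => by ring
  rw [mul_assoc, e, ← integral_add h0.1 h1.1, ← integral_const_mul]
  refine integral_congr_ae (Eventually.of_forall fun z => ?_)
  -- The momentum factors of the two densities coincide, so the sign of the position sum alone
  -- decides which is smaller.
  have hle : 0 ≤ ∑ j, z.1 j → coherentDensity (fun _ => ((-a : ℝ) : ℂ)) z ≤
      coherentDensity (fun _ => (a : ℂ)) z := fun hz => by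
    rw [coherentDensity_real, coherentDensity_real, mul_neg]
    exact mul_le_mul_of_nonneg_right (gaussianProd_neg_le (by positivity))
      (gaussianProd_nonneg _ _)
  have hge : ∑ j, z.1 j ≤ 0 → coherentDensity (fun _ => (a : ℂ)) z ≤
      coherentDensity (fun _ => ((-a : ℝ) : ℂ)) z := fun hz => by
    rw [coherentDensity_real, coherentDensity_real, mul_neg]
    refine mul_le_mul_of_nonneg_right ?_ (gaussianProd_nonneg _ _)
    have h := gaussianProd_neg_le (a := -(√2 * a)) (y := z.1) (by
      rw [neg_mul, ← mul_neg]
      exact mul_nonneg (by positivity) (by linarith))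
    simpa only [neg_neg] using h
  have hpi : (2 * Real.pi) ^ m ≠ 0 := by positivity
  by_cases hz : z.1 ∈ positiveSum m
  · simp only [homodyneWigner, Set.indicator_of_mem hz,
      Set.indicator_of_notMem (Set.notMem_compl_iff.2 hz), min_eq_right (hle (le_of_lt hz))]
    rw [zero_mul, zero_add, mul_inv_cancel_left₀ hpi]
  · simp only [homodyneWigner, Set.indicator_of_notMem hz,
      Set.indicator_of_mem (Set.mem_compl hz), min_eq_left (hge (not_lt.1 hz))]
    rw [zero_mul, add_zero, mul_inv_cancel_left₀ hpi]

/-- The momentum Gaussian integrates to one, leaving the probability that a sum of independent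
normal positions lies in `B`. -/
lemma re_inner_homodyneTest_coherent {B : Set ℝ} (hB : MeasurableSet B)
    (hA : MeasurableSet {y : Fin m → ℝ | ∑ j, y j ∈ B}) (a : ℝ) :
    (⟪coherent fun _ => (a : ℂ), homodyneTest _ hA (coherent fun _ => (a : ℂ))⟫_ℂ).re =
      (ProbabilityTheory.gaussianReal (m * (√2 * a)) (m * (1 / 2))).real B := by
  rw [((isWignerFunction_homodyneTest hA).re_inner_coherent _).2, ← integral_const_mul,
    ← integral_indicator_gaussianProd hB]
  have h := integral_prod_mul (μ := (volume : Measure (Fin m → ℝ)))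
    (ν := (volume : Measure (Fin m → ℝ)))
    ({y : Fin m → ℝ | ∑ j, y j ∈ B}.indicator (gaussianProd fun _ => √2 * a))
    (gaussianProd fun _ => 0)
  rw [show ∫ y : Fin m → ℝ, gaussianProd (fun _ => 0) y = 1 from integral_pi_gaussian _,
    mul_one] at h
  rw [← h]
  refine integral_congr_ae (Eventually.of_forall fun z => ?_)
  have hpi : (2 * Real.pi) ^ m ≠ 0 := by positivity
  simp only [homodyneWigner, coherentDensity_real]
  by_cases hz : z.1 ∈ {y : Fin m → ℝ | ∑ j, y j ∈ B}
  · rw [Set.indicator_of_mem hz, Set.indicator_of_mem hz, mul_inv_cancel_left₀ hpi]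
  · rw [Set.indicator_of_notMem hz, Set.indicator_of_notMem hz, zero_mul, zero_mul, mul_zero]

/-- The error probability of homodyne detection for the coherent states `|±a⟩^{⊗m}`. -/
lemma errorProb_homodyneTest_positiveSum (hm : 0 < m) (a : ℝ) :
    errorProb (pureState (coherent fun _ : Fin m => (a : ℂ)))
      (pureState (coherent fun _ => ((-a : ℝ) : ℂ)))
      (homodyneTest (positiveSum m) (measurableSet_positiveSum m)) =
      1 / 2 * (1 - erf (a * √2 * √m)) := by
  have hc : {y : Fin m → ℝ | ∑ j, y j ∈ Set.Iic 0} = (positiveSum m)ᶜ := by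
    ext y
    simp [positiveSum]
  have h0 := re_inner_homodyneTest_coherent (m := m) measurableSet_Iic
    (hc ▸ (measurableSet_positiveSum m).compl) a
  have h1 := re_inner_homodyneTest_coherent (m := m) measurableSet_Ioi
    (measurableSet_positiveSum m) (-a)
  simp only [hc] at h0
  rw [mul_neg, gaussianReal_neg_Ioi_zero hm] at h1
  rw [errorProb_pureState, one_sub_homodyneTest, h0]
  erw [h1]
  rw [gaussianReal_mul_Iic_zero hm, mul_comm √2 a]
  ring

/-- A set of measurements that contains homodyne detection and is no better at distinguishing
`|±a⟩^{⊗m}` than their Wigner functions are classically distinguishable. -/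
lemma restrictedNorm_coherent (hm : 0 < m) {a : ℝ} (ha : 0 ≤ a)
    {𝕄 : Set (Modes m →L[ℂ] Modes m)}
    (hmem : homodyneTest (positiveSum m) (measurableSet_positiveSum m) ∈ 𝕄)
    (hle : ∀ M ∈ 𝕄, ∫ z : Phase m, min (coherentDensity (fun _ => (a : ℂ)) z)
        (coherentDensity (fun _ => ((-a : ℝ) : ℂ)) z) ≤
      2 * errorProb (pureState (coherent fun _ : Fin m => (a : ℂ)))
        (pureState (coherent fun _ => ((-a : ℝ) : ℂ))) M) :
    1 / 2 * restrictedNorm 𝕄 (pureState (coherent fun _ : Fin m => (a : ℂ)))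
      (pureState (coherent fun _ => ((-a : ℝ) : ℂ))) = erf (a * √2 * √m) := by
  have hleast : IsLeast (errorProb (pureState (coherent fun _ : Fin m => (a : ℂ)))
      (pureState (coherent fun _ => ((-a : ℝ) : ℂ))) '' 𝕄) (1 / 2 * (1 - erf (a * √2 * √m))) := by
    refine ⟨⟨_, hmem, errorProb_homodyneTest_positiveSum hm a⟩, ?_⟩
    rintro _ ⟨M, hM, rfl⟩
    have h := hle M hM
    rw [← integral_min_coherentDensity ha, errorProb_homodyneTest_positiveSum hm] at h
    linarith
  rw [restrictedNorm, hleast.csInf_eq]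
  ring

lemma integrable_min_coherentDensity (β γ : Fin m → ℂ) :
    Integrable fun z => min (coherentDensity β z) (coherentDensity γ z) :=
  (integrable_coherentDensity β).inf (integrable_coherentDensity γ)

lemma restrictedNorm_GOCC_coherent (hm : 0 < m) {a : ℝ} (ha : 0 ≤ a) :
    1 / 2 * restrictedNorm (GOCC m) (pureState (coherent fun _ : Fin m => (a : ℂ)))
      (pureState (coherent fun _ => ((-a : ℝ) : ℂ))) = erf (a * √2 * √m) :=
  restrictedNorm_coherent hm ha (homodyneTest_mem_GOCC _) fun _ hM =>
    integral_le_of_mem_GOCC hM (isWignerDensity_coherent _) (isWignerDensity_coherent _)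
      (integrable_min_coherentDensity _ _) (Eventually.of_forall fun _ => min_le_left _ _)
      (Eventually.of_forall fun _ => min_le_right _ _)

lemma restrictedNorm_WPlus_coherent (hm : 0 < m) {a : ℝ} (ha : 0 ≤ a) :
    1 / 2 * restrictedNorm (WPlus m) (pureState (coherent fun _ : Fin m => (a : ℂ)))
      (pureState (coherent fun _ => ((-a : ℝ) : ℂ))) = erf (a * √2 * √m) :=
  restrictedNorm_coherent hm ha (homodyneTest_mem_WPlus _) fun _ hM =>
    integral_le_of_mem_WPlus hM (integrable_min_coherentDensity _ _)
      (fun _ => min_le_left _ _) (fun _ => min_le_right _ _)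

/-- Real amplitudes displace only positions, so no Weyl phase arises. -/
lemma displacement_coherent_real (a b : ℝ) :
    displacement (fun _ : Fin m => (b : ℂ)) (coherent fun _ => (a : ℂ)) =
      coherent fun _ => ((a + b : ℝ) : ℂ) := by
  apply Lp.ext
  refine (displacement_coeFn_of_ae _ (coherent_coeFn _)).trans
    (EventuallyEq.trans (Eventually.of_forall fun y => ?_) (coherent_coeFn _).symm)
  simp only [weylPhase_eq_prod, coherentFun, ← Finset.prod_mul_distrib]
  refine Finset.prod_congr rfl fun j _ => ?_
  have e : y j - √2 * b - √2 * a = y j - √2 * (a + b) := by ring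
  have e' : (y j - √2 * b - √2 * a : ℂ) = y j - √2 * (a + b) := by exact_mod_cast e
  simp [coherentWave, e']

/-- As `|-a⟩ = D(-2a)|a⟩`, the overlap is a value of the characteristic function of `|a⟩`, of
modulus `exp(-(2√2 a)²/4) = exp(-2a²)` per mode. -/
lemma norm_inner_coherent_neg (a : ℝ) :
    ‖⟪coherent fun _ : Fin m => (a : ℂ), coherent fun _ => ((-a : ℝ) : ℂ)⟫_ℂ‖ =
      Real.exp (-2 * a ^ 2 * m) := by
  have h : (coherent fun _ : Fin m => ((-a : ℝ) : ℂ)) =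
      displacement (fun _ => ((-2 * a : ℝ) : ℂ)) (coherent fun _ => (a : ℂ)) := by
    rw [displacement_coherent_real]
    congr 1
    ext
    congr 1
    ring
  rw [h, inner_coherent_displacement]
  simp only [norm_pow, norm_mul, Complex.norm_exp, Finset.prod_const, Finset.card_univ,
    Fintype.card_fin]
  rw [← Real.exp_add, ← Real.exp_nat_mul]
  congr 1
  have h3 : ((a : ℂ) ^ 2).re = a ^ 2 := by norm_cast
  have h4 : ((a : ℂ) ^ 2).im = 0 := by norm_cast
  norm_cast
  simp [mul_pow]
  ring_nf
  rw [h3, h4]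
  norm_num
  ring

lemma traceNorm_coherent (hm : 0 < m) {a : ℝ} (ha : 0 < a) :
    1 / 2 * traceNorm (pureState (coherent fun _ : Fin m => (a : ℂ)) -
      pureState (coherent fun _ => ((-a : ℝ) : ℂ))) = √(1 - Real.exp (-(4 * a ^ 2) * m)) := by
  have hm' : (0 : ℝ) < m := by exact_mod_cast hm
  rw [traceNorm_pureState_sub (norm_coherent _) (norm_coherent _), norm_inner_coherent_neg,
    ← Real.exp_nat_mul, ← mul_assoc, one_div, inv_mul_cancel₀ two_ne_zero, one_mul]
  · congr 3
    push_cast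
    ring
  · rw [norm_inner_coherent_neg, Real.exp_lt_one_iff]
    have := mul_pos (pow_pos ha 2) hm'
    linarith

end RealCoherentStates

end

end Bosonic

end

/-! ### Assembly of the theorem -/

theorem mainTheorem5 (α : ℝ) (hα : 0 < α)
    (ψ₀ ψ₁ : Bosonic.Modes 1)
    (hψ₀ : ψ₀ = Bosonic.coherent (fun _ => (α : ℂ)))
    (hψ₁ : ψ₁ = Bosonic.coherent (fun _ => -(α : ℂ)))
    (ρ₀ ρ₁ : Bosonic.Modes 1 →L[ℂ] Bosonic.Modes 1)
    (hρ₀ : ρ₀ = Bosonic.pureState ψ₀) (hρ₁ : ρ₁ = Bosonic.pureState ψ₁) :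
    -- single copy: trace distance, GOCC distance, W+ distance
    1 / 2 * Bosonic.traceNorm (ρ₀ - ρ₁) = √(1 - Real.exp (-4 * α ^ 2)) ∧
    1 / 2 * Bosonic.restrictedNorm (Bosonic.GOCC 1) ρ₀ ρ₁ = Bosonic.erf (α * √2) ∧
    1 / 2 * Bosonic.restrictedNorm (Bosonic.WPlus 1) ρ₀ ρ₁ = Bosonic.erf (α * √2) ∧
    -- both are attained by homodyning the x-quadrature and deciding by the sign of the outcome
    (∃ hA : MeasurableSet {y : Fin 1 → ℝ | 0 < y 0},
      (∃ R : ℕ, Bosonic.GOCCProtocol R 1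
        ![Bosonic.homodyneTest _ hA, 1 - Bosonic.homodyneTest _ hA]) ∧
      Bosonic.homodyneTest _ hA ∈ Bosonic.GOCC 1 ∧
      Bosonic.homodyneTest _ hA ∈ Bosonic.WPlus 1 ∧
      Bosonic.errorProb ρ₀ ρ₁ (Bosonic.homodyneTest _ hA) =
        1 / 2 * (1 - Bosonic.erf (α * √2))) ∧
    -- Chernoff coefficients
    Bosonic.IsChernoffCoefficient (fun _ σ₀ σ₁ => Bosonic.traceNorm (σ₀ - σ₁)) ψ₀ ψ₁
      (4 * |α| ^ 2) ∧
    -Real.log (Bosonic.fidelity ρ₀ ρ₁ ^ 2) = 4 * |α| ^ 2 ∧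
    Bosonic.IsChernoffCoefficient (fun n => Bosonic.restrictedNorm (Bosonic.GOCC n)) ψ₀ ψ₁
      (2 * |α| ^ 2) ∧
    Bosonic.IsChernoffCoefficient (fun n => Bosonic.restrictedNorm (Bosonic.WPlus n)) ψ₀ ψ₁
      (2 * |α| ^ 2) ∧
    -- the latter two are attained by homodyning every mode separately in the x-direction,
    -- followed by classical post-processing
    (∃ (A : (n : ℕ) → Set (Fin n → ℝ)) (hA : ∀ n, MeasurableSet (A n)),
      (∀ n, Bosonic.homodyneTest (A n) (hA n) ∈ Bosonic.GOCC n ∧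
        Bosonic.homodyneTest (A n) (hA n) ∈ Bosonic.WPlus n) ∧
      Tendsto (fun n : ℕ => -(1 / (n : ℝ)) * Real.log (2 * Bosonic.errorProb
        (Bosonic.pureState (Bosonic.tensorPower ψ₀ n))
        (Bosonic.pureState (Bosonic.tensorPower ψ₁ n))
        (Bosonic.homodyneTest (A n) (hA n)))) atTop (𝓝 (2 * |α| ^ 2))) := by
  have hneg : ∀ n : ℕ, (fun _ : Fin n => -(α : ℂ)) = fun _ => ((-α : ℝ) : ℂ) := fun n => by
    ext; push_cast; rfl
  have hp₀ : ∀ n, Bosonic.tensorPower ψ₀ n = Bosonic.coherent fun _ => (α : ℂ) := fun n => by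
    rw [hψ₀, Bosonic.tensorPower_coherent]
  have hp₁ : ∀ n, Bosonic.tensorPower ψ₁ n = Bosonic.coherent fun _ => ((-α : ℝ) : ℂ) := fun n => by
    rw [hψ₁, Bosonic.tensorPower_coherent, hneg]
  rw [hneg] at hψ₁
  rw [hρ₀, hρ₁]
  have hset : Bosonic.positiveSum 1 = {y : Fin 1 → ℝ | 0 < y 0} := by
    ext y
    simp [Bosonic.positiveSum]
  have hsq : (α * √2) ^ 2 = 2 * |α| ^ 2 := by
    rw [mul_pow, Real.sq_sqrt zero_le_two, sq_abs, mul_comm]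
  have hlim := Bosonic.tendsto_log_one_sub_erf (a := α * √2) (by positivity)
  rw [hsq] at hlim
  -- GOCC and W+ obey the same closed formula and hence share one limit argument; the formula for `n
  -- > 0` suffices for the limit.
  have hrestricted : ∀ 𝕄 : (n : ℕ) → Set (Bosonic.Modes n →L[ℂ] Bosonic.Modes n),
      (∀ n, 0 < n → 1 / 2 * Bosonic.restrictedNorm (𝕄 n)
        (Bosonic.pureState (Bosonic.coherent fun _ : Fin n => (α : ℂ)))
        (Bosonic.pureState (Bosonic.coherent fun _ => ((-α : ℝ) : ℂ))) = Bosonic.erf (α * √2 * √n)) →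
      Bosonic.IsChernoffCoefficient (fun n => Bosonic.restrictedNorm (𝕄 n)) ψ₀ ψ₁ (2 * |α| ^ 2) := fun 𝕄 h => by
    refine hlim.congr' ?_
    filter_upwards [eventually_gt_atTop 0] with n hn
    rw [hp₀, hp₁, h n hn]
  refine ⟨?_, ?_, ?_, ?_, ?_, ?_, hrestricted Bosonic.GOCC fun n hn => Bosonic.restrictedNorm_GOCC_coherent hn hα.le,
    hrestricted Bosonic.WPlus fun n hn => Bosonic.restrictedNorm_WPlus_coherent hn hα.le,
    Bosonic.positiveSum, Bosonic.measurableSet_positiveSum,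
    fun n => ⟨Bosonic.homodyneTest_mem_GOCC _, Bosonic.homodyneTest_mem_WPlus _⟩, hlim.congr' ?_⟩
  · rw [hψ₀, hψ₁, Bosonic.traceNorm_coherent one_pos hα, Nat.cast_one, mul_one, neg_mul]
  · rw [hψ₀, hψ₁, Bosonic.restrictedNorm_GOCC_coherent one_pos hα.le, Nat.cast_one, Real.sqrt_one, mul_one]
  · rw [hψ₀, hψ₁, Bosonic.restrictedNorm_WPlus_coherent one_pos hα.le, Nat.cast_one, Real.sqrt_one, mul_one]
  · refine ⟨hset ▸ Bosonic.measurableSet_positiveSum 1, ⟨1, Bosonic.goccProtocol_homodyneTest _⟩,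
      Bosonic.homodyneTest_mem_GOCC _, Bosonic.homodyneTest_mem_WPlus _, ?_⟩
    have h := Bosonic.errorProb_homodyneTest_positiveSum one_pos α
    rw [Nat.cast_one, Real.sqrt_one, mul_one] at h
    simp only [hset] at h
    rw [hψ₀, hψ₁, h]
  · refine (Bosonic.tendsto_log_one_sub_sqrt (b := 4 * |α| ^ 2) (by positivity)).congr' ?_
    filter_upwards [eventually_gt_atTop 0] with n hn
    rw [hp₀, hp₁, Bosonic.traceNorm_coherent hn hα, sq_abs]
  · rw [hψ₀, hψ₁, Bosonic.fidelity_pureState (Bosonic.norm_coherent _) (Bosonic.norm_coherent _), Bosonic.norm_inner_coherent_neg,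
      Real.log_pow, Real.log_exp, sq_abs]
    push_cast
    ring
  · filter_upwards [eventually_gt_atTop 0] with n hn
    rw [hp₀, hp₁, Bosonic.errorProb_homodyneTest_positiveSum hn, ← mul_assoc, mul_one_div,
      div_self two_ne_zero, one_mul]
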